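/- Let $\mathbb H$ be the hyperbolic plane and let $a,b$ be orientation-preserving isometries of $\mathbb H$; write $\bar a=a^{-1}$, $\bar b=b^{-1}$. Assume that there are four closed half-planes $D(a),D(\bar b),D(b),D(\bar a)$ of $\mathbb H$, pairwise disjoint together with their ideal boundary arcs and occurring in this cyclic anticlockwise order along the boundary at infinity (so $D(a)$ and $D(\bar a)$ are side by side), such that $a(D(\bar a))=\mathbb H\setminus \mathring D(a)$ and $b(D(\bar b))=\mathbb H\setminus\mathring D(b)$. Then $\Gamma=\langle a,b\rangle$ is a Schottky group and $P=\mathbb H/\Gamma$ is a pair of pants. Let $n\ge 1$, let $i_1,j_1,\dots,i_n,j_n\geq 1$ be integers, let $s_k\in\{a,\bar a\}$, $r_k\in\{b,\bar b\}$ for $1\le k\le n$, and let $\gamma$ be the closed geodesic of $P$ with word $w=s_1^{i_1}r_1^{j_1}\cdots s_n^{i_n}r_n^{j_n}$, that is, the oriented closed geodesic $\gamma:\mathbb R/\ell\mathbb Z\to P$ which lifts to the unit-speed axis $c:\mathbb R\to\mathbb H$ of $w$, where $w\,c(t)=c(t+\ell)$ for all $t$ and $\ell>0$ is the translation length of $w$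 ($w$ may be a proper power). Let $L(\gamma)=\sum_{k=1}^n(i_k+j_k)$ be its combinatorial length, and let $i(\gamma;\gamma)$ be its number of transverse self-intersections, i.e. the number of unordered pairs $\{s,t\}$ of distinct elements of $\mathbb R/\ell\mathbb Z$ such that $\gamma(s)=\gamma(t)$ and such that the two branches of $\gamma$ at this point lie along different geodesic lines. (Thus $i(\gamma_0^m;\gamma_0^m)=m^2\,i(\gamma_0;\gamma_0)$.) If $\gamma$ is non-simple, i.e. if two distinct lifts of $\gamma$ to $\mathbb H$ (two distinct lines among the translates $g\,c(\mathbb R)$, $g\in\Gamma$) intersect, then $i(\gamma;\gamma)$ is finite and $$L(\gamma)-n-1\;\le\; i(\gamma;\gamma)\;\le\; nL(\gamma)-n^2 .$$ -/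

import Mathlib

open scoped MatrixGroups UpperHalfPlane Pointwise

namespace Pants

/-- The closed Euclidean half-disk of the upper half-plane with centre `x` on the real axis and
radius `r`; its boundary circle is orthogonal to the real axis. -/
def halfDisk (x r : ℝ) : Set ℍ := {z | dist (z : ℂ) (x : ℂ) ≤ r}

/-- The interior of `halfDisk x r`. -/
def openHalfDisk (x r : ℝ) : Set ℍ := {z | dist (z : ℂ) (x : ℂ) < r}

/-- Four half-disks `D(a), D(b⁻¹), D(b), D(a⁻¹)`, disjoint together with their ideal boundary arcs
and met in this cyclic order along the boundary at infinity, with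
`a (D(a⁻¹)) = ℍ - int D(a)` and `b (D(b⁻¹)) = ℍ - int D(b)`.

The half-disks are `h • halfDisk x r`; the isometry `h` chooses the coordinate of the hyperbolic
plane in such a way that the ideal point `∞` lies between the arcs of `D(a⁻¹)` and `D(a)`. -/
def IsPantsPair (a b : SL(2, ℝ)) : Prop :=
  ∃ (h : SL(2, ℝ)) (xa ra xb' rb' xb rb xa' ra' : ℝ),
    0 < ra ∧ 0 < rb' ∧ 0 < rb ∧ 0 < ra' ∧
    xa + ra < xb' - rb' ∧ xb' + rb' < xb - rb ∧ xb + rb < xa' - ra' ∧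
    a • (h • halfDisk xa' ra') = (h • openHalfDisk xa ra)ᶜ ∧
    b • (h • halfDisk xb' rb') = (h • openHalfDisk xb rb)ᶜ

/-- The group `Γ = ⟨a, b⟩`; the pair of pants is `P = ℍ / Γ`. -/
def group (a b : SL(2, ℝ)) : Subgroup SL(2, ℝ) := Subgroup.closure {a, b}

/-- The point `i eᵗ` of the imaginary half-axis. -/
noncomputable def axisPoint (t : ℝ) : ℍ := ⟨⟨0, Real.exp t⟩, Real.exp_pos t⟩

/-- Complete unit-speed oriented geodesics of the hyperbolic plane: the images of `t ↦ i eᵗ` under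
orientation preserving isometries. -/
def IsGeodesic (c : ℝ → ℍ) : Prop := ∃ M : SL(2, ℝ), ∀ t, c t = M • axisPoint t

/-- The group element spelled by the word `s₁^{i₁} r₁^{j₁} ⋯ sₙ^{iₙ} rₙ^{jₙ}`, where
`s k ∈ {a, a⁻¹}` and `r k ∈ {b, b⁻¹}` are given by the signs `σ k` and `τ k`. -/
def word (a b : SL(2, ℝ)) {n : ℕ} (σ τ : Fin n → ℤˣ) (i j : Fin n → ℕ) : SL(2, ℝ) :=
  (List.ofFn fun k => (a ^ (σ k : ℤ)) ^ i k * (b ^ (τ k : ℤ)) ^ j k).prod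

/-- The combinatorial length of the word. -/
def combLength {n : ℕ} (i j : Fin n → ℕ) : ℕ := ∑ k, (i k + j k)

/-- `c` is a lift of the closed geodesic of `ℍ / Γ` of length `ℓ` with word `w`: the isometry `w`
translates the geodesic `c` by `ℓ > 0` in the positive direction. -/
def IsClosedGeodesicLift (w : SL(2, ℝ)) (c : ℝ → ℍ) (ℓ : ℝ) : Prop :=
  IsGeodesic c ∧ 0 < ℓ ∧ ∀ t, w • c t = c (t + ℓ)

/-- The closed geodesic of `ℍ / Γ` with lift `c` is non-simple: two distinct lifts of it meet. -/
def NonSimple (Γ : Subgroup SL(2, ℝ)) (c : ℝ → ℍ) : Prop :=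
  ∃ g ∈ Γ, g • Set.range c ≠ Set.range c ∧ (g • Set.range c ∩ Set.range c).Nonempty

/-- The self-intersections of the closed geodesic `ℝ / ℓℤ → ℍ / Γ` with lift `c`: the unordered
pairs of parameters `{s, t}` in `ℝ / ℓℤ`, represented by `0 ≤ s < t < ℓ`, at which it passes through
the same point of `ℍ / Γ` along two different lines. -/
def selfIntersections (Γ : Subgroup SL(2, ℝ)) (c : ℝ → ℍ) (ℓ : ℝ) : Set (ℝ × ℝ) :=
  {p | 0 ≤ p.1 ∧ p.1 < p.2 ∧ p.2 < ℓ ∧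
    ∃ g ∈ Γ, g • c p.1 = c p.2 ∧ g • Set.range c ≠ Set.range c}

end Pants

/-! In the Cayley tree of the free group, a lift of the geodesic is the bi-infinite periodic reduced
word of `w`, and its two ends lie in the ping-pong intervals named by its letters. Two lifts cross
exactly when their ends are linked on the boundary circle (`entryProd_inv_mul_neg_iff`), and then
their tree axes share a vertex (`exists_δ`). A self-intersection is therefore a pair of vertices of
the cyclic word, up to sliding along the common segment of the two tree axes. Whether such a pair
crosses is decided by the cyclic order of the directions at the two ends of that segment.

Let `2m` be the number of sign changes of the word, that is, of passages between a generator and an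
inverse, and let `X` be the number of self-intersections. Every common segment of a crossing has two
ends, which coincide if the segment is a single vertex. A pair of vertices sees at most `endBound`
ends, a number that depends only on the pairs of directions of the two lines there. Summation gives
`X ≤ n (L - 2n) + m² + 2m (n - m) = nL - n² - (n - m)²`.

For the lower bound, `L - n - 1 = (L - 2n) + (n - 1)`. Each of the `L - 2n` straight vertices gives
a crossing of a block of equal letters with a shift of itself (`parallel_self`). Further, `m²`
crossings have a single common vertex, and others run along a segment that starts in two different
blocks. If there are sign changes, at least `n - 2m` crossings are of the last kind, and `n - 2m +
m² ≥ n - 1`. If there are none, each shift by `2s` blocks, `0 < s < n`, gives one, unless all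
exponents are `1`. In that exceptional case the upper bound is `0`, which contradicts
non-simplicity. The crossings are distinct because the action is free and the initial vertex of a
common segment is unique (`BackEnd.unique`). -/

namespace Pants

/-! ### Crossings of the imaginary half-axis with its translates -/

lemma smul_axisPoint_eq_iff (K : SL(2, ℝ)) (s t : ℝ) :
    K • axisPoint s = axisPoint t ↔
      K 0 1 = -(K 1 0 * (Real.exp s * Real.exp t)) ∧ K 0 0 * Real.exp s = K 1 1 * Real.exp t := by
  have hden : ((K 1 0 : ℝ) : ℂ) * (axisPoint s : ℂ) + ((K 1 1 : ℝ) : ℂ) ≠ 0 := by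
    have := UpperHalfPlane.denom_ne_zero (K : GL (Fin 2) ℝ) (axisPoint s)
    simpa [UpperHalfPlane.denom] using this
  rw [UpperHalfPlane.ext_iff, UpperHalfPlane.coe_specialLinearGroup_apply]
  simp only [Algebra.algebraMap_self, RingHom.id_apply]
  rw [div_eq_iff hden, Complex.ext_iff]
  simp only [axisPoint, Complex.add_re, Complex.mul_re, Complex.ofReal_re, Complex.ofReal_im,
    Complex.add_im, Complex.mul_im]
  constructor
  · rintro ⟨h1, h2⟩
    constructor <;> linarith
  · rintro ⟨h1, h2⟩
    constructor <;> linarith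

/-- The product of the four entries of `K`; it is negative exactly when `K` maps the imaginary
half-axis to a line crossing it. -/
def entryProd (K : SL(2, ℝ)) : ℝ := K 0 0 * K 0 1 * K 1 0 * K 1 1

lemma det_eq (K : SL(2, ℝ)) : K 0 0 * K 1 1 - K 0 1 * K 1 0 = 1 := by
  have := K.det_coe
  rwa [Matrix.det_fin_two] at this

lemma entryProd_neg_iff {K : SL(2, ℝ)} {s t : ℝ} (h : K • axisPoint s = axisPoint t) :
    entryProd K < 0 ↔ K 1 0 ≠ 0 ∧ K 1 1 ≠ 0 := by
  obtain ⟨h1, h2⟩ := (smul_axisPoint_eq_iff K s t).1 h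
  have key : entryProd K = -((K 1 0) ^ 2 * (K 1 1) ^ 2 * Real.exp t ^ 2) := by
    have : entryProd K = -((K 0 0 * Real.exp s) * K 1 1 * Real.exp t * (K 1 0) ^ 2) := by
      unfold entryProd; rw [h1]; ring
    rw [this, h2]; ring
  rw [key]
  constructor
  · intro h
    constructor <;> intro h0 <;> rw [h0] at h <;> simp at h
  · rintro ⟨h3, h4⟩
    have : 0 < (K 1 0) ^ 2 * (K 1 1) ^ 2 * Real.exp t ^ 2 := by positivity
    linarith

lemma entries_of_entryProd_neg {K : SL(2, ℝ)} (h : entryProd K < 0) :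
    0 < K 0 0 * K 1 1 ∧ K 0 1 * K 1 0 < 0 := by
  have hd := det_eq K
  have h' : (K 0 0 * K 1 1) * (K 0 1 * K 1 0) < 0 := by
    unfold entryProd at h; nlinarith
  rcases mul_neg_iff.1 h' with h1 | h1
  · exact h1
  · exfalso; linarith [h1.1, h1.2]

lemma ne_zero_of_entryProd_neg {K : SL(2, ℝ)} (h : entryProd K < 0) :
    K 0 0 ≠ 0 ∧ K 0 1 ≠ 0 ∧ K 1 0 ≠ 0 ∧ K 1 1 ≠ 0 := by
  refine ⟨?_, ?_, ?_, ?_⟩ <;> intro h0 <;> unfold entryProd at h <;> rw [h0] at h <;> simp at h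

lemma exists_crossing {K : SL(2, ℝ)} (h : entryProd K < 0) :
    ∃ s t, K • axisPoint s = axisPoint t := by
  obtain ⟨h1, h2⟩ := entries_of_entryProd_neg h
  obtain ⟨n1, n2, n3, n4⟩ := ne_zero_of_entryProd_neg h
  have hA : 0 < -(K 0 1) / K 1 0 := by
    have : -(K 0 1) / K 1 0 = -(K 0 1 * K 1 0) / (K 1 0) ^ 2 := by field_simp
    rw [this]
    apply div_pos (by linarith) (by positivity)
  have hB : 0 < K 0 0 / K 1 1 := by
    have : K 0 0 / K 1 1 = (K 0 0 * K 1 1) / (K 1 1) ^ 2 := by field_simp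
    rw [this]; positivity
  -- The two conditions of `smul_axisPoint_eq_iff` prescribe `exp (s + t)` and `exp (t - s)`.
  refine ⟨(Real.log (-(K 0 1) / K 1 0) - Real.log (K 0 0 / K 1 1)) / 2,
    (Real.log (-(K 0 1) / K 1 0) + Real.log (K 0 0 / K 1 1)) / 2, ?_⟩
  rw [smul_axisPoint_eq_iff]
  constructor
  · rw [← Real.exp_add]
    ring_nf
    rw [Real.exp_log (by convert hA using 1; ring)]
    field_simp
  · have : (Real.log (-(K 0 1) / K 1 0) + Real.log (K 0 0 / K 1 1)) / 2 =
      (Real.log (-(K 0 1) / K 1 0) - Real.log (K 0 0 / K 1 1)) / 2 + Real.log (K 0 0 / K 1 1) := by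
      ring
    rw [this, Real.exp_add, Real.exp_log hB]
    field_simp

lemma crossing_unique {K : SL(2, ℝ)} (h3 : K 1 0 ≠ 0) (h4 : K 1 1 ≠ 0) {s t s' t' : ℝ}
    (h : K • axisPoint s = axisPoint t) (h' : K • axisPoint s' = axisPoint t') :
    s = s' ∧ t = t' := by
  obtain ⟨h1, h2⟩ := (smul_axisPoint_eq_iff K s t).1 h
  obtain ⟨h1', h2'⟩ := (smul_axisPoint_eq_iff K s' t').1 h'
  have e1 : Real.exp s * Real.exp t = Real.exp s' * Real.exp t' := by
    apply mul_left_cancel₀ h3; linarith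
  have e2 : Real.exp t * Real.exp s' = Real.exp t' * Real.exp s := by
    apply mul_left_cancel₀ h4
    linear_combination -(Real.exp s') * h2 + Real.exp s * h2'
  rw [← Real.exp_add, ← Real.exp_add] at e1 e2
  have := Real.exp_injective e1
  have := Real.exp_injective e2
  constructor <;> linarith

/-- A translate that meets the axis coincides with it exactly when `K` is diagonal (a translation)
or antidiagonal (a half-turn). Otherwise the meeting point is unique. -/
lemma smul_range_axis_ne_iff {K : SL(2, ℝ)} {s t : ℝ} (h : K • axisPoint s = axisPoint t) :
    K • Set.range axisPoint ≠ Set.range axisPoint ↔ entryProd K < 0 := by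
  rw [entryProd_neg_iff h]
  have aux : ∀ (K : SL(2, ℝ)), (∀ s', ∃ t', K • axisPoint s' = axisPoint t') →
      K • Set.range axisPoint ⊆ Set.range axisPoint := by
    rintro K hK _ ⟨_, ⟨s', rfl⟩, rfl⟩
    obtain ⟨t', h'⟩ := hK s'
    exact ⟨t', h'.symm⟩
  have aux2 : ∀ (K : SL(2, ℝ)), (∀ s', ∃ t', K • axisPoint s' = axisPoint t') →
      (∀ t', ∃ s', K • axisPoint s' = axisPoint t') →
      K • Set.range axisPoint = Set.range axisPoint := by
    intro K hK hK'
    apply (aux K hK).antisymm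
    rintro _ ⟨t', rfl⟩
    obtain ⟨s', h'⟩ := hK' t'
    exact ⟨_, ⟨s', rfl⟩, h'⟩
  constructor
  · intro hne
    by_contra hcon
    apply hne
    obtain ⟨h1, h2⟩ := (smul_axisPoint_eq_iff K s t).1 h
    by_cases h0 : K 1 0 = 0
    · have h01 : K 0 1 = 0 := by rw [h1, h0]; simp
      have hK : ∀ s', K • axisPoint s' = axisPoint (s' + (t - s)) := by
        intro s'
        rw [smul_axisPoint_eq_iff, h0, h01]
        refine ⟨by simp, ?_⟩
        have : K 0 0 = K 1 1 * Real.exp (t - s) := by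
          rw [Real.exp_sub]; field_simp; exact h2
        rw [this, Real.exp_add]; ring
      refine aux2 K (fun s' => ⟨_, hK s'⟩) (fun t' => ⟨t' - (t - s), ?_⟩)
      rw [hK]; congr 1; ring
    · have h11 : K 1 1 = 0 := by
        by_contra h11; exact hcon ⟨h0, h11⟩
      have h00 : K 0 0 = 0 := by
        rw [h11, zero_mul] at h2
        exact (mul_eq_zero.1 h2).resolve_right (Real.exp_pos s).ne'
      have hK : ∀ s', K • axisPoint s' = axisPoint (s + t - s') := by
        intro s'
        rw [smul_axisPoint_eq_iff, h00, h11, ← Real.exp_add]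
        refine ⟨?_, by simp⟩
        rw [h1, ← Real.exp_add]; congr 3; ring
      refine aux2 K (fun s' => ⟨_, hK s'⟩) (fun t' => ⟨s + t - t', ?_⟩)
      rw [hK]; congr 1; ring
  · rintro ⟨h3, h4⟩ heq
    have : K • axisPoint (s + 1) ∈ Set.range axisPoint := by
      rw [← heq]; exact ⟨_, ⟨_, rfl⟩, rfl⟩
    obtain ⟨t', ht'⟩ := this
    have := (crossing_unique h3 h4 h ht'.symm).1
    linarith

/-! ### From half-planes to ping-pong on the boundary -/

/-- The double cone of vectors `(p, q)` with `p / q` in the closed interval of centre `c` and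
radius `r`. -/
def Cone (c r p q : ℝ) : Prop := (p - c * q) ^ 2 ≤ r ^ 2 * q ^ 2

lemma smul_axisPoint_mem_halfDisk (N : SL(2, ℝ)) (t c r : ℝ) (hr : 0 < r) :
    N • axisPoint t ∈ halfDisk c r ↔
      ((N 0 0 - c * N 1 0) ^ 2 - r ^ 2 * (N 1 0) ^ 2) * (Real.exp t) ^ 2 +
        ((N 0 1 - c * N 1 1) ^ 2 - r ^ 2 * (N 1 1) ^ 2) ≤ 0 := by
  have hden : ((N 1 0 : ℝ) : ℂ) * (axisPoint t : ℂ) + ((N 1 1 : ℝ) : ℂ) ≠ 0 := by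
    have := UpperHalfPlane.denom_ne_zero (N : GL (Fin 2) ℝ) (axisPoint t)
    simpa [UpperHalfPlane.denom] using this
  rw [halfDisk, Set.mem_ofPred_eq, UpperHalfPlane.coe_specialLinearGroup_apply, dist_eq_norm]
  simp only [Algebra.algebraMap_self, RingHom.id_apply]
  rw [div_sub' hden, norm_div, div_le_iff₀ (norm_pos_iff.2 hden),
    ← abs_of_nonneg (norm_nonneg (_ - _)), ← abs_of_nonneg (mul_nonneg hr.le (norm_nonneg _)),
    ← sq_le_sq, mul_pow, Complex.sq_norm, Complex.sq_norm, Complex.normSq_apply,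
    Complex.normSq_apply]
  simp only [axisPoint, Complex.add_re, Complex.mul_re, Complex.ofReal_re, Complex.ofReal_im,
    Complex.add_im, Complex.mul_im, Complex.sub_re, Complex.sub_im]
  rw [← sub_nonpos]
  apply iff_of_eq
  congr 1
  ring

lemma nonpos_of_affine_nonpos {a b X₀ : ℝ} (h : ∀ X > X₀, a * X + b ≤ 0) : a ≤ 0 := by
  by_contra! ha
  have h1 := h (max (X₀ + 1) ((1 - b) / a)) (lt_of_lt_of_le (by linarith) (le_max_left _ _))
  have h2 : (1 - b) / a ≤ max (X₀ + 1) ((1 - b) / a) := le_max_right _ _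
  have h3 : a * ((1 - b) / a) = 1 - b := by field_simp
  nlinarith

/-- If `N` has first column `(p, q)`, the geodesic `t ↦ N • axisPoint t` ends at `p / q`. For large
`t` it is outside the half-disk of `c'`, `r'`, so its image is inside that of `c`, `r`. This
membership is affine in `exp t ^ 2`, and its leading coefficient is the cone condition. -/
lemma cone_of_pingPong {A : SL(2, ℝ)} {c r c' r' : ℝ} (hr : 0 < r) (hr' : 0 < r')
    (hA : ∀ z : ℍ, z ∉ halfDisk c' r' → A • z ∈ halfDisk c r) {p q : ℝ}
    (h : ¬ Cone c' r' p q) :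
    Cone c r (A 0 0 * p + A 0 1 * q) (A 1 0 * p + A 1 1 * q) := by
  have hpq : 0 < p ^ 2 + q ^ 2 := by
    by_contra! h0
    have hp : p = 0 := by nlinarith [sq_nonneg p, sq_nonneg q]
    have hq : q = 0 := by nlinarith [sq_nonneg p, sq_nonneg q]
    apply h; simp [Cone, hp, hq]
  obtain ⟨N, h00, h10⟩ : ∃ N : SL(2, ℝ), N 0 0 = p ∧ N 1 0 = q := by
    refine ⟨⟨!![p, -q / (p ^ 2 + q ^ 2); q, p / (p ^ 2 + q ^ 2)], ?_⟩, ?_, ?_⟩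
    · rw [Matrix.det_fin_two_of]; field_simp; ring
    · simp
    · simp
  have h' : 0 < (N 0 0 - c' * N 1 0) ^ 2 - r' ^ 2 * (N 1 0) ^ 2 := by
    unfold Cone at h; rw [h00, h10]; linarith
  set Q' := (N 0 0 - c' * N 1 0) ^ 2 - r' ^ 2 * (N 1 0) ^ 2
  set R' := (N 0 1 - c' * N 1 1) ^ 2 - r' ^ 2 * (N 1 1) ^ 2
  have hmul0 : ∀ i, (A * N) i 0 = A i 0 * p + A i 1 * q := by
    intro i; rw [← h00, ← h10]; simp [Matrix.mul_apply, Fin.sum_univ_two]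
  have := nonpos_of_affine_nonpos (a := ((A * N) 0 0 - c * (A * N) 1 0) ^ 2 -
    r ^ 2 * ((A * N) 1 0) ^ 2) (b := ((A * N) 0 1 - c * (A * N) 1 1) ^ 2 -
    r ^ 2 * ((A * N) 1 1) ^ 2) (X₀ := max 0 (-R' / Q')) (by
      intro X hX
      have hX0 : 0 < X := lt_of_le_of_lt (le_max_left _ _) hX
      have hX1 : -R' / Q' < X := lt_of_le_of_lt (le_max_right _ _) hX
      have hexp : (Real.exp (Real.log X / 2)) ^ 2 = X := by
        rw [← Real.exp_nat_mul]; push_cast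
        rw [mul_div_cancel₀ _ two_ne_zero, Real.exp_log hX0]
      have hn : N • axisPoint (Real.log X / 2) ∉ halfDisk c' r' := by
        rw [smul_axisPoint_mem_halfDisk _ _ _ _ hr', hexp, not_le]
        rw [div_lt_iff₀ h'] at hX1
        linarith
      have := hA _ hn
      rwa [← mul_smul, smul_axisPoint_mem_halfDisk _ _ _ _ hr, hexp] at this)
  rw [hmul0, hmul0] at this
  unfold Cone
  linarith

lemma mul_entry (A B : SL(2, ℝ)) (i k : Fin 2) :
    (A * B) i k = A i 0 * B 0 k + A i 1 * B 1 k := by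
  simp [Matrix.mul_apply, Fin.sum_univ_two]

lemma inv_entries (A : SL(2, ℝ)) :
    A⁻¹ 0 0 = A 1 1 ∧ A⁻¹ 0 1 = -A 0 1 ∧ A⁻¹ 1 0 = -A 1 0 ∧ A⁻¹ 1 1 = A 0 0 := by
  simp [Matrix.SpecialLinearGroup.coe_inv, Matrix.adjugate_fin_two]

/-! ### Ping-pong intervals and the order of boundary points -/

/-- Ping-pong data for a free group with letters `Fin 4`, the inverse of `y` being `y.rev`, in terms
of four disjoint intervals of the real line met in the order of their indices. -/
structure PingPong where
  G : Fin 4 → SL(2, ℝ)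
  ctr : Fin 4 → ℝ
  rad : Fin 4 → ℝ
  inv : ∀ y, G y.rev = (G y)⁻¹
  rad_pos : ∀ y, 0 < rad y
  sep : ∀ y y', y < y' → ctr y + rad y < ctr y' - rad y'
  pingPong : ∀ y p q, ¬ Cone (ctr y.rev) (rad y.rev) p q →
    Cone (ctr y) (rad y) (G y 0 0 * p + G y 0 1 * q) (G y 1 0 * p + G y 1 1 * q)

/-- The `k`-th column of `N` represents a point of the interval `y`. -/
def PingPong.ColIn (S : PingPong) (y : Fin 4) (N : SL(2, ℝ)) (k : Fin 2) : Prop :=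
  Cone (S.ctr y) (S.rad y) (N 0 k) (N 1 k)

/-- The boundary point represented by the `k`-th column. -/
noncomputable def ratio (N : SL(2, ℝ)) (k : Fin 2) : ℝ := N 0 k / N 1 k

namespace PingPong
variable (S : PingPong)

lemma colIn_mul {y : Fin 4} {N : SL(2, ℝ)} {k : Fin 2} (h : ¬ S.ColIn y.rev N k) :
    S.ColIn y (S.G y * N) k := by
  have := S.pingPong y _ _ h
  simpa only [ColIn, mul_entry] using this

/-- The point `∞` lies outside all four intervals. It serves as a base point whose image under a
reduced word shows the first letter of the word. -/
lemma not_colIn_one (y : Fin 4) : ¬ S.ColIn y 1 0 := by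
  simp only [ColIn, Cone]
  simp

lemma col_ne_zero (N : SL(2, ℝ)) (k : Fin 2) (h0 : N 0 k = 0) (h1 : N 1 k = 0) : False := by
  have := det_eq N
  fin_cases k <;> simp_all

variable {S}

lemma ColIn.ne_zero {y : Fin 4} {N : SL(2, ℝ)} {k : Fin 2} (h : S.ColIn y N k) : N 1 k ≠ 0 := by
  intro h0
  simp only [ColIn, Cone, h0] at h
  have : N 0 k = 0 := by nlinarith [sq_nonneg (N 0 k)]
  exact col_ne_zero N k this h0

lemma ColIn.bounds {y : Fin 4} {N : SL(2, ℝ)} {k : Fin 2} (h : S.ColIn y N k) :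
    S.ctr y - S.rad y ≤ ratio N k ∧ ratio N k ≤ S.ctr y + S.rad y := by
  have h0 := h.ne_zero
  have hr := S.rad_pos y
  have : (ratio N k - S.ctr y) ^ 2 ≤ S.rad y ^ 2 := by
    have e : (ratio N k - S.ctr y) ^ 2 = (N 0 k - S.ctr y * N 1 k) ^ 2 / (N 1 k) ^ 2 := by
      unfold ratio; field_simp
    rw [e, div_le_iff₀ (by positivity)]
    exact h
  have := abs_le_of_sq_le_sq' this hr.le
  constructor <;> linarith [this.1, this.2]

lemma ColIn.lt {y y' : Fin 4} {N N' : SL(2, ℝ)} {k k' : Fin 2} (h : S.ColIn y N k)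
    (h' : S.ColIn y' N' k') (hy : y < y') : ratio N k < ratio N' k' := by
  linarith [h.bounds.2, h'.bounds.1, S.sep y y' hy]

lemma ColIn.lt_iff {y y' : Fin 4} {N N' : SL(2, ℝ)} {k k' : Fin 2} (h : S.ColIn y N k)
    (h' : S.ColIn y' N' k') (hy : y ≠ y') : ratio N k < ratio N' k' ↔ y < y' := by
  refine ⟨fun h1 => ?_, h.lt h'⟩
  rcases lt_or_gt_of_ne hy with h2 | h2
  · exact h2
  · exact absurd h1 (not_lt.2 (h'.lt h h2).le)

lemma ColIn.unique {y y' : Fin 4} {N : SL(2, ℝ)} {k : Fin 2} (h : S.ColIn y N k)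
    (h' : S.ColIn y' N k) : y = y' := by
  by_contra hne
  rcases lt_or_gt_of_ne hne with h2 | h2
  · exact lt_irrefl _ (h.lt h' h2)
  · exact lt_irrefl _ (h'.lt h h2)

lemma ColIn.mul {y z : Fin 4} {N : SL(2, ℝ)} {k : Fin 2} (h : S.ColIn z N k) (hz : z ≠ y.rev) :
    S.ColIn y (S.G y * N) k :=
  S.colIn_mul fun h' => hz (h.unique h')

/-- If the denominator vanished, the cone condition for the image would make the numerator vanish as
well, against determinant one. -/
lemma denom_ne_zero_of_outside (y : Fin 4) {x : ℝ}
    (hx : x < S.ctr y.rev - S.rad y.rev ∨ S.ctr y.rev + S.rad y.rev < x) :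
    S.G y 1 0 * x + S.G y 1 1 ≠ 0 := by
  have hr := S.rad_pos y.rev
  intro h0
  have h := S.pingPong y x 1 (by
    unfold Cone
    rcases hx with h | h <;> nlinarith)
  simp only [mul_one] at h
  rw [Cone, h0] at h
  have h1 : S.G y 0 0 * x + S.G y 0 1 = 0 := by nlinarith [sq_nonneg (S.G y 0 0 * x + S.G y 0 1)]
  have := det_eq (S.G y)
  have e1 : S.G y 1 1 = -(S.G y 1 0 * x) := by linarith
  have e2 : S.G y 0 1 = -(S.G y 0 0 * x) := by linarith
  rw [e1, e2] at this
  nlinarith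

lemma lower_left_ne_zero (y : Fin 4) : S.G y 1 0 ≠ 0 := by
  have := S.colIn_mul (S.not_colIn_one y.rev)
  rw [mul_one] at this
  exact this.ne_zero

/-- The pole `-δ/γ` of `z ↦ (α z + β) / (γ z + δ)` lies in the interval of the inverse letter. -/
lemma pole_mem (y : Fin 4) : S.ctr y.rev - S.rad y.rev ≤ -(S.G y 1 1) / S.G y 1 0 ∧
    -(S.G y 1 1) / S.G y 1 0 ≤ S.ctr y.rev + S.rad y.rev := by
  have hz : S.G y 1 0 * (-(S.G y 1 1) / S.G y 1 0) + S.G y 1 1 = 0 := by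
    field_simp [S.lower_left_ne_zero y]
    ring
  constructor
  · by_contra! h
    exact denom_ne_zero_of_outside y (Or.inl h) hz
  · by_contra! h
    exact denom_ne_zero_of_outside y (Or.inr h) hz

lemma ratio_sub_ratio {A N N' : SL(2, ℝ)} {k k' : Fin 2} (h : N 1 k ≠ 0) (h' : N' 1 k' ≠ 0)
    (hA : (A * N) 1 k ≠ 0) (hA' : (A * N') 1 k' ≠ 0) :
    ratio (A * N) k - ratio (A * N') k' = (ratio N k - ratio N' k') /
      ((A 1 0 * ratio N k + A 1 1) * (A 1 0 * ratio N' k' + A 1 1)) := by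
  have e : ∀ (N : SL(2, ℝ)) k i, (A * N) i k = A i 0 * N 0 k + A i 1 * N 1 k   :=
    fun N k i => mul_entry A N i k
  have hd := det_eq A
  have h1 : A 1 0 * ratio N k + A 1 1 = (A * N) 1 k / N 1 k := by
    rw [e]; unfold ratio; field_simp
  have h2 : A 1 0 * ratio N' k' + A 1 1 = (A * N') 1 k' / N' 1 k' := by
    rw [e]; unfold ratio; field_simp
  rw [h1, h2]
  unfold ratio
  field_simp
  rw [e, e, e, e]
  linear_combination (N 0 k * N' 1 k' - N 1 k * N' 0 k') * hd

/-- The position of the letter `z` in the cyclic order starting after the inverse of `y`. -/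
def cycPos (y z : Fin 4) : Fin 4 := y + z + 1

lemma cycPos_lt_iff : ∀ y z z' : Fin 4, z ≠ y.rev → z' ≠ y.rev → z ≠ z' →
    (((z < y.rev ↔ z' < y.rev) ∧ z < z' ∨ z' < y.rev ∧ y.rev < z) ↔
      cycPos y z < cycPos y z') := by
  decide

/-- A Möbius map is increasing on each side of its pole and sends the right side below the left one.
The pole lies in the interval of `y.rev`, so the letters tell the sides. -/
lemma ratio_mul_lt_iff {y z z' : Fin 4} {N N' : SL(2, ℝ)} {k k' : Fin 2} (h : S.ColIn z N k)
    (h' : S.ColIn z' N' k') (hz : z ≠ y.rev) (hz' : z' ≠ y.rev) :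
    ratio (S.G y * N) k < ratio (S.G y * N') k' ↔
      ((z < y.rev ↔ z' < y.rev) ∧ ratio N k < ratio N' k') ∨ (z' < y.rev ∧ y.rev < z) := by
  have hm := h.mul hz
  have hm' := h'.mul hz'
  rw [← sub_neg, ratio_sub_ratio h.ne_zero h'.ne_zero hm.ne_zero hm'.ne_zero]
  obtain ⟨p1, p2⟩ := pole_mem (S := S) y
  have hg := lower_left_ne_zero (S := S) y
  set π := -(S.G y 1 1) / S.G y 1 0 with hπ
  have e : ∀ x, S.G y 1 0 * x + S.G y 1 1 = S.G y 1 0 * (x - π) := by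
    intro x; rw [hπ]; field_simp; ring
  rw [e, e]
  have key : ∀ {z : Fin 4} {N : SL(2, ℝ)} {k : Fin 2}, S.ColIn z N k → z ≠ y.rev →
      (z < y.rev ∧ ratio N k - π < 0) ∨ (y.rev < z ∧ 0 < ratio N k - π) := by
    intro z N k h hz
    rcases lt_or_gt_of_ne hz with h1 | h1
    · left; refine ⟨h1, ?_⟩; linarith [h.bounds.2, S.sep _ _ h1]
    · right; refine ⟨h1, ?_⟩; linarith [h.bounds.1, S.sep _ _ h1]
  have hg2 : 0 < S.G y 1 0 ^ 2 := by positivity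
  have e2 : ∀ A B : ℝ, S.G y 1 0 * A * (S.G y 1 0 * B) = S.G y 1 0 ^ 2 * (A * B) := by
    intro A B; ring
  rw [e2]
  rcases key h hz with ⟨a1, a2⟩ | ⟨a1, a2⟩ <;> rcases key h' hz' with ⟨b1, b2⟩ | ⟨b1, b2⟩
  · have : 0 < S.G y 1 0 ^ 2 * ((ratio N k - π) * (ratio N' k' - π)) :=
      mul_pos hg2 (mul_pos_of_neg_of_neg a2 b2)
    rw [div_neg_iff]
    simp only [a1, b1, true_and, this, this.not_gt, and_false, and_true, false_or, sub_neg,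
      a1.not_gt, or_false]
  · have : S.G y 1 0 ^ 2 * ((ratio N k - π) * (ratio N' k' - π)) < 0 :=
      mul_neg_of_pos_of_neg hg2 (mul_neg_of_neg_of_pos a2 b2)
    have h3 : ratio N k - ratio N' k' < 0 := by linarith
    rw [div_neg_iff]
    simp only [this, this.not_gt, h3.not_gt, a1, b1.not_gt, a1.not_gt, and_false, false_and]
    simp
  · have : S.G y 1 0 ^ 2 * ((ratio N k - π) * (ratio N' k' - π)) < 0 :=
      mul_neg_of_pos_of_neg hg2 (mul_neg_of_pos_of_neg a2 b2)
    have h3 : 0 < ratio N k - ratio N' k' := by linarith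
    rw [div_neg_iff]
    simp [this, h3, a1, b1]
  · have : 0 < S.G y 1 0 ^ 2 * ((ratio N k - π) * (ratio N' k' - π)) :=
      mul_pos hg2 (mul_pos a2 b2)
    rw [div_neg_iff]
    simp only [a1.not_gt, b1.not_gt, true_and, this, this.not_gt, and_false, and_true, false_or,
      sub_neg, false_and, or_false]

lemma ratio_mul_lt_iff_of_ne {y z z' : Fin 4} {N N' : SL(2, ℝ)} {k k' : Fin 2}
    (h : S.ColIn z N k) (h' : S.ColIn z' N' k') (hz : z ≠ y.rev) (hz' : z' ≠ y.rev)
    (hne : z ≠ z') :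
    ratio (S.G y * N) k < ratio (S.G y * N') k' ↔ cycPos y z < cycPos y z' := by
  rw [ratio_mul_lt_iff h h' hz hz', h.lt_iff h' hne]
  exact cycPos_lt_iff y z z' hz hz' hne

lemma ratio_mul_lt_iff_of_eq {y z : Fin 4} {N N' : SL(2, ℝ)} {k k' : Fin 2}
    (h : S.ColIn z N k) (h' : S.ColIn z N' k') (hz : z ≠ y.rev) :
    ratio (S.G y * N) k < ratio (S.G y * N') k' ↔ ratio N k < ratio N' k' := by
  rw [ratio_mul_lt_iff h h' hz hz]
  have : ¬ (z < y.rev ∧ y.rev < z) := fun h => lt_asymm h.1 h.2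
  simp [this]

end PingPong

/-! ### Linked endpoints, and fixed points as limits of orbits -/

lemma entryProd_inv_mul {M N : SL(2, ℝ)} (h1 : M 1 0 ≠ 0) (h2 : M 1 1 ≠ 0) (h3 : N 1 0 ≠ 0)
    (h4 : N 1 1 ≠ 0) :
    entryProd (M⁻¹ * N) = (M 1 0 * M 1 1 * N 1 0 * N 1 1) ^ 2 *
      ((ratio N 0 - ratio M 1) * (ratio N 1 - ratio M 1) * (ratio M 0 - ratio N 0) *
        (ratio M 0 - ratio N 1)) := by
  unfold entryProd ratio
  obtain ⟨a, b, c, d⟩ := inv_entries M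
  simp only [mul_entry, a, b, c, d]
  field_simp
  ring

/-- The sign of this product of differences tells whether the endpoints of the two lines separate
each other on the boundary circle. -/
lemma entryProd_inv_mul_neg_iff {M N : SL(2, ℝ)} (h1 : M 1 0 ≠ 0) (h2 : M 1 1 ≠ 0)
    (h3 : N 1 0 ≠ 0) (h4 : N 1 1 ≠ 0) :
    entryProd (M⁻¹ * N) < 0 ↔ (ratio N 0 - ratio M 1) * (ratio N 1 - ratio M 1) *
      (ratio M 0 - ratio N 0) * (ratio M 0 - ratio N 1) < 0 := by
  rw [entryProd_inv_mul h1 h2 h3 h4]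
  have : 0 < (M 1 0 * M 1 1 * N 1 0 * N 1 1) ^ 2 := by positivity
  constructor
  · intro h; by_contra! h'
    linarith [mul_nonneg this.le h']
  · intro h; exact mul_neg_of_pos_of_neg this h

lemma pow_diag {D : SL(2, ℝ)} (h01 : D 0 1 = 0) (h10 : D 1 0 = 0) (k : ℕ) :
    (D ^ k) 0 0 = D 0 0 ^ k ∧ (D ^ k) 0 1 = 0 ∧ (D ^ k) 1 0 = 0 ∧ (D ^ k) 1 1 = D 1 1 ^ k := by
  induction k with
  | zero => simp
  | succ k ih =>
    obtain ⟨a, b, c, d⟩ := ih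
    simp only [pow_succ, mul_entry, a, b, c, d, h01, h10]
    simp

lemma conj_pow_diag {D : SL(2, ℝ)} (N : SL(2, ℝ)) (h01 : D 0 1 = 0) (h10 : D 1 0 = 0) (k : ℕ)
    (i : Fin 2) : (N * D ^ k * N⁻¹) i 0 =
      N i 0 * N 1 1 * D 0 0 ^ k - N i 1 * N 1 0 * D 1 1 ^ k := by
  obtain ⟨a, b, c, d⟩ := pow_diag h01 h10 k
  obtain ⟨a', -, c', -⟩ := inv_entries N
  simp only [mul_entry, a, b, c, d, a', c']
  ring

lemma cone_limit {r A B C D μ : ℝ} (hμ : μ ^ 2 < 1)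
    (h : ∀ k : ℕ, (A + B * (μ ^ 2) ^ (k + 1)) ^ 2 ≤ r ^ 2 * (C + D * (μ ^ 2) ^ (k + 1)) ^ 2) :
    A ^ 2 ≤ r ^ 2 * C ^ 2 := by
  have h0 : Filter.Tendsto (fun k : ℕ => (μ ^ 2) ^ (k + 1)) Filter.atTop (nhds 0) :=
    (tendsto_pow_atTop_nhds_zero_of_lt_one (sq_nonneg _) hμ).comp (Filter.tendsto_add_atTop_nat 1)
  have h1 := ((h0.const_mul B).const_add A).pow 2
  have h2 := (((h0.const_mul D).const_add C).pow 2).const_mul (r ^ 2)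
  simpa using le_of_tendsto_of_tendsto' h1 h2 h

/-- The attracting fixed point lies in an interval that contains the forward orbit of `∞`. -/
lemma cone_attracting {c r : ℝ} {N D : SL(2, ℝ)} (h01 : D 0 1 = 0) (h10 : D 1 0 = 0)
    (hD : D 1 1 ^ 2 < 1)
    (h : ∀ k : ℕ, Cone c r ((N * D ^ (k + 1) * N⁻¹) 0 0) ((N * D ^ (k + 1) * N⁻¹) 1 0)) :
    Cone c r (N 0 0) (N 1 0) := by
  have hdet := det_eq D
  have hN := det_eq N
  rw [h01, zero_mul, sub_zero] at hdet
  simp only [conj_pow_diag N h01 h10] at h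
  -- Otherwise `∞` is the repelling fixed point; its orbit stays there, and no cone contains it.
  have h11 : N 1 1 ≠ 0 := by
    intro h0
    have h1 := h 0
    simp only [h0, Cone] at h1
    simp only [h0, mul_zero, zero_sub] at hN
    have e : N 0 1 * N 1 0 = -1 := by linarith
    simp only [e] at h1
    have : D 1 1 ≠ 0 := fun h => by rw [h] at hdet; simp at hdet
    have : 0 < (D 1 1) ^ 2 := by positivity
    ring_nf at h1
    nlinarith
  have key := cone_limit (r := r) (A := N 1 1 * (N 0 0 - c * N 1 0))
    (B := -(N 1 0 * (N 0 1 - c * N 1 1)))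
    (C := N 1 1 * N 1 0) (D := - (N 1 0 * N 1 1)) hD (by
      intro k
      have hk := h k
      unfold Cone at hk
      have hp : D 0 0 ^ (k + 1) * D 1 1 ^ (k + 1) = 1 := by rw [← mul_pow, hdet, one_pow]
      -- Scaling the vector by `D 1 1 ^ (k + 1)` keeps the boundary point and makes the coefficient
      -- of the attracting column constant.
      have := mul_le_mul_of_nonneg_left hk (sq_nonneg (D 1 1 ^ (k + 1)))
      set P := D 0 0 ^ (k + 1)
      have e3 : (D 1 1 ^ 2) ^ (k + 1) = (D 1 1 ^ (k + 1)) ^ 2 := by rw [← pow_mul, ← pow_mul, mul_comm]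
      rw [e3]
      set R := D 1 1 ^ (k + 1)
      have e1 : R ^ 2 * (N 0 0 * N 1 1 * P - N 0 1 * N 1 0 * R -
          c * (N 1 0 * N 1 1 * P - N 1 1 * N 1 0 * R)) ^ 2 =
          (N 1 1 * (N 0 0 - c * N 1 0) * (P * R) + -(N 1 0 * (N 0 1 - c * N 1 1)) * R ^ 2) ^ 2 := by
        ring
      have e2 : R ^ 2 * (r ^ 2 * (N 1 0 * N 1 1 * P - N 1 1 * N 1 0 * R) ^ 2) =
          r ^ 2 * (N 1 1 * N 1 0 * (P * R) + -(N 1 0 * N 1 1) * R ^ 2) ^ 2 := by ring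
      rw [e1, e2, hp, mul_one, mul_one] at this
      exact this)
  unfold Cone
  have hpos : 0 < (N 1 1) ^ 2 := by positivity
  rw [mul_pow, mul_pow] at key
  by_contra! hlt
  nlinarith

/-- This is `cone_attracting` after the half-turn `J`, which exchanges the two ends of the axis. -/
lemma cone_repelling {c r : ℝ} {N D : SL(2, ℝ)} (h01 : D 0 1 = 0) (h10 : D 1 0 = 0)
    (hD : D 0 0 ^ 2 < 1)
    (h : ∀ k : ℕ, Cone c r ((N * D ^ (k + 1) * N⁻¹) 0 0) ((N * D ^ (k + 1) * N⁻¹) 1 0)) :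
    Cone c r (N 0 1) (N 1 1) := by
  obtain ⟨J, j00, j01, j10, j11⟩ : ∃ J : SL(2, ℝ), J 0 0 = 0 ∧ J 0 1 = -1 ∧ J 1 0 = 1 ∧ J 1 1 = 0 :=
    ⟨⟨!![0, -1; 1, 0], by simp⟩, by simp⟩
  have hJ : ∀ i k, (N * J) i k = N i 0 * J 0 k + N i 1 * J 1 k  :=
    fun i k => mul_entry N J i k
  have hD' : ∀ i k, (J⁻¹ * D * J) i k =
      (J⁻¹ i 0 * D 0 0 + J⁻¹ i 1 * D 1 0) * J 0 k + (J⁻¹ i 0 * D 0 1 + J⁻¹ i 1 * D 1 1) * J 1 k := by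
    intro i k; simp only [mul_entry]
  have hJi : J⁻¹ 0 0 = 0 ∧ J⁻¹ 0 1 = 1 ∧ J⁻¹ 1 0 = -1 ∧ J⁻¹ 1 1 = 0 := by
    obtain ⟨a, b, c, d⟩ := inv_entries J
    simp [a, b, c, d, j00, j01, j10, j11]
  obtain ⟨i00, i01, i10, i11⟩ := hJi
  have := cone_attracting (c := c) (r := r) (N := N * J) (D := J⁻¹ * D * J)
    (by rw [hD', i00, i01, j01, j11, h10]; ring) (by rw [hD', i10, i11, j00, j10, h01]; ring)
    (by rw [hD', i10, i11, j01, j11, h01]; simpa using hD) (by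
      intro k
      have e : N * J * (J⁻¹ * D * J) ^ (k + 1) * (N * J)⁻¹ = N * D ^ (k + 1) * N⁻¹ := by
        have : (J⁻¹ * D * J) ^ (k + 1) = J⁻¹ * D ^ (k + 1) * J := by
          simpa using (conj_pow (i := k + 1) (a := J⁻¹) (b := D))
        rw [this]; group
      rw [e]; exact h k)
  rw [hJ, hJ, j00, j10] at this
  simpa using this

/-! ### The group acts freely on the hyperbolic plane -/

namespace PingPong
variable (S : PingPong)

/-- The group generated by the letters. -/
def Gam : Subgroup SL(2, ℝ) := Subgroup.closure (Set.range S.G)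

lemma G_mem (y : Fin 4) : S.G y ∈ S.Gam := Subgroup.subset_closure ⟨y, rfl⟩

/-- The group element spelled by a list of letters. -/
def spell (l : List (Fin 4)) : SL(2, ℝ) := (l.map S.G).prod

/-- Reduced lists of letters. -/
abbrev Reduced (l : List (Fin 4)) : Prop := l.IsChain (fun p q => q ≠ p.rev)

lemma spell_cons (y : Fin 4) (l : List (Fin 4)) : S.spell (y :: l) = S.G y * S.spell l := by
  simp [spell]

lemma spell_append (l l' : List (Fin 4)) : S.spell (l ++ l') = S.spell l * S.spell l' := by
  simp [spell]

lemma G_mul_rev (y : Fin 4) : S.G y * S.G y.rev = 1 := by rw [S.inv]; simp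

lemma exists_reduced_mul (y : Fin 4) {l : List (Fin 4)} (hl : Reduced l) :
    ∃ l', Reduced l' ∧ S.spell l' = S.G y * S.spell l := by
  cases l with
  | nil => exact ⟨[y], by simp, by simp [spell]⟩
  | cons z l =>
    by_cases hz : z = y.rev
    · refine ⟨l, (List.isChain_cons.1 hl).2, ?_⟩
      rw [spell_cons, hz, ← mul_assoc, S.G_mul_rev, one_mul]
    · exact ⟨y :: z :: l, List.isChain_cons_cons.2 ⟨hz, hl⟩, S.spell_cons _ _⟩

lemma exists_reduced {h : SL(2, ℝ)} (hh : h ∈ S.Gam) : ∃ l, Reduced l ∧ S.spell l = h := by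
  induction hh using Subgroup.closure_induction_left with
  | one => exact ⟨[], by simp, by simp [spell]⟩
  | mul_left x hx y hy ih =>
    obtain ⟨z, rfl⟩ := hx
    obtain ⟨l, hl, rfl⟩ := ih
    exact S.exists_reduced_mul z hl
  | inv_mul_cancel x hx y hy ih =>
    obtain ⟨z, rfl⟩ := hx
    obtain ⟨l, hl, rfl⟩ := ih
    rw [← S.inv]
    exact S.exists_reduced_mul z.rev hl

lemma colIn_spell {N : SL(2, ℝ)} {k : Fin 2} (l : List (Fin 4)) (y : Fin 4)
    (hl : Reduced (y :: l))
    (h : ¬ S.ColIn ((y :: l).getLast (by simp)).rev N k) :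
    S.ColIn y (S.spell (y :: l) * N) k := by
  induction l generalizing y with
  | nil =>
    rw [spell_cons]
    simpa [spell] using S.colIn_mul (by simpa using h)
  | cons z l ih =>
    obtain ⟨h1, h2⟩ := List.isChain_cons_cons.1 hl
    have := ih z h2 (by simpa using h)
    rw [spell_cons, mul_assoc]
    exact this.mul h1

/-- Cyclic reducedness makes the element map the closed interval of `y` into itself. With a fixed
point in `ℍ` it would push both ends of the interval in the same direction. -/
lemma smul_ne_of_cyclically_reduced (l : List (Fin 4)) (y : Fin 4) (hl : Reduced (y :: l))
    (hy : y ≠ ((y :: l).getLast (by simp)).rev) (z : ℍ) : S.spell (y :: l) • z ≠ z := by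
  intro hz
  set h := S.spell (y :: l)
  have hcone : ∀ x, S.ctr y - S.rad y ≤ x → x ≤ S.ctr y + S.rad y →
      ∃ N : SL(2, ℝ), N 0 0 = x ∧ N 1 0 = 1 ∧ S.ColIn y (h * N) 0 := by
    intro x h1 h2
    obtain ⟨N, h00, h10⟩ : ∃ N : SL(2, ℝ), N 0 0 = x ∧ N 1 0 = 1 :=
      ⟨⟨!![x, -1; 1, 0], by simp⟩, by simp⟩
    refine ⟨N, h00, h10, S.colIn_spell l y hl fun h' => hy ?_⟩
    have : S.ColIn y N 0 := by
      unfold ColIn Cone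
      rw [h00, h10]
      have := sq_le_sq' (a := x - S.ctr y) (b := S.rad y) (by linarith) (by linarith)
      linarith
    exact this.unique h'
  have hD : ∀ x, S.ctr y - S.rad y ≤ x → x ≤ S.ctr y + S.rad y → h 1 0 * x + h 1 1 ≠ 0 ∧
      S.ctr y - S.rad y ≤ (h 0 0 * x + h 0 1) / (h 1 0 * x + h 1 1) ∧
      (h 0 0 * x + h 0 1) / (h 1 0 * x + h 1 1) ≤ S.ctr y + S.rad y := by
    intro x h1 h2
    obtain ⟨N, h00, h10, hN⟩ := hcone x h1 h2
    have e0 := hN.ne_zero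
    have e1 := hN.bounds
    unfold ratio at e1
    rw [mul_entry, h00, h10, mul_one] at e0
    rw [mul_entry, mul_entry, h00, h10, mul_one, mul_one] at e1
    exact ⟨e0, e1⟩
  have hc : h 1 0 ≠ 0 := by
    have := S.colIn_spell l y hl (S.not_colIn_one _)
    rw [mul_one] at this
    exact this.ne_zero
  have hden : ((h 1 0 : ℝ) : ℂ) * (z : ℂ) + ((h 1 1 : ℝ) : ℂ) ≠ 0 := by
    have := UpperHalfPlane.denom_ne_zero (h : GL (Fin 2) ℝ) z
    simpa [UpperHalfPlane.denom] using this
  rw [UpperHalfPlane.ext_iff, UpperHalfPlane.coe_specialLinearGroup_apply] at hz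
  simp only [Algebra.algebraMap_self, RingHom.id_apply] at hz
  rw [div_eq_iff hden, Complex.ext_iff] at hz
  simp only [Complex.add_re, Complex.mul_re, Complex.ofReal_re, Complex.ofReal_im,
    Complex.add_im, Complex.mul_im, UpperHalfPlane.coe_re, UpperHalfPlane.coe_im] at hz
  obtain ⟨hre, him⟩ := hz
  have hY := z.im_pos
  set X := z.re
  set Y := z.im
  have e1 : h 0 0 - h 1 1 = 2 * h 1 0 * X := by
    apply mul_right_cancel₀ hY.ne'; linarith
  have e2 : h 0 1 = -h 1 0 * (X ^ 2 + Y ^ 2) := by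
    have : h 0 0 = h 1 1 + 2 * h 1 0 * X := by linarith
    rw [this] at hre; linarith
  -- The fixed-point polynomial has the roots `X ± iY`, hence a constant sign on the real line.
  have hf : ∀ x, x * (h 1 0 * x + h 1 1) - (h 0 0 * x + h 0 1) =
      h 1 0 * ((x - X) ^ 2 + Y ^ 2) := by
    intro x
    have : h 0 0 = h 1 1 + 2 * h 1 0 * X := by linarith
    rw [this, e2]; ring
  have hr := S.rad_pos y
  obtain ⟨a1, a2, -⟩ := hD (S.ctr y - S.rad y) le_rfl (by linarith)
  obtain ⟨b1, -, b2⟩ := hD (S.ctr y + S.rad y) (by linarith) le_rfl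
  set l₀ := S.ctr y - S.rad y
  set r₀ := S.ctr y + S.rad y
  have f1 := hf l₀
  have f2 := hf r₀
  -- The pole is not in the interval, so the denominator has the same sign at both ends.
  have hDD : 0 < (h 1 0 * l₀ + h 1 1) * (h 1 0 * r₀ + h 1 1) := by
    by_contra! hneg
    have hpole : h 1 0 * (-(h 1 1) / h 1 0) + h 1 1 = 0 := by field_simp; ring
    set π := -(h 1 1) / h 1 0
    have e : ∀ x, h 1 0 * x + h 1 1 = h 1 0 * (x - π) := by intro x; linarith
    rw [e, e] at hneg
    have h2 : 0 < h 1 0 ^ 2 := by positivity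
    have h3 : (l₀ - π) * (r₀ - π) ≤ 0 := by
      by_contra! hp
      have := mul_pos h2 hp
      linarith
    exact (hD π (by nlinarith) (by nlinarith)).1 hpole
  have q1 : 0 ≤ (h 0 0 * l₀ + h 0 1 - l₀ * (h 1 0 * l₀ + h 1 1)) / (h 1 0 * l₀ + h 1 1) := by
    rw [sub_div, mul_div_cancel_right₀ _ a1]; linarith
  have q2 : (h 0 0 * r₀ + h 0 1 - r₀ * (h 1 0 * r₀ + h 1 1)) / (h 1 0 * r₀ + h 1 1) ≤ 0 := by
    rw [sub_div, mul_div_cancel_right₀ _ b1]; linarith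
  have q3 := mul_nonpos_of_nonneg_of_nonpos q1 q2
  rw [div_mul_div_comm, div_le_iff₀ hDD, zero_mul] at q3
  have g1 : h 0 0 * l₀ + h 0 1 - l₀ * (h 1 0 * l₀ + h 1 1) = -(h 1 0 * ((l₀ - X) ^ 2 + Y ^ 2)) := by
    linarith
  have g2 : h 0 0 * r₀ + h 0 1 - r₀ * (h 1 0 * r₀ + h 1 1) = -(h 1 0 * ((r₀ - X) ^ 2 + Y ^ 2)) := by
    linarith
  rw [g1, g2] at q3
  have : 0 < h 1 0 ^ 2 * (((l₀ - X) ^ 2 + Y ^ 2) * ((r₀ - X) ^ 2 + Y ^ 2)) := by positivity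
  nlinarith

/-- A word that is not cyclically reduced is conjugate to a shorter one, and a nonempty cyclically
reduced word has no fixed point. -/
lemma spell_eq_one_of_fixed : ∀ (n : ℕ) (l : List (Fin 4)), l.length = n → Reduced l →
    ∀ z : ℍ, S.spell l • z = z → S.spell l = 1 := by
  intro n
  induction n using Nat.strong_induction_on with
  | _ n ih =>
    intro l hn hl z hz
    cases l with
    | nil => simp [spell]
    | cons y l =>
      by_cases hy : y = ((y :: l).getLast (by simp)).rev
      · rcases List.eq_nil_or_concat l with rfl | ⟨l', y', rfl⟩
        · simp at hy
          exact absurd hy ((by decide : ∀ y : Fin 4, y ≠ y.rev) y)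
        · have hy' : y = y'.rev := by simpa using hy
          have hy2 : y' = y.rev := by rw [hy', Fin.rev_rev]
          rw [List.concat_eq_append] at hn hl hz ⊢
          have e : S.spell (y :: (l' ++ [y'])) = S.G y * S.spell l' * (S.G y)⁻¹ := by
            rw [spell_cons, spell_append, hy2]
            simp [spell, S.inv, mul_assoc]
          rw [e] at hz ⊢
          have := ih l'.length (by simp at hn; omega) l' rfl
            (List.isChain_append.1 (List.isChain_cons.1 hl).2).1 ((S.G y)⁻¹ • z) (by
              rw [mul_smul, mul_smul] at hz
              rw [eq_inv_smul_iff]; exact hz)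
          rw [this]; simp
      · exact absurd hz (S.smul_ne_of_cyclically_reduced l y hl hy z)

/-- The group generated by the letters acts freely. -/
lemma eq_one_of_fixed {h : SL(2, ℝ)} (hh : h ∈ S.Gam) {z : ℍ} (hz : h • z = z) : h = 1 := by
  obtain ⟨l, hl, rfl⟩ := S.exists_reduced hh
  exact S.spell_eq_one_of_fixed _ l rfl hl z hz

end PingPong

/-! ### Periodic words, their axes, and common vertices of crossing lines -/

/-- A periodic bi-infinite reduced word `x`, its prefixes `g`, and the axis `M` of the element `w`
spelled by a period. -/
structure Itinerary (S : PingPong) where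
  x : ℤ → Fin 4
  g : ℤ → SL(2, ℝ)
  L : ℤ
  w : SL(2, ℝ)
  M : SL(2, ℝ)
  ℓ : ℝ
  red : ∀ i, x (i + 1) ≠ (x i).rev
  g_zero : g 0 = 1
  g_succ : ∀ i, g (i + 1) = g i * S.G (x i)
  L_pos : 0 < L
  x_per : ∀ i, x (i + L) = x i
  g_per : ∀ i, g (i + L) = w * g i
  ℓ_pos : 0 < ℓ
  axis : ∀ t, (M⁻¹ * w * M) • axisPoint t = axisPoint (t + ℓ)

namespace Itinerary
variable {S : PingPong} (I : Itinerary S)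

/-- The translation by `w`, read on the imaginary half-axis. -/
def W : SL(2, ℝ) := I.M⁻¹ * I.w * I.M

/-- The line of the itinerary as seen from the `i`-th vertex. -/
def line (i : ℤ) : SL(2, ℝ) := (I.g i)⁻¹ * I.M

/-- The group element relating the lines seen from the `i`-th and the `j`-th vertex. -/
def δ (i j : ℤ) : SL(2, ℝ) := I.g i * (I.g j)⁻¹

/-- The lines seen from the `i`-th and the `j`-th vertex cross. -/
def Lk (i j : ℤ) : Prop := entryProd (I.M⁻¹ * I.δ i j * I.M) < 0

lemma Lk_iff (i j : ℤ) : I.Lk i j ↔ entryProd ((I.line i)⁻¹ * I.line j) < 0 := by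
  unfold Lk line δ
  rw [mul_inv_rev, inv_inv]
  simp only [mul_assoc]

lemma g_pred (i : ℤ) : I.g (i - 1) = I.g i * S.G (x I (i - 1)).rev := by
  have := I.g_succ (i - 1)
  rw [sub_add_cancel] at this
  rw [this, S.inv]; simp

lemma red' (i : ℤ) : I.x i ≠ (I.x (i - 1)).rev := by
  have := I.red (i - 1)
  rwa [sub_add_cancel] at this

lemma x_per_nat (i : ℤ) (k : ℕ) : I.x (i + k * I.L) = I.x i := by
  induction k with
  | zero => simp
  | succ k ih => rw [← ih, ← I.x_per (i + k * I.L)]; congr 1; push_cast; ring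

lemma x_per_int (i k : ℤ) : I.x (i + k * I.L) = I.x i := by
  obtain ⟨n, rfl | rfl⟩ := k.eq_nat_or_neg
  · exact I.x_per_nat i n
  · rw [← I.x_per_nat (i + -(n : ℤ) * I.L) n]; congr 1; ring

lemma g_per_nat (i : ℤ) (k : ℕ) : I.g (i + k * I.L) = I.w ^ k * I.g i := by
  induction k with
  | zero => simp
  | succ k ih =>
    rw [pow_succ', mul_assoc, ← ih, ← I.g_per]; congr 1; push_cast; ring

lemma g_per_int (i k : ℤ) : I.g (i + k * I.L) = I.w ^ k * I.g i := by
  obtain ⟨n, rfl | rfl⟩ := k.eq_nat_or_neg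
  · exact_mod_cast I.g_per_nat i n
  · have := I.g_per_nat (i + -(n : ℤ) * I.L) n
    rw [show i + -(n : ℤ) * I.L + n * I.L = i by ring] at this
    rw [this]; simp

lemma g_mem_nat (k : ℕ) : I.g k ∈ S.Gam := by
  induction k with
  | zero => rw [Nat.cast_zero, I.g_zero]; exact one_mem _
  | succ k ih => push_cast; rw [I.g_succ]; exact mul_mem ih (S.G_mem _)

lemma w_mem : I.w ∈ S.Gam := by
  have h1 := I.g_per 0
  rw [I.g_zero, mul_one, zero_add] at h1
  rw [← h1]
  have := I.g_mem_nat I.L.toNat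
  rwa [Int.toNat_of_nonneg I.L_pos.le] at this

lemma g_mem (i : ℤ) : I.g i ∈ S.Gam := by
  have h1 := I.g_per_int (i % I.L) (i / I.L)
  rw [mul_comm, Int.emod_add_mul_ediv] at h1
  rw [h1]
  refine mul_mem (zpow_mem I.w_mem _) ?_
  have := I.g_mem_nat (i % I.L).toNat
  rwa [Int.toNat_of_nonneg (Int.emod_nonneg _ I.L_pos.ne')] at this

lemma δ_mem (i j : ℤ) : I.δ i j ∈ S.Gam := mul_mem (I.g_mem i) (inv_mem (I.g_mem j))

lemma δ_succ_succ {i j : ℤ} (h : I.x i = I.x j) : I.δ (i + 1) (j + 1) = I.δ i j := by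
  unfold δ; rw [I.g_succ, I.g_succ, h]; group

lemma δ_succ_pred {i j : ℤ} (h : I.x i = (I.x (j - 1)).rev) : I.δ (i + 1) (j - 1) = I.δ i j := by
  unfold δ; rw [I.g_succ, I.g_pred, h]; group

lemma δ_per (i j a b : ℤ) : I.δ (i + a * I.L) (j + b * I.L) = I.w ^ a * I.δ i j * (I.w ^ b)⁻¹ := by
  unfold δ; rw [I.g_per_int, I.g_per_int]; group

lemma colIn_forward (k : ℕ) : ∀ (i : ℤ) (N : SL(2, ℝ)) (c : Fin 2),
    ¬ S.ColIn (I.x (i + k)).rev N c → S.ColIn (I.x i) ((I.g i)⁻¹ * I.g (i + k + 1) * N) c := by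
  induction k with
  | zero =>
    intro i N c h
    rw [Nat.cast_zero, add_zero] at *
    rw [I.g_succ]
    simpa [mul_assoc] using S.colIn_mul h
  | succ k ih =>
    intro i N c h
    have e1 : i + ((k + 1 : ℕ) : ℤ) = i + 1 + k := by push_cast; ring
    rw [e1] at h ⊢
    have := (ih (i + 1) N c h).mul (I.red i)
    rw [I.g_succ i] at this
    simpa [mul_assoc] using this

lemma colIn_backward (k : ℕ) : ∀ (i : ℤ) (N : SL(2, ℝ)) (c : Fin 2),
    ¬ S.ColIn (I.x (i - 1 - k)) N c →
      S.ColIn (I.x (i - 1)).rev ((I.g i)⁻¹ * I.g (i - 1 - k) * N) c := by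
  induction k with
  | zero =>
    intro i N c h
    rw [Nat.cast_zero, sub_zero] at *
    rw [I.g_pred]
    simpa [mul_assoc] using S.colIn_mul (y := (I.x (i - 1)).rev) (by rwa [Fin.rev_rev])
  | succ k ih =>
    intro i N c h
    have e1 : i - 1 - ((k + 1 : ℕ) : ℤ) = i - 1 - 1 - k := by push_cast; ring
    rw [e1] at h ⊢
    have := (ih (i - 1) N c h).mul (y := (I.x (i - 1)).rev) (by
      rw [Fin.rev_rev]
      have := I.red' (i - 1)
      exact this.symm)
    rw [I.g_pred i] at this
    simpa [mul_assoc] using this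

/-- The element spells the letters from `i` to `i' - 1`, and its first letter is visible on `∞`. -/
lemma colIn_infty_forward {i i' : ℤ} (h : i < i') : S.ColIn (I.x i) ((I.g i)⁻¹ * I.g i') 0 := by
  have := I.colIn_forward (i' - i - 1).toNat i 1 0 (S.not_colIn_one _)
  rw [Int.toNat_of_nonneg (by omega), mul_one] at this
  rwa [show i + (i' - i - 1) + 1 = i' by ring] at this

lemma colIn_infty_backward {i i' : ℤ} (h : i' < i) :
    S.ColIn (I.x (i - 1)).rev ((I.g i)⁻¹ * I.g i') 0 := by
  have := I.colIn_backward (i - 1 - i').toNat i 1 0 (S.not_colIn_one _)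
  rw [Int.toNat_of_nonneg (by omega), mul_one] at this
  rwa [show i - 1 - (i - 1 - i') = i' by ring] at this

lemma W_diag : I.W 0 1 = 0 ∧ I.W 1 0 = 0 ∧ I.W 1 1 ^ 2 < 1 := by
  have h := fun t => (smul_axisPoint_eq_iff I.W t (t + I.ℓ)).1 (I.axis t)
  have hd := det_eq I.W
  have h0 := h 0
  have h1 := h 1
  have e : Real.exp 0 * Real.exp (0 + I.ℓ) < Real.exp 1 * Real.exp (1 + I.ℓ) := by
    rw [← Real.exp_add, ← Real.exp_add]; apply Real.exp_lt_exp.2; linarith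
  have h10 : I.W 1 0 = 0 := by
    have : I.W 1 0 * (Real.exp 1 * Real.exp (1 + I.ℓ) - Real.exp 0 * Real.exp (0 + I.ℓ)) = 0 := by
      linarith [h0.1, h1.1]
    rcases mul_eq_zero.1 this with h | h
    · exact h
    · linarith
  have h01 : I.W 0 1 = 0 := by rw [h0.1, h10]; simp
  refine ⟨h01, h10, ?_⟩
  have h2 := h0.2
  rw [Real.exp_zero, mul_one, zero_add] at h2
  rw [h01, zero_mul, sub_zero, h2] at hd
  have hℓ : 1 < Real.exp I.ℓ := Real.one_lt_exp_iff.2 I.ℓ_pos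
  nlinarith [sq_nonneg (I.W 1 1)]

lemma w_pow (k : ℕ) : I.w ^ k = I.M * I.W ^ k * I.M⁻¹ := by
  have : I.W ^ k = I.M⁻¹ * I.w ^ k * I.M := by
    unfold W
    simpa using (conj_pow (i := k) (a := I.M⁻¹) (b := I.w))
  rw [this]; group

/-- The forward end is the limit of the images of `∞` under prefixes that are whole periods further
on. Seen from vertex `i`, all of these lie in the interval of `x i`. -/
lemma colIn_line_zero (i : ℤ) : S.ColIn (I.x i) (I.line i) 0 := by
  obtain ⟨h01, h10, h11⟩ := I.W_diag
  refine cone_attracting h01 h10 h11 fun k => ?_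
  have h := I.colIn_infty_forward (i := i) (i' := i + ((k + 1 : ℕ) : ℤ) * I.L) (by
    have := I.L_pos
    push_cast
    nlinarith [mul_nonneg (Int.natCast_nonneg k) this.le])
  rw [I.g_per_nat, I.w_pow] at h
  have e : (I.g i)⁻¹ * (I.M * I.W ^ (k + 1) * I.M⁻¹ * I.g i) =
      I.line i * I.W ^ (k + 1) * (I.line i)⁻¹ := by
    unfold line; group
  rw [e] at h
  exact h

lemma colIn_line_one (i : ℤ) : S.ColIn (I.x (i - 1)).rev (I.line i) 1 := by
  obtain ⟨h01, h10, h11⟩ := I.W_diag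
  obtain ⟨i00, i01, i10, i11⟩ := inv_entries I.W
  refine cone_repelling (D := I.W⁻¹) (by rw [i01, h01, neg_zero]) (by rw [i10, h10, neg_zero])
    (by rw [i00]; exact h11) fun k => ?_
  have hlt : i + -((k + 1 : ℕ) : ℤ) * I.L < i := by
    have := I.L_pos
    push_cast
    nlinarith [mul_nonneg (Int.natCast_nonneg k) this.le]
  have h := I.colIn_infty_backward hlt
  rw [I.g_per_int, zpow_neg, zpow_natCast, I.w_pow] at h
  have e : (I.g i)⁻¹ * ((I.M * I.W ^ (k + 1) * I.M⁻¹)⁻¹ * I.g i) =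
      I.line i * I.W⁻¹ ^ (k + 1) * (I.line i)⁻¹ := by
    unfold line; group
  rw [e] at h
  exact h

/-- The forward and the backward end of the line seen from the `i`-th vertex. -/
noncomputable def v (i : ℤ) : ℝ := ratio (I.line i) 0

noncomputable def u (i : ℤ) : ℝ := ratio (I.line i) 1

lemma Lk_iff_ratio (i j : ℤ) : I.Lk i j ↔
    (I.v j - I.u i) * (I.u j - I.u i) * (I.v i - I.v j) * (I.v i - I.u j) < 0 := by
  rw [I.Lk_iff, entryProd_inv_mul_neg_iff (I.colIn_line_zero i).ne_zero
    (I.colIn_line_one i).ne_zero (I.colIn_line_zero j).ne_zero (I.colIn_line_one j).ne_zero]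
  rfl

lemma line_eq (i : ℤ) : I.line i = S.G (I.x i) * I.line (i + 1) := by
  unfold line; rw [I.g_succ]; group

lemma x_agree_shift {i j : ℤ} (h : ∀ t : ℕ, I.x (i + t) = I.x (j + t)) (k : ℕ) :
    I.δ (i + k) (j + k) = I.δ i j := by
  induction k with
  | zero => simp
  | succ k ih =>
    rw [← ih]
    have := I.δ_succ_succ (h k)
    rw [← this]; push_cast; congr 1 <;> ring

lemma x_agree_reverse {i j : ℤ} (h : ∀ t : ℕ, I.x (i + t) = (I.x (j - 1 - t)).rev) (k : ℕ) :
    I.δ (i + k) (j - k) = I.δ i j := by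
  induction k with
  | zero => simp
  | succ k ih =>
    rw [← ih]
    have := I.δ_succ_pred (i := i + k) (j := j - k) (by rw [h k]; congr 2; ring)
    rw [← this]; push_cast; congr 1 <;> ring

/-- `W` is diagonal with distinct eigenvalues, so whatever commutes with it preserves the axis. -/
lemma entryProd_eq_zero_of_commute {K : SL(2, ℝ)} (h : I.W * K = K * I.W) : entryProd K = 0 := by
  obtain ⟨h01, h10, h11⟩ := I.W_diag
  have hd := det_eq I.W
  rw [h01, zero_mul, sub_zero] at hd
  have e := congrArg (fun A : SL(2, ℝ) => A 0 1) h
  simp only [mul_entry, h01] at e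
  have hne : I.W 0 0 ≠ I.W 1 1 := by
    intro he; rw [he] at hd; nlinarith
  have : K 0 1 * (I.W 0 0 - I.W 1 1) = 0 := by linarith
  have : K 0 1 = 0 := (mul_eq_zero.1 this).resolve_right (sub_ne_zero.2 hne)
  unfold entryProd; rw [this]; ring

lemma entryProd_eq_zero_of_inverts {K : SL(2, ℝ)} (h : I.W * K = K * I.W⁻¹) :
    entryProd K = 0 := by
  obtain ⟨h01, h10, h11⟩ := I.W_diag
  obtain ⟨i00, i01, i10, i11⟩ := inv_entries I.W
  have hd := det_eq I.W
  rw [h01, zero_mul, sub_zero] at hd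
  have e := congrArg (fun A : SL(2, ℝ) => A 0 0) h
  simp only [mul_entry, h01, h10, i00, i10] at e
  have hne : I.W 0 0 ≠ I.W 1 1 := by
    intro he; rw [he] at hd; nlinarith
  have : K 0 0 * (I.W 0 0 - I.W 1 1) = 0 := by linarith
  have : K 0 0 = 0 := (mul_eq_zero.1 this).resolve_right (sub_ne_zero.2 hne)
  unfold entryProd; rw [this]; ring

lemma toNat_L : ((I.L.toNat : ℕ) : ℤ) = I.L := Int.toNat_of_nonneg I.L_pos.le

/-- If `δ` is invariant under translation by a period, it commutes with `w`. -/
lemma not_Lk_of_agree {i j : ℤ} (h : I.δ (i + I.L) (j + I.L) = I.δ i j) : ¬ I.Lk i j := by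
  have := I.δ_per i j 1 1
  rw [one_mul, h, zpow_one] at this
  have h2 : I.w * I.δ i j = I.δ i j * I.w := by
    nth_rewrite 2 [this]; group
  unfold Lk
  rw [I.entryProd_eq_zero_of_commute]
  · exact lt_irrefl _
  · unfold W
    have : I.M⁻¹ * I.w * I.M * (I.M⁻¹ * I.δ i j * I.M) = I.M⁻¹ * (I.w * I.δ i j) * I.M := by group
    rw [this, h2]; group

lemma not_Lk_of_agree_reverse {i j : ℤ} (h : I.δ (i + I.L) (j - I.L) = I.δ i j) : ¬ I.Lk i j := by
  have := I.δ_per i j 1 (-1)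
  rw [one_mul, neg_one_mul, ← sub_eq_add_neg, h, zpow_one, zpow_neg_one, inv_inv] at this
  have h2 : I.w * I.δ i j = I.δ i j * I.w⁻¹ := by
    nth_rewrite 2 [this]; group
  unfold Lk
  rw [I.entryProd_eq_zero_of_inverts]
  · exact lt_irrefl _
  · unfold W
    have : I.M⁻¹ * I.w * I.M * (I.M⁻¹ * I.δ i j * I.M) = I.M⁻¹ * (I.w * I.δ i j) * I.M := by group
    rw [this, h2]; group

lemma Lk_congr {i j i' j' : ℤ} (h : I.δ i' j' = I.δ i j) : I.Lk i' j' ↔ I.Lk i j := by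
  unfold Lk; rw [h]

/-- The lines seen from vertices `i` and `j` part at these vertices, in the forward direction of the
first one. -/
def Front (i j : ℤ) : Prop := I.x i ≠ I.x j ∧ I.x i ≠ (I.x (j - 1)).rev

/-- The same in the backward direction of the first line. -/
def Back (i j : ℤ) : Prop := I.x (i - 1) ≠ I.x (j - 1) ∧ I.x j ≠ (I.x (i - 1)).rev

/-- The vertices slide forward along the first line while the second one goes with it, in its own
direction or in the opposite one. If this never stopped, `δ` would commute with `w` or invert it,
and the lines would not cross. -/
lemma exists_front {i j : ℤ} (h : I.Lk i j) : ∃ i' j', I.δ i' j' = I.δ i j ∧ I.Front i' j' := by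
  classical
  by_cases h1 : I.x i = I.x j
  · have hex : ∃ t : ℕ, I.x (i + t) ≠ I.x (j + t) := by
      by_contra! hall
      have := I.x_agree_shift hall I.L.toNat
      rw [I.toNat_L] at this
      exact I.not_Lk_of_agree this h
    obtain ⟨ht, hmin⟩ := Nat.find_spec hex, fun m => @Nat.find_min _ _ hex m
    set t := Nat.find hex
    have hδ : ∀ k ≤ t, I.δ (i + k) (j + k) = I.δ i j := by
      intro k hk
      induction k with
      | zero => simp
      | succ k ih =>
        rw [← ih (by omega), ← I.δ_succ_succ (not_not.1 (hmin k (by omega)))]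
        push_cast; congr 1 <;> ring
    have ht0 : 1 ≤ t := by
      by_contra! h0
      have : t = 0 := by omega
      rw [this] at ht; simp [h1] at ht
    refine ⟨i + t, j + t, hδ t le_rfl, ht, ?_⟩
    -- The lines have just shared an edge, so the remaining coincidence would contradict
    -- reducedness.
    have := not_not.1 (hmin (t - 1) (by omega))
    rw [show j + (t : ℤ) - 1 = j + ((t - 1 : ℕ) : ℤ) by omega, ← this]
    rw [show i + (t : ℤ) = i + ((t - 1 : ℕ) : ℤ) + 1 by omega]
    exact I.red _
  · by_cases h2 : I.x i = (I.x (j - 1)).rev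
    · have hex : ∃ t : ℕ, I.x (i + t) ≠ (I.x (j - 1 - t)).rev := by
        by_contra! hall
        have := I.x_agree_reverse hall I.L.toNat
        rw [I.toNat_L] at this
        exact I.not_Lk_of_agree_reverse this h
      obtain ⟨ht, hmin⟩ := Nat.find_spec hex, fun m => @Nat.find_min _ _ hex m
      set t := Nat.find hex
      have hδ : ∀ k ≤ t, I.δ (i + k) (j - k) = I.δ i j := by
        intro k hk
        induction k with
        | zero => simp
        | succ k ih =>
          rw [← ih (by omega), ← I.δ_succ_pred (i := i + k) (j := j - k) (by
            rw [not_not.1 (hmin k (by omega))]; congr 2; ring)]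
          push_cast; congr 1 <;> ring
      have ht0 : 1 ≤ t := by
        by_contra! h0
        have : t = 0 := by omega
        rw [this] at ht; simp [h2] at ht
      refine ⟨i + t, j - t, hδ t le_rfl, ?_, by
        rw [show j - (t : ℤ) - 1 = j - 1 - t by ring]; exact ht⟩
      have := not_not.1 (hmin (t - 1) (by omega))
      rw [show j - (t : ℤ) = j - 1 - ((t - 1 : ℕ) : ℤ) by omega]
      rw [show i + (t : ℤ) = i + ((t - 1 : ℕ) : ℤ) + 1 by omega]
      intro h3
      apply I.red (i + ((t - 1 : ℕ) : ℤ))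
      rw [h3, this, Fin.rev_rev]
    · exact ⟨i, j, rfl, h1, h2⟩

lemma δ_pred_pred {i j : ℤ} (h : I.x (i - 1) = I.x (j - 1)) : I.δ (i - 1) (j - 1) = I.δ i j := by
  rw [← I.δ_succ_succ h]; simp

lemma δ_pred_succ {i j : ℤ} (h : I.x j = (I.x (i - 1)).rev) : I.δ (i - 1) (j + 1) = I.δ i j := by
  rw [← I.δ_succ_pred (i := i - 1) (j := j + 1) (by rw [add_sub_cancel_right, h, Fin.rev_rev])]
  simp

lemma exists_back {i j : ℤ} (h : I.Lk i j) : ∃ i' j', I.δ i' j' = I.δ i j ∧ I.Back i' j' := by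
  classical
  by_cases h1 : I.x (i - 1) = I.x (j - 1)
  · have hex : ∃ t : ℕ, I.x (i - 1 - t) ≠ I.x (j - 1 - t) := by
      by_contra! hall
      have hδ : ∀ k : ℕ, I.δ (i - k) (j - k) = I.δ i j := by
        intro k
        induction k with
        | zero => simp
        | succ k ih =>
          rw [← ih, ← I.δ_pred_pred (i := i - k) (j := j - k) (by
            convert hall k using 2 <;> ring)]
          push_cast; congr 1 <;> ring
      have := hδ I.L.toNat
      rw [I.toNat_L] at this
      -- The coincidence extends backward, so the period is read from the vertices one period
      -- earlier.
      refine I.not_Lk_of_agree (i := i - I.L) (j := j - I.L) ?_ ((I.Lk_congr this).2 h)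
      rw [this, sub_add_cancel, sub_add_cancel]
    obtain ⟨ht, hmin⟩ := Nat.find_spec hex, fun m => @Nat.find_min _ _ hex m
    set t := Nat.find hex
    have hδ : ∀ k ≤ t, I.δ (i - k) (j - k) = I.δ i j := by
      intro k hk
      induction k with
      | zero => simp
      | succ k ih =>
        rw [← ih (by omega), ← I.δ_pred_pred (i := i - k) (j := j - k) (by
          convert not_not.1 (hmin k (by omega)) using 2 <;> ring)]
        push_cast; congr 1 <;> ring
    have ht0 : 1 ≤ t := by
      by_contra! h0
      have : t = 0 := by omega
      rw [this] at ht; simp [h1] at ht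
    refine ⟨i - t, j - t, hδ t le_rfl, by convert ht using 2 <;> ring_nf, ?_⟩
    have := not_not.1 (hmin (t - 1) (by omega))
    rw [show j - (t : ℤ) = j - 1 - ((t - 1 : ℕ) : ℤ) by omega, ← this]
    rw [show i - (t : ℤ) - 1 = i - 1 - ((t - 1 : ℕ) : ℤ) - 1 by omega]
    exact I.red' _
  · by_cases h2 : I.x j = (I.x (i - 1)).rev
    · have hex : ∃ t : ℕ, I.x (j + t) ≠ (I.x (i - 1 - t)).rev := by
        by_contra! hall
        have hδ : ∀ k : ℕ, I.δ (i - k) (j + k) = I.δ i j := by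
          intro k
          induction k with
          | zero => simp
          | succ k ih =>
            rw [← ih, ← I.δ_pred_succ (i := i - k) (j := j + k) (by
              convert hall k using 3; ring)]
            push_cast; congr 1 <;> ring
        have := hδ I.L.toNat
        rw [I.toNat_L] at this
        refine I.not_Lk_of_agree_reverse (i := i - I.L) (j := j + I.L) ?_ ((I.Lk_congr this).2 h)
        rw [this, sub_add_cancel, add_sub_cancel_right]
      obtain ⟨ht, hmin⟩ := Nat.find_spec hex, fun m => @Nat.find_min _ _ hex m
      set t := Nat.find hex
      have hδ : ∀ k ≤ t, I.δ (i - k) (j + k) = I.δ i j := by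
        intro k hk
        induction k with
        | zero => simp
        | succ k ih =>
          rw [← ih (by omega), ← I.δ_pred_succ (i := i - k) (j := j + k) (by
            rw [not_not.1 (hmin k (by omega))]; congr 2; ring)]
          push_cast; congr 1 <;> ring
      have ht0 : 1 ≤ t := by
        by_contra! h0
        have : t = 0 := by omega
        rw [this] at ht; simp [h2] at ht
      refine ⟨i - t, j + t, hδ t le_rfl, ?_, by
        rw [show i - (t : ℤ) - 1 = i - 1 - t by ring]; exact ht⟩
      have := not_not.1 (hmin (t - 1) (by omega))
      rw [show j + (t : ℤ) - 1 = j + ((t - 1 : ℕ) : ℤ) by omega, this]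
      rw [show i - (t : ℤ) - 1 = i - 1 - ((t - 1 : ℕ) : ℤ) - 1 by omega]
      intro h3
      exact I.red' (i - 1 - ((t - 1 : ℕ) : ℤ)) (by rw [h3, Fin.rev_rev])
    · exact ⟨i, j, rfl, h1, h2⟩

/-- The lines share at most the forward direction at the vertices `i` and `j`. -/
def BackEnd (i j : ℤ) : Prop :=
  I.x (i - 1) ≠ I.x (j - 1) ∧ I.x i ≠ (I.x (j - 1)).rev ∧ I.x j ≠ (I.x (i - 1)).rev

variable {I}

lemma BackEnd.symm {i j : ℤ} (h : I.BackEnd i j) : I.BackEnd j i := ⟨h.1.symm, h.2.2, h.2.1⟩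

/-- The element leading from vertex `i` to `i'` also leads from `j` to `j'`. Its action on `∞`, or
that of its inverse, shows a direction shared by both lines. For `j < j'` and `j' < j` this
direction is forbidden by `BackEnd`; for `j = j'` the element would be trivial. -/
lemma not_backEnd_of_lt {i j i' j' : ℤ} (h : I.BackEnd i j) (h' : I.BackEnd i' j')
    (hδ : I.δ i j = I.δ i' j') : ¬ i < i' := by
  intro hlt
  have e : (I.g i)⁻¹ * I.g i' = (I.g j)⁻¹ * I.g j' := by
    unfold δ at hδ
    have : I.g i' = I.g i * (I.g j)⁻¹ * I.g j' := by rw [hδ]; group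
    rw [this]; group
  have e' : (I.g i')⁻¹ * I.g i = (I.g j')⁻¹ * I.g j := by
    have := congrArg (·⁻¹) e
    simpa using this
  have h1 := I.colIn_infty_forward hlt
  have h2 := I.colIn_infty_backward hlt
  rcases lt_trichotomy j j' with hj | hj | hj
  · have h3 := I.colIn_infty_backward hj
    rw [e'] at h2
    exact h'.1 (Fin.rev_injective (h2.unique h3))
  · rw [e, hj, inv_mul_cancel] at h1
    exact S.not_colIn_one _ h1
  · have h3 := I.colIn_infty_backward hj
    rw [e] at h1
    exact h.2.1 (h1.unique h3)

lemma BackEnd.unique {i j i' j' : ℤ} (h : I.BackEnd i j) (h' : I.BackEnd i' j')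
    (hδ : I.δ i j = I.δ i' j') : i = i' ∧ j = j' := by
  have hi : i = i' := le_antisymm (not_lt.1 (not_backEnd_of_lt h' h hδ.symm))
    (not_lt.1 (not_backEnd_of_lt h h' hδ))
  subst hi
  have hδ' : I.δ j i = I.δ j' i := by
    have := congrArg (·⁻¹) hδ
    unfold δ at this ⊢
    simpa using this
  exact ⟨rfl, le_antisymm (not_lt.1 (not_backEnd_of_lt h'.symm h.symm hδ'.symm))
    (not_lt.1 (not_backEnd_of_lt h.symm h'.symm hδ'))⟩

variable (I)

/-- Translates of the line that cross it meet it in the tree of the free group. -/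
lemma exists_δ_of_spell : ∀ (n : ℕ) (l : List (Fin 4)), l.length = n → PingPong.Reduced l →
    ∀ i j, entryProd (I.M⁻¹ * (I.g i * S.spell l * (I.g j)⁻¹) * I.M) < 0 →
      ∃ i' j', I.g i * S.spell l * (I.g j)⁻¹ = I.δ i' j' := by
  intro n
  induction n with
  | zero =>
    intro l hl _ i j _
    rw [List.length_eq_zero_iff] at hl
    subst hl
    exact ⟨i, j, by simp [PingPong.spell, δ]⟩
  | succ n ih =>
    intro l hn hl i j h
    obtain ⟨y, l', rfl⟩ := List.exists_cons_of_length_eq_add_one hn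
    obtain ⟨l'', y', hl''⟩ := (List.eq_nil_or_concat (y :: l')).resolve_left (by simp)
    rw [List.concat_eq_append] at hl''
    have hlen' : l'.length = n := by simpa using hn
    have hlen'' : l''.length = n := by rw [hl''] at hn; simpa using hn
    have hred' : PingPong.Reduced l' := (List.isChain_cons.1 hl).2
    have hred'' : PingPong.Reduced l'' := by
      have := hl; rw [hl''] at this; exact (List.isChain_append.1 this).1
    have key : ∀ i₁ j₁ (l₁ : List (Fin 4)), l₁.length = n → PingPong.Reduced l₁ →
        I.g i * S.spell (y :: l') * (I.g j)⁻¹ = I.g i₁ * S.spell l₁ * (I.g j₁)⁻¹ →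
        ∃ i' j', I.g i * S.spell (y :: l') * (I.g j)⁻¹ = I.δ i' j' := by
      intro i₁ j₁ l₁ h1 h2 h3
      rw [h3] at h ⊢
      exact ih l₁ h1 h2 i₁ j₁ h
    -- A first letter along the first line or a last letter along the second one is absorbed into
    -- the index, forward or backward.
    by_cases c1 : y = I.x i
    · exact key (i + 1) j l' hlen' hred' (by rw [I.g_succ, S.spell_cons, c1]; simp [mul_assoc])
    by_cases c2 : y = (I.x (i - 1)).rev
    · exact key (i - 1) j l' hlen' hred' (by rw [I.g_pred, S.spell_cons, c2]; simp [mul_assoc])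
    by_cases c3 : y'.rev = I.x j
    · refine key i (j + 1) l'' hlen'' hred'' ?_
      rw [hl'', S.spell_append, I.g_succ, ← c3, S.inv]
      simp [PingPong.spell, mul_assoc]
    by_cases c4 : y'.rev = (I.x (j - 1)).rev
    · refine key i (j - 1) l'' hlen'' hred'' ?_
      rw [hl'', S.spell_append, I.g_pred, ← c4, S.inv]
      simp [PingPong.spell, mul_assoc]
    -- Now the word leaves both lines. Both ends of the translate lie in the single interval of `y`,
    -- which contains neither end of the first line, so the ends are not linked.
    exfalso
    have hlast : (y :: l').getLast (by simp) = y' := by simp [hl'']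
    have hc0 := S.colIn_spell l' y hl (by
      rw [hlast]; intro hc; exact c3 (hc.unique (I.colIn_line_zero j)))
    have hc1 := S.colIn_spell l' y hl (by
      rw [hlast]; intro hc; exact c4 (hc.unique (I.colIn_line_one j)))
    set N := S.spell (y :: l') * I.line j with hN
    have h' : entryProd ((I.line i)⁻¹ * N) < 0 := by
      have : (I.line i)⁻¹ * N = I.M⁻¹ * (I.g i * S.spell (y :: l') * (I.g j)⁻¹) * I.M := by
        rw [hN]; unfold line; group
      rwa [this]
    have hi0 := I.colIn_line_zero i
    have hi1 := I.colIn_line_one i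
    rw [entryProd_inv_mul_neg_iff hi0.ne_zero hi1.ne_zero hc0.ne_zero hc1.ne_zero] at h'
    have a : 0 < (ratio N 0 - ratio (I.line i) 1) * (ratio N 1 - ratio (I.line i) 1) := by
      rcases lt_or_gt_of_ne c2 with hlt | hlt
      · exact mul_pos_of_neg_of_neg (by linarith [hc0.lt hi1 hlt]) (by linarith [hc1.lt hi1 hlt])
      · exact mul_pos (by linarith [hi1.lt hc0 hlt]) (by linarith [hi1.lt hc1 hlt])
    have b : 0 < (ratio (I.line i) 0 - ratio N 0) * (ratio (I.line i) 0 - ratio N 1) := by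
      rcases lt_or_gt_of_ne c1 with hlt | hlt
      · exact mul_pos (by linarith [hc0.lt hi0 hlt]) (by linarith [hc1.lt hi0 hlt])
      · exact mul_pos_of_neg_of_neg (by linarith [hi0.lt hc0 hlt]) (by linarith [hi0.lt hc1 hlt])
    nlinarith [mul_pos a b]

lemma exists_δ {h : SL(2, ℝ)} (hh : h ∈ S.Gam) (hX : entryProd (I.M⁻¹ * h * I.M) < 0) :
    ∃ i j, h = I.δ i j := by
  obtain ⟨l, hl, rfl⟩ := S.exists_reduced hh
  have := I.exists_δ_of_spell _ l rfl hl 0 0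
  simpa [I.g_zero, hX] using this

end Itinerary

/-! ### Counting crossings by pairs of vertices modulo the period -/

lemma entryProd_inv (K : SL(2, ℝ)) : entryProd K⁻¹ = entryProd K := by
  obtain ⟨a, b, c, d⟩ := inv_entries K
  unfold entryProd; rw [a, b, c, d]; ring

lemma entryProd_diag_mul {D : SL(2, ℝ)} (h01 : D 0 1 = 0) (h10 : D 1 0 = 0) (K : SL(2, ℝ)) :
    entryProd (D * K) = entryProd K := by
  have hd := det_eq D
  rw [h01, zero_mul, sub_zero] at hd
  unfold entryProd
  simp only [mul_entry, h01, h10]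
  linear_combination (K 0 0 * K 0 1 * K 1 0 * K 1 1) * (D 0 0 * D 1 1 + 1) * hd

lemma entryProd_mul_diag {D : SL(2, ℝ)} (h01 : D 0 1 = 0) (h10 : D 1 0 = 0) (K : SL(2, ℝ)) :
    entryProd (K * D) = entryProd K := by
  obtain ⟨-, b, c, -⟩ := inv_entries D
  rw [← entryProd_inv, mul_inv_rev, entryProd_diag_mul (by rw [b, h01, neg_zero])
    (by rw [c, h10, neg_zero]), entryProd_inv]

namespace Itinerary
variable {S : PingPong} (I : Itinerary S)

lemma W_zpow_smul (a : ℤ) (t : ℝ) : I.W ^ a • axisPoint t = axisPoint (t + a * I.ℓ) := by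
  have hnat : ∀ (n : ℕ) t, I.W ^ n • axisPoint t = axisPoint (t + n * I.ℓ) := by
    intro n
    induction n with
    | zero => intro t; simp
    | succ n ih =>
      intro t
      rw [pow_succ, mul_smul, show I.W • axisPoint t = axisPoint (t + I.ℓ) from I.axis t, ih]
      congr 1; push_cast; ring
  obtain ⟨n, rfl | rfl⟩ := a.eq_nat_or_neg
  · exact_mod_cast hnat n t
  · rw [zpow_neg, zpow_natCast, inv_smul_eq_iff, hnat]
    congr 1; push_cast; ring

lemma conj_δ_per (i j a b : ℤ) : I.M⁻¹ * I.δ (i + a * I.L) (j + b * I.L) * I.M =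
    I.W ^ a * (I.M⁻¹ * I.δ i j * I.M) * (I.W ^ b)⁻¹ := by
  have : ∀ a : ℤ, I.W ^ a = I.M⁻¹ * I.w ^ a * I.M := by
    intro a
    unfold W
    simpa using (conj_zpow (i := a) (a := I.M⁻¹) (b := I.w))
  rw [this, this, I.δ_per]; group

lemma Lk_per (i j a b : ℤ) : I.Lk (i + a * I.L) (j + b * I.L) ↔ I.Lk i j := by
  obtain ⟨h01, h10, -⟩ := I.W_diag
  obtain ⟨-, b', c', -⟩ := inv_entries I.W
  have h1 : ∀ i j, I.Lk (i + I.L) j ↔ I.Lk i j := by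
    intro i j
    have := I.conj_δ_per i j 1 0
    unfold Lk
    rw [one_mul, zero_mul, add_zero, zpow_one, zpow_zero, inv_one, mul_one] at this
    rw [this, entryProd_diag_mul h01 h10]
  have h2 : ∀ i j, I.Lk i (j + I.L) ↔ I.Lk i j := by
    intro i j
    have := I.conj_δ_per i j 0 1
    unfold Lk
    rw [one_mul, zero_mul, add_zero, zpow_one, zpow_zero, one_mul] at this
    rw [this, entryProd_mul_diag (by rw [b', h01, neg_zero]) (by rw [c', h10, neg_zero])]
  have p1 : ∀ j, Function.Periodic (fun i => I.Lk i j) (a * I.L) := fun j => by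
    have : Function.Periodic (fun i => I.Lk i j) I.L := fun i => propext (h1 i j)
    exact_mod_cast this.int_mul a
  have p2 : ∀ i, Function.Periodic (fun j => I.Lk i j) (b * I.L) := fun i => by
    have : Function.Periodic (fun j => I.Lk i j) I.L := fun j => propext (h2 i j)
    exact_mod_cast this.int_mul b
  have e1 := p1 (j + b * I.L) i
  have e2 := p2 i j
  simp only at e1 e2
  rw [e1, e2]

/-- The pairs of parameters `(s, t)` in `[0, ℓ)` at which the line is crossed by its translate. -/
def orderedCrossings : Set (ℝ × ℝ) :=
  {p | 0 ≤ p.1 ∧ p.1 < I.ℓ ∧ 0 ≤ p.2 ∧ p.2 < I.ℓ ∧ ∃ h ∈ S.Gam,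
    (I.M⁻¹ * h * I.M) • axisPoint p.1 = axisPoint p.2 ∧ entryProd (I.M⁻¹ * h * I.M) < 0}

/-- The crossing `p` is seen from the vertices `q`. -/
def SeenFrom (p : ℝ × ℝ) (q : ℤ × ℤ) : Prop := ∃ a b : ℤ,
  (I.M⁻¹ * I.δ q.1 q.2 * I.M) • axisPoint (p.1 + b * I.ℓ) = axisPoint (p.2 + a * I.ℓ)

/-- Pairs of vertices modulo translation. -/
noncomputable def box : Finset (ℤ × ℤ) := Finset.Ico 0 I.L ×ˢ Finset.Ico 0 I.L

lemma eq_of_mod {s s' b : ℝ} {m m' : ℤ} (hs : 0 ≤ s) (hs' : s < b) (ht : 0 ≤ s') (ht' : s' < b)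
    (h : s + m * b = s' + m' * b) : s = s' := by
  have : ((m - m' : ℤ) : ℝ) * b = s' - s := by push_cast; linarith
  have h1 : ((m - m' : ℤ) : ℝ) < 1 := by
    by_contra! hc; nlinarith
  have h2 : (-1 : ℝ) < ((m - m' : ℤ) : ℝ) := by
    by_contra! hc; nlinarith
  have h3 : m - m' = 0 := by
    have h1' : m - m' < 1 := by exact_mod_cast h1
    have h2' : -1 < m - m' := by exact_mod_cast h2
    omega
  rw [h3] at this; simp at this; linarith

/-- Two different lines meet at most once, and parameters in `[0, ℓ)` are determined by their
classes. -/
lemma SeenFrom.unique {p p' : ℝ × ℝ} {q : ℤ × ℤ} (hp : p ∈ I.orderedCrossings)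
    (hp' : p' ∈ I.orderedCrossings) (hq : I.Lk q.1 q.2) (h : I.SeenFrom p q)
    (h' : I.SeenFrom p' q) : p = p' := by
  obtain ⟨a, b, h⟩ := h
  obtain ⟨a', b', h'⟩ := h'
  obtain ⟨-, -, h3, h4⟩ := ne_zero_of_entryProd_neg hq
  obtain ⟨e1, e2⟩ := crossing_unique h3 h4 h h'
  obtain ⟨p1, p2, p3, p4, -⟩ := hp
  obtain ⟨p1', p2', p3', p4', -⟩ := hp'
  exact Prod.ext (eq_of_mod p1 p2 p1' p2' e1) (eq_of_mod p3 p4 p3' p4' e2)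

lemma seenFrom_of_δ {p : ℝ × ℝ} {i j : ℤ}
    (h : (I.M⁻¹ * I.δ i j * I.M) • axisPoint p.1 = axisPoint p.2) :
    I.SeenFrom p (i % I.L, j % I.L) := by
  have e := I.conj_δ_per (i % I.L) (j % I.L) (i / I.L) (j / I.L)
  rw [mul_comm (i / I.L), mul_comm (j / I.L), Int.emod_add_mul_ediv, Int.emod_add_mul_ediv] at e
  refine ⟨-(i / I.L), -(j / I.L), ?_⟩
  rw [e, mul_smul, mul_smul, ← zpow_neg, W_zpow_smul] at h
  rw [← W_zpow_smul (a := -(i / I.L)), zpow_neg, ← h, inv_smul_smul]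

lemma emod_mem_box (i j : ℤ) : (i % I.L, j % I.L) ∈ I.box := by
  have := I.L_pos
  simp only [box, Finset.mem_product, Finset.mem_Ico]
  exact ⟨⟨Int.emod_nonneg _ this.ne', Int.emod_lt_of_pos _ this⟩,
    ⟨Int.emod_nonneg _ this.ne', Int.emod_lt_of_pos _ this⟩⟩

lemma x_emod (i k : ℤ) : I.x (i % I.L + k) = I.x (i + k) := by
  rw [← I.x_per_int (i % I.L + k) (i / I.L)]
  congr 1
  have := Int.emod_add_mul_ediv i I.L
  linarith

lemma x_emod_zero (i : ℤ) : I.x (i % I.L) = I.x i := by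
  have := I.x_emod i 0
  simpa using this

lemma x_emod_pred (i : ℤ) : I.x (i % I.L - 1) = I.x (i - 1) := I.x_emod i (-1)

lemma Lk_emod (i j : ℤ) : I.Lk (i % I.L) (j % I.L) ↔ I.Lk i j := by
  rw [← I.Lk_per (i % I.L) (j % I.L) (i / I.L) (j / I.L), mul_comm (i / I.L), mul_comm (j / I.L),
    Int.emod_add_mul_ediv, Int.emod_add_mul_ediv]

lemma exists_seenFrom_front {p : ℝ × ℝ} (hp : p ∈ I.orderedCrossings) :
    ∃ q ∈ I.box, I.SeenFrom p q ∧ I.Lk q.1 q.2 ∧ I.Front q.1 q.2 := by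
  obtain ⟨-, -, -, -, h, hh, hs, hX⟩ := hp
  obtain ⟨i, j, rfl⟩ := I.exists_δ hh hX
  obtain ⟨i', j', hδ, hF⟩ := I.exists_front hX
  rw [← hδ] at hs hX
  refine ⟨_, I.emod_mem_box i' j', I.seenFrom_of_δ hs, (I.Lk_emod _ _).2 hX, ?_⟩
  unfold Front at *
  simpa only [I.x_emod_zero, I.x_emod_pred] using hF

lemma exists_seenFrom_back {p : ℝ × ℝ} (hp : p ∈ I.orderedCrossings) :
    ∃ q ∈ I.box, I.SeenFrom p q ∧ I.Lk q.1 q.2 ∧ I.Back q.1 q.2 := by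
  obtain ⟨-, -, -, -, h, hh, hs, hX⟩ := hp
  obtain ⟨i, j, rfl⟩ := I.exists_δ hh hX
  obtain ⟨i', j', hδ, hF⟩ := I.exists_back hX
  rw [← hδ] at hs hX
  refine ⟨_, I.emod_mem_box i' j', I.seenFrom_of_δ hs, (I.Lk_emod _ _).2 hX, ?_⟩
  unfold Back at *
  simpa only [I.x_emod_zero, I.x_emod_pred] using hF

lemma finite_and_card_le (B : Finset (ℤ × ℤ)) (hB : ∀ p ∈ I.orderedCrossings,
    ∃ q ∈ B, I.SeenFrom p q ∧ I.Lk q.1 q.2) :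
    I.orderedCrossings.Finite ∧ I.orderedCrossings.ncard ≤ B.card := by
  classical
  choose! f hf using hB
  have hinj : Set.InjOn f I.orderedCrossings := by
    intro p hp p' hp' he
    have h1 := hf p hp
    have h2 := hf p' hp'
    rw [← he] at h2
    exact SeenFrom.unique I hp hp' h1.2.2 h1.2.1 h2.2.1
  have hmaps : Set.MapsTo f I.orderedCrossings (B : Set (ℤ × ℤ)) := fun p hp => (hf p hp).1
  refine ⟨Set.Finite.of_injOn hmaps hinj B.finite_toSet, ?_⟩
  rw [← Set.ncard_coe_finset]
  exact Set.ncard_le_ncard_of_injOn f hmaps hinj B.finite_toSet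

open Classical in
lemma finite_and_card_le_front : I.orderedCrossings.Finite ∧ I.orderedCrossings.ncard ≤
    (I.box.filter fun q => I.Lk q.1 q.2 ∧ I.Front q.1 q.2).card := by
  refine I.finite_and_card_le _ fun p hp => ?_
  obtain ⟨q, h1, h2, h3, h4⟩ := I.exists_seenFrom_front hp
  exact ⟨q, Finset.mem_filter.2 ⟨h1, h3, h4⟩, h2, h3⟩

open Classical in
lemma card_le_back : I.orderedCrossings.ncard ≤
    (I.box.filter fun q => I.Lk q.1 q.2 ∧ I.Back q.1 q.2).card := by
  refine (I.finite_and_card_le _ fun p hp => ?_).2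
  obtain ⟨q, h1, h2, h3, h4⟩ := I.exists_seenFrom_back hp
  exact ⟨q, Finset.mem_filter.2 ⟨h1, h3, h4⟩, h2, h3⟩

lemma exists_mod_eq (s : ℝ) : ∃ (s' : ℝ) (m : ℤ), 0 ≤ s' ∧ s' < I.ℓ ∧ s = s' + m * I.ℓ := by
  obtain ⟨m, ⟨h1, h2⟩, -⟩ := existsUnique_sub_zsmul_mem_Ico I.ℓ_pos s 0
  refine ⟨s - m • I.ℓ, m, h1, by simpa using h2, by simp⟩

lemma exists_crossing_seenFrom {q : ℤ × ℤ} (hq : I.Lk q.1 q.2) :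
    ∃ p ∈ I.orderedCrossings, I.SeenFrom p q := by
  obtain ⟨s, t, h⟩ := exists_crossing hq
  obtain ⟨s', b, hs1, hs2, rfl⟩ := I.exists_mod_eq s
  obtain ⟨t', a, ht1, ht2, rfl⟩ := I.exists_mod_eq t
  refine ⟨(s', t'), ⟨hs1, hs2, ht1, ht2, I.δ (q.1 + (-a) * I.L) (q.2 + (-b) * I.L), I.δ_mem _ _,
    ?_, (I.Lk_per _ _ _ _).2 hq⟩, a, b, h⟩
  rw [I.conj_δ_per, mul_smul, mul_smul, ← zpow_neg, neg_neg, W_zpow_smul, h, W_zpow_smul]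
  congr 1; push_cast; ring

lemma SeenFrom.exists_δ {p : ℝ × ℝ} {q : ℤ × ℤ} (h : I.SeenFrom p q) : ∃ a b : ℤ,
    (I.M⁻¹ * I.δ (q.1 + a * I.L) (q.2 + b * I.L) * I.M) • axisPoint p.1 = axisPoint p.2 := by
  obtain ⟨a, b, h⟩ := h
  refine ⟨-a, -b, ?_⟩
  rw [I.conj_δ_per, mul_smul, mul_smul, ← zpow_neg, neg_neg, W_zpow_smul, h, W_zpow_smul]
  congr 1; push_cast; ring

lemma x_shift (i k m : ℤ) : I.x (i + m * I.L + k) = I.x (i + k) := by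
  rw [← I.x_per_int (i + k) m]; congr 1; ring

lemma BackEnd.shift {i j : ℤ} (h : I.BackEnd i j) (a b : ℤ) :
    I.BackEnd (i + a * I.L) (j + b * I.L) := by
  have h1 := I.x_shift i (-1) a
  have h2 := I.x_shift j (-1) b
  rw [← sub_eq_add_neg, ← sub_eq_add_neg] at h1 h2
  unfold BackEnd at *
  rw [h1, h2, I.x_per_int, I.x_per_int]
  exact h

lemma eq_of_smul_eq {h h' : SL(2, ℝ)} (hh : h ∈ S.Gam) (hh' : h' ∈ S.Gam) {s t : ℝ}
    (e : (I.M⁻¹ * h * I.M) • axisPoint s = axisPoint t)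
    (e' : (I.M⁻¹ * h' * I.M) • axisPoint s = axisPoint t) : h = h' := by
  have h1 : (h'⁻¹ * h) • (I.M • axisPoint s) = I.M • axisPoint s := by
    rw [← e'] at e
    rw [mul_smul, mul_smul, mul_smul, mul_smul, smul_left_cancel_iff] at e
    rw [mul_smul, inv_smul_eq_iff]
    exact e
  have := S.eq_one_of_fixed (mul_mem (inv_mem hh') hh) h1
  rwa [inv_mul_eq_one, eq_comm] at this

lemma eq_of_box {i i' a a' : ℤ} (h0 : 0 ≤ i) (h1 : i < I.L) (h0' : 0 ≤ i') (h1' : i' < I.L)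
    (h : i + a * I.L = i' + a' * I.L) : i = i' := by
  have := congrArg (· % I.L) h
  simpa [Int.emod_eq_of_lt h0 h1, Int.emod_eq_of_lt h0' h1'] using this

/-- A crossing determines its group element because the action is free, and the element determines
the vertices by `BackEnd.unique`. Hence different pairs see different crossings. -/
lemma card_backEnd_le (B : Finset (ℤ × ℤ))
    (hB : ∀ q ∈ B, q ∈ I.box ∧ I.Lk q.1 q.2 ∧ I.BackEnd q.1 q.2) :
    B.card ≤ I.orderedCrossings.ncard := by
  have hex : ∀ q ∈ B, ∃ p ∈ I.orderedCrossings, I.SeenFrom p q :=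
    fun q hq => I.exists_crossing_seenFrom (hB q hq).2.1
  choose! f hf using hex
  rw [← Set.ncard_coe_finset]
  refine Set.ncard_le_ncard_of_injOn f (fun q hq => (hf q hq).1) ?_ I.finite_and_card_le_front.1
  intro q hq q' hq' he
  obtain ⟨a, b, h1⟩ := SeenFrom.exists_δ I (hf q hq).2
  obtain ⟨a', b', h2⟩ := SeenFrom.exists_δ I (hf q' hq').2
  obtain ⟨k1, -, k3⟩ := hB q hq
  obtain ⟨k1', -, k3'⟩ := hB q' hq'
  rw [← he] at h2
  have hδ := I.eq_of_smul_eq (I.δ_mem _ _) (I.δ_mem _ _) h1 h2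
  obtain ⟨e1, e2⟩ := (BackEnd.shift I k3 a b).unique (BackEnd.shift I k3' a' b') hδ
  simp only [box, Finset.mem_product, Finset.mem_Ico] at k1 k1'
  exact Prod.ext (I.eq_of_box k1.1.1 k1.1.2 k1'.1.1 k1'.1.2 e1)
    (I.eq_of_box k1.2.1 k1.2.2 k1'.2.1 k1'.2.2 e2)

lemma swap_mem {p : ℝ × ℝ} (hp : p ∈ I.orderedCrossings) : p.swap ∈ I.orderedCrossings := by
  obtain ⟨h1, h2, h3, h4, h, hh, hs, hX⟩ := hp
  have e : I.M⁻¹ * h⁻¹ * I.M = (I.M⁻¹ * h * I.M)⁻¹ := by group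
  refine ⟨h3, h4, h1, h2, h⁻¹, inv_mem hh, ?_, ?_⟩
  · rw [e, inv_smul_eq_iff]; exact hs.symm
  · rw [e, entryProd_inv]; exact hX

/-- Equal parameters would give a fixed point, hence the identity, which produces no crossing. -/
lemma fst_ne_snd {p : ℝ × ℝ} (hp : p ∈ I.orderedCrossings) : p.1 ≠ p.2 := by
  obtain ⟨h1, h2, h3, h4, h, hh, hs, hX⟩ := hp
  intro heq
  rw [← heq] at hs
  have := I.eq_of_smul_eq hh (one_mem _) hs (by simp)
  rw [this] at hX
  simp [entryProd] at hX

lemma ncard_orderedCrossings :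
    I.orderedCrossings.ncard = 2 * {p ∈ I.orderedCrossings | p.1 < p.2}.ncard := by
  have hfin := I.finite_and_card_le_front.1
  have hunion : I.orderedCrossings = {p ∈ I.orderedCrossings | p.1 < p.2} ∪
      Prod.swap '' {p ∈ I.orderedCrossings | p.1 < p.2} := by
    ext p
    constructor
    · intro hp
      rcases lt_or_gt_of_ne (I.fst_ne_snd hp) with h | h
      · exact Or.inl ⟨hp, h⟩
      · exact Or.inr ⟨p.swap, ⟨I.swap_mem hp, h⟩, Prod.swap_swap p⟩
    · rintro (hp | ⟨q, hq, rfl⟩)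
      · exact hp.1
      · exact I.swap_mem hq.1
  have hfin' : {p ∈ I.orderedCrossings | p.1 < p.2}.Finite := hfin.subset (fun p hp => hp.1)
  conv_lhs => rw [hunion]
  rw [Set.ncard_union_eq _ hfin' (hfin'.image _),
    Set.ncard_image_of_injective _ Prod.swap_injective]
  · ring
  · rw [Set.disjoint_left]
    rintro _ ⟨-, hlt⟩ ⟨q, ⟨-, hq⟩, rfl⟩
    exact lt_asymm hlt hq

end Itinerary

/-! ### Linking read off from the cyclic order of directions -/

/-- The sign of `y - z` in the linear order of the letters. -/
def sgn (y z : Fin 4) : SignType := if y < z then -1 else if z < y then 1 else 0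

/-- How a reduced word goes on from the letter `y` to the letter `z`: straight on (`0`), turning
from a generator to an inverse or conversely (`1`), or turning otherwise (`2`). -/
def turn (y z : Fin 4) : ℕ := if y = z then 0 else if y.val % 2 = z.val % 2 then 2 else 1

lemma sign_sub_of_lt_iff {r s : ℝ} {y z : Fin 4} (hne : y ≠ z) (h1 : r < s ↔ y < z)
    (h2 : s < r ↔ z < y) : SignType.sign (r - s) = sgn y z := by
  unfold sgn
  rcases lt_or_gt_of_ne hne with h | h
  · rw [if_pos h, sign_neg (sub_neg.2 (h1.2 h))]
  · rw [if_neg h.not_gt, if_pos h, sign_pos (sub_pos.2 (h2.2 h))]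

lemma PingPong.ColIn.sign_sub {S : PingPong} {y y' : Fin 4} {N N' : SL(2, ℝ)} {k k' : Fin 2}
    (h : S.ColIn y N k) (h' : S.ColIn y' N' k') (hy : y ≠ y') :
    SignType.sign (ratio N k - ratio N' k') = sgn y y' :=
  sign_sub_of_lt_iff hy (h.lt_iff h' hy) (h'.lt_iff h hy.symm)

/-- The directions at a vertex are sorted by their turn, in a sense of rotation that depends only on
whether `y` is a generator or an inverse. The product of three signs is the orientation of the
triple `y`, `a.rev`, `b.rev`. -/
lemma sgn_back : ∀ y a b : Fin 4, a ≠ y.rev → b ≠ y.rev → turn a y < turn b y →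
    sgn y a.rev * sgn b.rev a.rev * sgn y b.rev = if y.val % 2 = 0 then -1 else 1 := by
  decide

lemma sgn_front : ∀ y z z' : Fin 4, z ≠ y.rev → z' ≠ y.rev → turn y z' < turn y z →
    sgn (PingPong.cycPos y z) (PingPong.cycPos y z') = if y.val % 2 = 0 then 1 else -1 := by
  decide

lemma cycPos_injective : ∀ y z z' : Fin 4, PingPong.cycPos y z = PingPong.cycPos y z' → z = z' := by
  decide

namespace Itinerary
variable {S : PingPong} (I : Itinerary S)

lemma Lk_iff_sign (i j : ℤ) : I.Lk i j ↔
    SignType.sign (I.v j - I.u i) * SignType.sign (I.u j - I.u i) *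
      SignType.sign (I.v i - I.v j) * SignType.sign (I.v i - I.u j) = -1 := by
  rw [I.Lk_iff_ratio, ← sign_mul, ← sign_mul, ← sign_mul, sign_eq_neg_one_iff]

lemma Lk_iff_of_distinct {i j : ℤ} (h1 : I.x i ≠ I.x j) (h2 : I.x i ≠ (I.x (j - 1)).rev)
    (h3 : I.x (i - 1) ≠ I.x (j - 1)) (h4 : I.x j ≠ (I.x (i - 1)).rev) : I.Lk i j ↔
    sgn (I.x j) (I.x (i - 1)).rev * sgn (I.x (j - 1)).rev (I.x (i - 1)).rev *
      sgn (I.x i) (I.x j) * sgn (I.x i) (I.x (j - 1)).rev = -1 := by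
  have a := I.colIn_line_zero i
  have b := I.colIn_line_one i
  have c := I.colIn_line_zero j
  have d := I.colIn_line_one j
  rw [I.Lk_iff_sign]
  unfold v u
  rw [c.sign_sub b h4, d.sign_sub b (fun h => h3 (Fin.rev_injective h.symm)), a.sign_sub c h1,
    a.sign_sub d h2]

lemma v_lt_iff_of_agree {i j : ℤ} (h : I.x i = I.x j) (h' : I.x (i + 1) = I.x (j + 1)) :
    I.v i < I.v j ↔ I.v (i + 1) < I.v (j + 1) := by
  have a := I.colIn_line_zero (i + 1)
  have b := I.colIn_line_zero (j + 1)
  have hr := I.red i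
  unfold v
  rw [I.line_eq i, I.line_eq j, ← h]
  rw [← h'] at b
  exact PingPong.ratio_mul_lt_iff_of_eq a b hr

lemma v_lt_iff_of_part {i j : ℤ} (h : I.x i = I.x j) (h' : I.x (i + 1) ≠ I.x (j + 1)) :
    I.v i < I.v j ↔
      PingPong.cycPos (I.x i) (I.x (i + 1)) < PingPong.cycPos (I.x i) (I.x (j + 1)) := by
  have a := I.colIn_line_zero (i + 1)
  have b := I.colIn_line_zero (j + 1)
  unfold v
  rw [I.line_eq i, I.line_eq j, ← h]
  exact PingPong.ratio_mul_lt_iff_of_ne a b (I.red i) (by rw [h]; exact I.red j) h'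

/-- A common letter acts increasingly on the interval of the next common letter, so the order of the
forward ends is decided where the lines part. -/
lemma v_lt_iff_of_chain {i j : ℤ} (T : ℕ) (h : ∀ t ≤ T, I.x (i + t) = I.x (j + t)) :
    I.v i < I.v j ↔ I.v (i + T) < I.v (j + T) := by
  induction T with
  | zero => simp
  | succ T ih =>
    rw [ih fun t ht => h t (by omega)]
    have := I.v_lt_iff_of_agree (h T (by omega)) (by
      have := h (T + 1) le_rfl
      push_cast at this
      rwa [← add_assoc, ← add_assoc] at this)
    rw [this]; push_cast; rw [← add_assoc, ← add_assoc]

/-- Two lines that run along each other over `T + 1` edges in the same direction, and leave each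
other to opposite sides at the two ends. -/
lemma Lk_of_chain {i j : ℤ} (T : ℕ) (h : ∀ t ≤ T, I.x (i + t) = I.x (j + t))
    (hpar : (I.x i).val % 2 = (I.x (i + T)).val % 2)
    (hb : turn (I.x (i - 1)) (I.x i) < turn (I.x (j - 1)) (I.x j))
    (hf : turn (I.x (j + T)) (I.x (j + T + 1)) < turn (I.x (i + T)) (I.x (i + T + 1))) :
    I.Lk i j ∧ I.BackEnd i j := by
  have h0 : I.x i = I.x j := by simpa using h 0 (by omega)
  have hT := h T le_rfl
  rw [← h0] at hb
  rw [← hT] at hf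
  have e1 : I.x (i - 1) ≠ (I.x i).rev := fun he => I.red' i (by rw [he, Fin.rev_rev])
  have e2 : I.x (j - 1) ≠ (I.x i).rev := fun he => I.red' j (by rw [he, Fin.rev_rev, h0])
  have hBE : I.BackEnd i j := by
    refine ⟨fun he => ?_, fun he => ?_, fun he => ?_⟩
    · rw [he] at hb; exact lt_irrefl _ hb
    · exact e2 (by rw [he, Fin.rev_rev])
    · exact e1 (by rw [h0, he, Fin.rev_rev])
  refine ⟨?_, hBE⟩
  have a := I.colIn_line_zero i
  have b := I.colIn_line_one i
  have c := I.colIn_line_zero j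
  have d := I.colIn_line_one j
  have hne : I.x (i + T + 1) ≠ I.x (j + T + 1) := by
    intro he; rw [he] at hf; exact lt_irrefl _ hf
  have hs : SignType.sign (I.v i - I.v j) =
      sgn (PingPong.cycPos (I.x (i + T)) (I.x (i + T + 1)))
        (PingPong.cycPos (I.x (i + T)) (I.x (j + T + 1))) := by
    apply sign_sub_of_lt_iff
    · exact fun he => hne (cycPos_injective _ _ _ he)
    · rw [I.v_lt_iff_of_chain T h, I.v_lt_iff_of_part hT hne]
    · rw [I.v_lt_iff_of_chain T fun t ht => (h t ht).symm, I.v_lt_iff_of_part hT.symm hne.symm, hT]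
  -- `hpar` gives both ends of the segment the same sense of rotation, so by `sgn_back` and
  -- `sgn_front` the lines part on opposite sides.
  rw [I.Lk_iff_sign, hs]
  unfold v u
  rw [← h0] at c
  rw [c.sign_sub b (fun he => e1 (by rw [he, Fin.rev_rev])),
    d.sign_sub b (fun he => hBE.1 (Fin.rev_injective he.symm)),
    a.sign_sub d (fun he => e2 (by rw [he, Fin.rev_rev])),
    sgn_front _ _ _ (I.red _) (by rw [hT]; exact I.red _) hf, mul_right_comm,
    sgn_back _ _ _ e1 e2 hb, hpar]
  split_ifs <;> rfl

end Itinerary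

/-! ### Pairs of directions and the upper bound -/

/-- The unordered pair of directions `{y, z}` at a vertex: `0` and `1` for the two straight ones,
`2` and `3` for the two at which a generator meets an inverse, `4` and `5` for the other ones. -/
def pairCode (y z : Fin 4) : Fin 6 :=
  if z = y.rev then (if y = 0 ∨ y = 3 then 0 else 1)
  else if y.val % 2 = z.val % 2 then (if y.val % 2 = 0 then 2 else 3)
  else if y.val ≤ 1 then 4 else 5

/-- An upper bound for the number of ends of linked pairs of lines with the given directions. -/
def endBound (s t : Fin 6) : ℕ :=
  if s = t then 0
  else if (s = 0 ∧ t = 1) ∨ (s = 1 ∧ t = 0) ∨ (s = 4 ∧ t = 5) ∨ (s = 5 ∧ t = 4) then 0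
  else if (s = 2 ∧ t = 3) ∨ (s = 3 ∧ t = 2) then 2 else 1

/-- Pairs without a common direction are linked only if they are `{0, 2}` and `{1, 3}`, which
alternate around the vertex. -/
lemma endBound_of_distinct : ∀ p y q z : Fin 4, y ≠ p → z ≠ q →
    (y ≠ z ∧ y ≠ q) → (p ≠ q ∧ z ≠ p) →
    sgn z p * sgn q p * sgn y z * sgn y q = -1 → endBound (pairCode p y) (pairCode q z) = 2 := by
  decide

/-- Exactly one end is seen here when the two pairs share one direction without being equal. -/
lemma one_le_endBound : ∀ p y q z : Fin 4, y ≠ p → z ≠ q →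
    ((y ≠ z ∧ y ≠ q) ∧ ¬ (p ≠ q ∧ z ≠ p) ∨ ¬ (y ≠ z ∧ y ≠ q) ∧ (p ≠ q ∧ z ≠ p)) →
    1 ≤ endBound (pairCode p y) (pairCode q z) := by
  decide

lemma sgn_of_pairCode : ∀ p y q z : Fin 4, pairCode p y = 2 → pairCode q z = 3 → y ≠ p → z ≠ q →
    sgn z p * sgn q p * sgn y z * sgn y q = -1 ∧ y ≠ z ∧ y ≠ q ∧ p ≠ q ∧ z ≠ p := by
  decide

namespace Itinerary
variable {S : PingPong} (I : Itinerary S)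

/-- The pair of directions of the line at the `i`-th vertex. -/
def code (i : ℤ) : Fin 6 := pairCode (I.x (i - 1)).rev (I.x i)

/-- The vertices modulo translation with a given pair of directions. -/
noncomputable def codeCount (s : Fin 6) : ℕ := {i ∈ Finset.Ico 0 I.L | I.code i = s}.card

lemma sum_code (f : Fin 6 → ℕ) :
    ∑ i ∈ Finset.Ico 0 I.L, f (I.code i) = ∑ s, I.codeCount s * f s := by
  have : ∀ i ∈ Finset.Ico 0 I.L, f (I.code i) = ∑ s, if I.code i = s then f s else 0 := by
    intro i _; simp
  rw [Finset.sum_congr rfl this, Finset.sum_comm]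
  refine Finset.sum_congr rfl fun s _ => ?_
  rw [codeCount, ← Finset.sum_filter, Finset.sum_const, smul_eq_mul]

lemma sum_shift (f : Fin 4 → ℕ) :
    ∑ i ∈ Finset.Ico 0 I.L, f (I.x (i - 1)) = ∑ i ∈ Finset.Ico 0 I.L, f (I.x i) := by
  have hL := I.L_pos
  refine Finset.sum_nbij' (fun i => (i - 1) % I.L) (fun i => (i + 1) % I.L) ?_ ?_ ?_ ?_ ?_
  · intro i _
    exact Finset.mem_Ico.2 ⟨Int.emod_nonneg _ hL.ne', Int.emod_lt_of_pos _ hL⟩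
  · intro i _
    exact Finset.mem_Ico.2 ⟨Int.emod_nonneg _ hL.ne', Int.emod_lt_of_pos _ hL⟩
  · intro i hi
    rw [Finset.mem_Ico] at hi
    rw [Int.emod_add_emod, sub_add_cancel, Int.emod_eq_of_lt hi.1 hi.2]
  · intro i hi
    rw [Finset.mem_Ico] at hi
    rw [Int.emod_sub_emod, add_sub_cancel_right, Int.emod_eq_of_lt hi.1 hi.2]
  · intro i _
    rw [I.x_emod_zero]

/-- Both ends of the edges labelled by a letter carry the same number of directions. -/
lemma codeCount_eq : I.codeCount 2 = I.codeCount 3 ∧ I.codeCount 4 = I.codeCount 5 := by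
  have key : ∀ f : Fin 4 → ℕ, ∀ g : Fin 6 → ℕ,
      (∀ y z : Fin 4, z ≠ y.rev → f y + f z.rev = g (pairCode y.rev z)) →
      ∑ s, I.codeCount s * g s = ∑ i ∈ Finset.Ico 0 I.L, (f (I.x i) + f (I.x i).rev) := by
    intro f g h
    rw [← I.sum_code, Finset.sum_add_distrib, ← I.sum_shift f, ← Finset.sum_add_distrib]
    exact Finset.sum_congr rfl fun i _ => (h _ _ (I.red' i)).symm
  have key2 : ∀ f f' : Fin 4 → ℕ, (∀ y, f y + f y.rev = f' y + f' y.rev) →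
      ∑ i ∈ Finset.Ico 0 I.L, (f (I.x i) + f (I.x i).rev) =
        ∑ i ∈ Finset.Ico 0 I.L, (f' (I.x i) + f' (I.x i).rev) :=
    fun f f' h => Finset.sum_congr rfl fun i _ => h _
  -- The four weights count the occurrences of the directions `0`, `3`, `1`, `2` in turn. Every edge
  -- carries a direction at one end and its reverse at the other, which gives `e1` and `e2`.
  have h0 := key (fun y => if y = 3 then 1 else 0) ![1, 0, 1, 0, 1, 0] (by decide)
  have h3 := key (fun y => if y = 0 then 1 else 0) ![1, 0, 0, 1, 0, 1] (by decide)
  have h1 := key (fun y => if y = 2 then 1 else 0) ![0, 1, 0, 1, 1, 0] (by decide)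
  have h2 := key (fun y => if y = 1 then 1 else 0) ![0, 1, 1, 0, 0, 1] (by decide)
  have e1 := key2 (fun y => if y = 3 then 1 else 0) (fun y => if y = 0 then 1 else 0) (by decide)
  have e2 := key2 (fun y => if y = 2 then 1 else 0) (fun y => if y = 1 then 1 else 0) (by decide)
  rw [← h0, ← h3] at e1
  rw [← h1, ← h2] at e2
  simp [Fin.sum_univ_succ] at e1 e2
  constructor <;> omega

lemma sum_codeCount : ∑ s, I.codeCount s = I.L.toNat := by
  have := I.sum_code (fun _ => 1)
  simpa using this.symm

open Classical in
-- Both ends are seen from one pair of vertices only if the lines have just this vertex in common.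
lemma front_add_back_le (i j : ℤ) : (if I.Lk i j ∧ I.Front i j then 1 else 0) +
    (if I.Lk i j ∧ I.Back i j then 1 else 0) ≤ endBound (I.code i) (I.code j) := by
  have hi := I.red' i
  have hj := I.red' j
  by_cases hLk : I.Lk i j
  · have hrev : (I.x (i - 1) ≠ I.x (j - 1)) ↔ (I.x (i - 1)).rev ≠ (I.x (j - 1)).rev :=
      (Fin.rev_injective.ne_iff).symm
    have h1 := one_le_endBound (I.x (i - 1)).rev (I.x i) (I.x (j - 1)).rev (I.x j) hi hj
    by_cases hF : I.Front i j <;> by_cases hB : I.Back i j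
    · have := (I.Lk_iff_of_distinct hF.1 hF.2 hB.1 hB.2).1 hLk
      rw [code, code, endBound_of_distinct _ _ _ _ hi hj hF ⟨hrev.1 hB.1, hB.2⟩ this]
      simp [hLk, hF, hB]
    · simp only [hLk, hF, hB, true_and, if_true, if_false]
      exact h1 (Or.inl ⟨hF, fun h => hB ⟨hrev.2 h.1, h.2⟩⟩)
    · simp only [hLk, hF, hB, true_and, if_true, if_false]
      exact h1 (Or.inr ⟨hF, hrev.1 hB.1, hB.2⟩)
    · simp [hF, hB]
  · simp [hLk]

/-- Each crossing has two ends, and these are counted by the pairs of directions. -/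
lemma two_mul_ncard_le : 2 * I.orderedCrossings.ncard ≤
    ∑ s, I.codeCount s * ∑ t, I.codeCount t * endBound s t := by
  classical
  have h1 := I.finite_and_card_le_front.2
  have h2 := I.card_le_back
  rw [Finset.card_filter] at h1 h2
  calc 2 * I.orderedCrossings.ncard ≤ _ := (two_mul _).trans_le (add_le_add h1 h2)
    _ = ∑ q ∈ I.box, ((if I.Lk q.1 q.2 ∧ I.Front q.1 q.2 then 1 else 0) +
          (if I.Lk q.1 q.2 ∧ I.Back q.1 q.2 then 1 else 0)) := Finset.sum_add_distrib.symm
    _ ≤ ∑ q ∈ I.box, endBound (I.code q.1) (I.code q.2) :=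
        Finset.sum_le_sum fun q _ => I.front_add_back_le q.1 q.2
    _ = ∑ i ∈ Finset.Ico 0 I.L, ∑ j ∈ Finset.Ico 0 I.L, endBound (I.code i) (I.code j) := by
        rw [box, Finset.sum_product]
    _ = _ := by
        rw [← I.sum_code (fun s => ∑ t, I.codeCount t * endBound s t)]
        exact Finset.sum_congr rfl fun i _ => I.sum_code _

/-- With `m = codeCount 2`, the codes `2` and `3` occur `m` times each, `4` and `5` occur `n - m`
times each, and the straight codes `L - 2n` times together. -/
lemma ncard_le_of_turns {n : ℕ}
    (hn : I.codeCount 2 + I.codeCount 3 + I.codeCount 4 + I.codeCount 5 = 2 * n) :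
    I.codeCount 2 ≤ n ∧ ({p ∈ I.orderedCrossings | p.1 < p.2}.ncard : ℤ) ≤
      n * (I.L - 2 * n) + I.codeCount 2 ^ 2 + 2 * I.codeCount 2 * (n - I.codeCount 2) := by
  obtain ⟨e1, e2⟩ := I.codeCount_eq
  have hsum := I.sum_codeCount
  have hb := I.two_mul_ncard_le
  rw [I.ncard_orderedCrossings] at hb
  have hL : ((I.L.toNat : ℕ) : ℤ) = I.L := I.toNat_L
  generalize I.orderedCrossings = A at *
  have hmat : ∑ s, I.codeCount s * ∑ t, I.codeCount t * endBound s t =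
      2 * ((I.codeCount 0 + I.codeCount 1) *
        (I.codeCount 2 + I.codeCount 3 + I.codeCount 4 + I.codeCount 5) +
        (I.codeCount 2 + I.codeCount 3) * (I.codeCount 4 + I.codeCount 5) +
        2 * I.codeCount 2 * I.codeCount 3) := by
    generalize I.codeCount = N
    simp only [Fin.sum_univ_six]
    simp [endBound]
    ring
  rw [hmat] at hb
  rw [Fin.sum_univ_six] at hsum
  generalize I.codeCount 0 = N0 at *
  generalize I.codeCount 1 = N1 at *
  generalize I.codeCount 2 = N2 at *
  generalize I.codeCount 3 = N3 at *
  generalize I.codeCount 4 = N4 at *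
  generalize I.codeCount 5 = N5 at *
  subst e1 e2
  refine ⟨by omega, ?_⟩
  generalize {p ∈ A | p.1 < p.2}.ncard = X at *
  zify at hb hsum hn
  rw [hL] at hsum
  have h4 : (N4 : ℤ) = n - N2 := by linarith
  have h01 : (N0 : ℤ) + N1 = I.L - 2 * n := by linarith
  rw [h01, h4] at hb
  nlinarith

end Itinerary

/-! ### Blocks of equal letters -/

/-- The pattern of the blocks of equal letters of a periodic word: the `k`-th one has `e k` letters
`lt k` and starts at the vertex `E k`. -/
structure BlockPattern where
  n : ℕ
  e : ℤ → ℕ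
  E : ℤ → ℤ
  lt : ℤ → Fin 4
  n_pos : 0 < n
  e_pos : ∀ k, 0 < e k
  E_zero : E 0 = 0
  E_succ : ∀ k, E (k + 1) = E k + e k
  typ : ∀ k, (lt k = 0 ∨ lt k = 3) ↔ Even k
  e_per : ∀ k, e (k + 2 * n) = e k
  lt_per : ∀ k, lt (k + 2 * n) = lt k

/-- The itinerary `I` is composed of the given blocks. -/
structure Blocks {S : PingPong} (I : Itinerary S) extends BlockPattern where
  x_eq : ∀ k (o : ℤ), 0 ≤ o → o < e k → I.x (E k + o) = lt k
  L_eq : I.L = E (2 * n)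

namespace BlockPattern
variable (B : BlockPattern)

lemma E_lt_succ (k : ℤ) : B.E k < B.E (k + 1) := by
  rw [B.E_succ]; have := B.e_pos k; omega

lemma E_strictMono : StrictMono B.E := strictMono_int_of_lt_succ B.E_lt_succ

lemma exists_block (i : ℤ) : ∃ k, B.E k ≤ i ∧ i < B.E (k + 1) := by
  have hnn : ∀ m : ℕ, (m : ℤ) ≤ B.E m ∧ B.E (-m) ≤ -m := by
    intro m
    induction m with
    | zero => simp [B.E_zero]
    | succ m ih =>
      have h1 := B.E_lt_succ m
      have h2 := B.E_lt_succ (-(m : ℤ) - 1)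
      rw [sub_add_cancel] at h2
      push_cast
      rw [show -((m : ℤ) + 1) = -m - 1 by ring]
      omega
  have hub : ∀ k, B.E k ≤ i → k ≤ |i| := by
    intro k hk
    by_contra! hc
    have h1 := (hnn k.toNat).1
    rw [Int.toNat_of_nonneg (by have := abs_nonneg i; omega)] at h1
    have := le_abs_self i
    omega
  have hex : ∃ k, B.E k ≤ i := ⟨-(i.natAbs : ℤ), by
    have := (hnn i.natAbs).2
    omega⟩
  obtain ⟨k, hk, hmax⟩ := Int.exists_greatest_of_bdd ⟨|i|, hub⟩ hex
  refine ⟨k, hk, ?_⟩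
  by_contra! hc
  have := hmax _ hc
  omega

/-- The block containing the vertex `i`. -/
noncomputable def bk (i : ℤ) : ℤ := (B.exists_block i).choose

lemma E_bk_le (i : ℤ) : B.E (B.bk i) ≤ i := (B.exists_block i).choose_spec.1

lemma lt_E_bk (i : ℤ) : i < B.E (B.bk i + 1) := (B.exists_block i).choose_spec.2

lemma bk_eq {i k : ℤ} (h1 : B.E k ≤ i) (h2 : i < B.E (k + 1)) : B.bk i = k := by
  have h3 := B.E_bk_le i
  have h4 := B.lt_E_bk i
  have h5 := B.E_strictMono.lt_iff_lt.1 (lt_of_le_of_lt h1 h4)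
  have h6 := B.E_strictMono.lt_iff_lt.1 (lt_of_le_of_lt h3 h2)
  omega

lemma bk_E (k : ℤ) : B.bk (B.E k) = k := B.bk_eq le_rfl (B.E_lt_succ k)

lemma lt_ne_succ (k : ℤ) : B.lt k ≠ B.lt (k + 1) := by
  intro h
  have h1 := B.typ k
  have h2 := B.typ (k + 1)
  rw [← h, h1, Int.even_add_one] at h2
  tauto

lemma E_add_period (k : ℤ) : B.E (k + 2 * B.n) = B.E k + B.E (2 * B.n) := by
  have hstep : ∀ k, B.E (k + 1 + 2 * B.n) - B.E (k + 1) = B.E (k + 2 * B.n) - B.E k := by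
    intro k
    rw [B.E_succ, show k + 1 + 2 * (B.n : ℤ) = (k + 2 * B.n) + 1 by ring, B.E_succ, B.e_per]; ring
  have hall : ∀ k, B.E (k + 2 * B.n) - B.E k = B.E (2 * B.n) := by
    intro k
    induction k using Int.induction_on with
    | zero => rw [zero_add, B.E_zero, sub_zero]
    | succ i ih => rw [hstep, ih]
    | pred i ih =>
      have := hstep (-(i : ℤ) - 1)
      rw [sub_add_cancel] at this
      rw [← this, ih]
  linarith [hall k]

lemma lt_per_int (k m : ℤ) : B.lt (k + m * (2 * B.n)) = B.lt k := by
  have : Function.Periodic B.lt (2 * B.n) := B.lt_per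
  exact_mod_cast this.int_mul m k

lemma e_per_int (k m : ℤ) : B.e (k + m * (2 * B.n)) = B.e k := by
  have : Function.Periodic B.e (2 * B.n) := B.e_per
  exact_mod_cast this.int_mul m k

end BlockPattern

namespace Blocks
variable {S : PingPong} {I : Itinerary S} (B : Blocks I)

lemma x_of_mem {i k : ℤ} (h1 : B.E k ≤ i) (h2 : i < B.E (k + 1)) : I.x i = B.lt k := by
  have := B.x_eq k (i - B.E k) (by omega) (by rw [B.E_succ] at h2; omega)
  rwa [add_sub_cancel] at this

lemma x_E (k : ℤ) : I.x (B.E k) = B.lt k := B.x_of_mem le_rfl (B.E_lt_succ k)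

lemma x_E_sub_one (k : ℤ) : I.x (B.E (k + 1) - 1) = B.lt k :=
  B.x_of_mem (by have := B.E_lt_succ k; omega) (by omega)

lemma turn_pos {y z : Fin 4} (h : y ≠ z) : 0 < turn y z := by
  unfold turn; rw [if_neg h]; split_ifs <;> norm_num

lemma turn_self (y : Fin 4) : turn y y = 0 := by simp [turn]

lemma turn_E (k : ℤ) : turn (I.x (B.E (k + 1) - 1)) (I.x (B.E (k + 1))) =
    turn (B.lt k) (B.lt (k + 1)) := by rw [B.x_E_sub_one, B.x_E]

lemma turn_of_mem {i k : ℤ} (h1 : B.E k < i) (h2 : i < B.E (k + 1)) :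
    turn (I.x (i - 1)) (I.x i) = 0 := by
  rw [B.x_of_mem h1.le h2, B.x_of_mem (k := k) (by omega) (by omega), turn_self]

lemma x_pred_ne_iff (i : ℤ) : I.x (i - 1) ≠ I.x i ↔ ∃ k, i = B.E k := by
  constructor
  · intro h
    refine ⟨B.bk i, ?_⟩
    by_contra hne
    have h1 := B.E_bk_le i
    have h2 := B.lt_E_bk i
    exact h (by rw [B.x_of_mem h1 h2, B.x_of_mem (k := B.bk i) (by omega) (by omega)])
  · rintro ⟨k, rfl⟩
    have := B.lt_ne_succ (k - 1)
    rw [sub_add_cancel] at this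
    have h2 := B.x_E_sub_one (k - 1)
    rw [sub_add_cancel] at h2
    rw [h2, B.x_E]
    exact this

lemma E_per (k : ℤ) : B.E (k + 2 * B.n) = B.E k + I.L := by rw [B.L_eq, B.E_add_period]

lemma E_per_int (k m : ℤ) : B.E (k + m * (2 * B.n)) = B.E k + m * I.L := by
  have hnat : ∀ (k : ℤ) (m : ℕ), B.E (k + m * (2 * B.n)) = B.E k + m * I.L := by
    intro k m
    induction m with
    | zero => simp
    | succ m ih =>
      have := B.E_per (k + m * (2 * B.n))
      rw [ih] at this
      push_cast
      rw [show k + ((m : ℤ) + 1) * (2 * B.n) = k + m * (2 * B.n) + 2 * B.n by ring, this]; ring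
  obtain ⟨m, rfl | rfl⟩ := m.eq_nat_or_neg
  · exact hnat k m
  · have := hnat (k + -(m : ℤ) * (2 * B.n)) m
    rw [show k + -(m : ℤ) * (2 * B.n) + m * (2 * B.n) = k by ring] at this
    rw [this]; ring

lemma bk_per_int (i m : ℤ) : B.bk (i + m * I.L) = B.bk i + m * (2 * B.n) := by
  apply B.bk_eq
  · rw [B.E_per_int]; linarith [B.E_bk_le i]
  · rw [add_right_comm, B.E_per_int]; linarith [B.lt_E_bk i]

lemma E_mem_iff (k : ℤ) : B.E k ∈ Finset.Ico 0 I.L ↔ k ∈ Finset.Ico (0 : ℤ) (2 * B.n) := by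
  rw [Finset.mem_Ico, Finset.mem_Ico, B.L_eq, B.E_strictMono.lt_iff_lt]
  nth_rewrite 1 [← B.E_zero]
  rw [B.E_strictMono.le_iff_le]

lemma card_turns : {i ∈ Finset.Ico 0 I.L | I.x (i - 1) ≠ I.x i}.card = 2 * B.n := by
  have : {i ∈ Finset.Ico 0 I.L | I.x (i - 1) ≠ I.x i} =
      (Finset.Ico (0 : ℤ) (2 * B.n)).image B.E := by
    ext i
    rw [Finset.mem_filter, Finset.mem_image, B.x_pred_ne_iff]
    constructor
    · rintro ⟨h, k, rfl⟩
      exact ⟨k, (B.E_mem_iff k).1 h, rfl⟩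
    · rintro ⟨k, h, rfl⟩
      exact ⟨(B.E_mem_iff k).2 h, k, rfl⟩
  rw [this, Finset.card_image_of_injective _ B.E_strictMono.injective]
  simp only [Int.card_Ico, sub_zero]
  omega

lemma card_straight : ({i ∈ Finset.Ico 0 I.L | I.x (i - 1) = I.x i}.card : ℤ) =
    I.L - 2 * B.n := by
  have h1 := B.card_turns
  have h2 := Finset.card_filter_add_card_filter_not (s := Finset.Ico 0 I.L)
    (fun i => I.x (i - 1) = I.x i)
  simp only [Int.card_Ico, sub_zero] at h2
  simp only [ne_eq] at h1
  have := I.toNat_L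
  omega

lemma codeCount_turns :
    I.codeCount 2 + I.codeCount 3 + I.codeCount 4 + I.codeCount 5 = 2 * B.n := by
  rw [← B.card_turns, Finset.card_filter]
  have h := I.sum_code ![0, 0, 1, 1, 1, 1]
  have h2 : ∑ s, I.codeCount s * (![0, 0, 1, 1, 1, 1] : Fin 6 → ℕ) s =
      I.codeCount 2 + I.codeCount 3 + I.codeCount 4 + I.codeCount 5 := by
    rw [Fin.sum_univ_six]; simp
  rw [← h2, ← h]
  refine Finset.sum_congr rfl fun i _ => ?_
  have h3 : ∀ y z : Fin 4, z ≠ y.rev → (![0, 0, 1, 1, 1, 1] : Fin 6 → ℕ) (pairCode y.rev z) =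
    if y ≠ z then 1 else 0 := by decide
  exact h3 _ _ (I.red' i)

end Blocks

/-! ### Crossings along common segments, found by comparing blocks -/

namespace Itinerary
variable {S : PingPong} (I : Itinerary S)

/-- A crossing of two lines that run along each other in the same direction, seen from the vertex
where they meet; the second one makes the greater turn there. -/
def Parallel (i j : ℤ) : Prop := I.Lk i j ∧ I.BackEnd i j ∧ I.x i = I.x j ∧
  turn (I.x (i - 1)) (I.x i) < turn (I.x (j - 1)) (I.x j)

lemma parallel_of_chain {i j m : ℤ} (hm : 0 < m)
    (h : ∀ t, 0 ≤ t → t < m → I.x (i + t) = I.x (j + t))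
    (hpar : (I.x i).val % 2 = (I.x (i + m - 1)).val % 2)
    (hb : turn (I.x (i - 1)) (I.x i) < turn (I.x (j - 1)) (I.x j))
    (hf : turn (I.x (j + m - 1)) (I.x (j + m)) < turn (I.x (i + m - 1)) (I.x (i + m))) :
    I.Parallel i j := by
  have hT : (((m - 1).toNat : ℕ) : ℤ) = m - 1 := Int.toNat_of_nonneg (by omega)
  have := I.Lk_of_chain (i := i) (j := j) (m - 1).toNat (fun t ht => h t (by omega) (by omega))
    (by rw [hT, ← add_sub_assoc]; exact hpar) hb
    (by rw [hT, ← add_sub_assoc, ← add_sub_assoc, sub_add_cancel, sub_add_cancel]; exact hf)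
  exact ⟨this.1, this.2, by simpa using h 0 le_rfl hm, hb⟩

lemma Parallel.emod {i j : ℤ} (h : I.Parallel i j) : I.Parallel (i % I.L) (j % I.L) := by
  obtain ⟨h1, h2, h3, h4⟩ := h
  refine ⟨(I.Lk_emod _ _).2 h1, ?_, ?_, ?_⟩
  · unfold BackEnd at *; simpa only [I.x_emod_zero, I.x_emod_pred] using h2
  · simpa only [I.x_emod_zero] using h3
  · simpa only [I.x_emod_zero, I.x_emod_pred] using h4

end Itinerary

namespace Blocks
variable {S : PingPong} {I : Itinerary S} (B : Blocks I)

/-- The line and its translate meet at the vertices `i` and `j` and run along each other up to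
the starts of the blocks `k` and `k + d`. -/
structure Aligned (k₀ d i j k : ℤ) : Prop where
  diff : j - i = B.E (k + d) - B.E k
  le : i ≤ B.E k
  agree : ∀ t, i ≤ t → t < B.E k → I.x t = I.x (t + (j - i))
  back : turn (I.x (i - 1)) (I.x i) < turn (I.x (j - 1)) (I.x j)
  lower : k₀ ≤ B.bk i
  upper : B.bk i ≤ k
  block : B.bk j = B.bk i + d
  parity : (I.x i).val % 2 = (B.lt k₀).val % 2

variable {B}

lemma Aligned.next {k₀ d i j k : ℤ} (h : B.Aligned k₀ d i j k) (hlt : B.lt k = B.lt (k + d))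
    (he : B.e (k + d) ≤ B.e k) (hk₀ : k₀ ≤ k) (hpar : (B.lt k).val % 2 = (B.lt k₀).val % 2) :
    ∃ i' j', B.Aligned k₀ d i' j' (k + 1) ∧ i' < B.E (k + 1) ∧ B.bk i' ≤ k := by
  have hs := B.E_succ k
  have hs' := B.E_succ (k + d)
  have hp := B.e_pos (k + d)
  rw [add_right_comm] at hs'
  rcases he.eq_or_lt with he | he
  · refine ⟨i, j, ⟨?_, ?_, ?_, h.back, h.lower, by have := h.upper; omega, h.block, h.parity⟩, ?_,
      h.upper⟩
    · have := h.diff; omega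
    · have := h.le; omega
    · intro t h1 h2
      by_cases h3 : t < B.E k
      · exact h.agree t h1 h3
      · rw [B.x_of_mem (k := k) (by omega) h2, B.x_of_mem (i := t + (j - i)) (k := k + d), hlt]
        · have := h.diff; omega
        · rw [add_right_comm]; have := h.diff; omega
    · have := h.le; have := B.e_pos k; omega
  · have hi : B.E k < B.E (k + 1) - B.e (k + d) := by omega
    have hi' : B.E (k + 1) - B.e (k + d) < B.E (k + 1) := by omega
    have hbk := B.bk_eq hi.le hi'
    refine ⟨B.E (k + 1) - B.e (k + d), B.E (k + d), ⟨?_, by omega, ?_, ?_, ?_, ?_, ?_, ?_⟩, hi',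
      hbk.le⟩
    · omega
    · intro t h1 h2
      rw [B.x_of_mem (k := k) (by omega) h2, B.x_of_mem (i := t + _) (k := k + d), hlt]
      · omega
      · rw [add_right_comm]; omega
    · rw [B.turn_of_mem hi hi']
      have := B.turn_E (k + d - 1)
      rw [sub_add_cancel] at this
      rw [this]
      apply turn_pos
      have := B.lt_ne_succ (k + d - 1)
      rwa [sub_add_cancel] at this
    · rw [hbk]; exact hk₀
    · rw [hbk]; omega
    · rw [hbk, B.bk_E]
    · rw [B.x_of_mem hi.le hi']; exact hpar

/-- Where block `k` ends, the first line turns while the second one still goes straight; this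
reverses the comparison of turns made at the start. -/
lemma Aligned.exists_parallel_of_lt {k₀ d i j k : ℤ} (h : B.Aligned k₀ d i j k)
    (hlt : B.lt k = B.lt (k + d)) (hpar : (B.lt k).val % 2 = (B.lt k₀).val % 2)
    (he : B.e k < B.e (k + d)) :
    ∃ i' j', I.Parallel i' j' ∧ B.bk j' = B.bk i' + d ∧ k₀ ≤ B.bk i' ∧ B.bk i' ≤ k := by
  have hs := B.E_succ k
  have hs' := B.E_succ (k + d)
  have hp := B.e_pos k
  refine ⟨i, j, I.parallel_of_chain (m := B.E (k + 1) - i) ?_ ?_ ?_ h.back ?_, h.block, h.lower,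
    h.upper⟩
  · have := h.le; omega
  · intro t h1 h2
    by_cases h3 : i + t < B.E k
    · rw [h.agree (i + t) (by omega) h3]; congr 1; ring
    · rw [B.x_of_mem (i := i + t) (k := k) (by omega) (by omega),
        B.x_of_mem (i := j + t) (k := k + d), hlt]
      · have := h.diff; omega
      · have := h.diff; omega
  · rw [add_sub_cancel, B.x_E_sub_one, h.parity, hpar]
  · rw [add_sub_cancel, B.turn_E, B.turn_of_mem (k := k + d)]
    · exact turn_pos (B.lt_ne_succ k)
    · have := h.diff; omega
    · have := h.diff; omega

/-- As soon as a block of the first line is the shorter one, a crossing is found. Otherwise the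
alignment passes to the next block, and the turn after the last block decides. -/
lemma Aligned.exists_parallel {k₀ d : ℤ} (N : ℕ) : ∀ {i j k : ℤ}, B.Aligned k₀ d i j k → k₀ ≤ k →
    (∀ r, k ≤ r → r ≤ k + N → B.lt r = B.lt (r + d) ∧ (B.lt r).val % 2 = (B.lt k₀).val % 2) →
    (B.e (k + N) < B.e (k + N + d) ∨ turn (B.lt (k + N + d)) (B.lt (k + N + d + 1)) <
      turn (B.lt (k + N)) (B.lt (k + N + 1))) →
    ∃ i' j', I.Parallel i' j' ∧ B.bk j' = B.bk i' + d ∧ k₀ ≤ B.bk i' ∧ B.bk i' ≤ k + N := by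
  induction N with
  | zero =>
    intro i j k h hk₀ hrun hend
    obtain ⟨hlt, hpar⟩ := hrun k le_rfl (by simp)
    rw [Nat.cast_zero, add_zero] at *
    by_cases he : B.e k < B.e (k + d)
    · exact h.exists_parallel_of_lt hlt hpar he
    · obtain ⟨i', j', h', hi', hbk⟩ := h.next hlt (not_lt.1 he) hk₀ hpar
      refine ⟨i', j', I.parallel_of_chain (m := B.E (k + 1) - i') (by omega) ?_ ?_ h'.back ?_,
        h'.block, h'.lower, hbk⟩
      · intro t h1 h2
        rw [h'.agree (i' + t) (by omega) (by omega)]; congr 1; ring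
      · rw [add_sub_cancel, B.x_E_sub_one, h'.parity, hpar]
      · have hj : j' + (B.E (k + 1) - i') = B.E (k + d + 1) := by
          have := h'.diff; rw [add_right_comm] at this; omega
        rw [add_sub_cancel, hj, B.turn_E, B.turn_E]
        exact hend.resolve_left he
  | succ N ih =>
    intro i j k h hk₀ hrun hend
    obtain ⟨hlt, hpar⟩ := hrun k le_rfl (by omega)
    by_cases he : B.e k < B.e (k + d)
    · obtain ⟨i', j', h1, h2, h3, h4⟩ := h.exists_parallel_of_lt hlt hpar he
      exact ⟨i', j', h1, h2, h3, by omega⟩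
    · obtain ⟨i', j', h', hi', hbk⟩ := h.next hlt (not_lt.1 he) hk₀ hpar
      obtain ⟨i', j', h1, h2, h3, h4⟩ := ih h' (by omega)
        (fun r h1 h2 => hrun r (by omega) (by push_cast; omega)) (by
          push_cast at hend
          rw [show k + 1 + (N : ℤ) = k + (N + 1) by ring]
          exact hend)
      exact ⟨i', j', h1, h2, h3, by push_cast; omega⟩

end Blocks

namespace Blocks
variable {S : PingPong} {I : Itinerary S} (B : Blocks I)

lemma two_n_pos : (0 : ℤ) < 2 * B.n := by have := B.n_pos; omega

lemma turn_E_pos (k : ℤ) : 0 < turn (I.x (B.E k - 1)) (I.x (B.E k)) := by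
  have := B.turn_E (k - 1)
  rw [sub_add_cancel] at this
  rw [this]
  apply turn_pos
  have := B.lt_ne_succ (k - 1)
  rwa [sub_add_cancel] at this

/-- A block crosses its translates along itself. -/
lemma parallel_self {i : ℤ} (hi : I.x (i - 1) = I.x i) : I.Parallel i (B.E (B.bk i)) := by
  have h1 := B.E_bk_le i
  have h2 := B.lt_E_bk i
  have h3 : i ≠ B.E (B.bk i) := fun h => (B.x_pred_ne_iff i).2 ⟨_, h⟩ hi
  refine I.parallel_of_chain (m := B.E (B.bk i + 1) - i) (by omega) ?_ ?_ ?_ ?_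
  · intro t ht1 ht2
    rw [B.x_of_mem (i := i + t) (k := B.bk i) (by omega) (by omega),
      B.x_of_mem (k := B.bk i) (by omega) (by omega)]
  · rw [add_sub_cancel, B.x_E_sub_one, B.x_of_mem h1 h2]
  · rw [hi, turn_self]; exact B.turn_E_pos _
  · rw [add_sub_cancel, B.turn_of_mem (k := B.bk i) (by omega) (by omega)]
    exact B.turn_E_pos _

lemma bk_emod (i : ℤ) : B.bk (i % I.L) = B.bk i - i / I.L * (2 * B.n) := by
  have := B.bk_per_int (i % I.L) (i / I.L)
  rw [mul_comm (i / I.L) I.L, Int.emod_add_mul_ediv] at this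
  linarith

lemma bk_emod_sub (i j : ℤ) : (B.bk (j % I.L) - B.bk (i % I.L)) % (2 * B.n) =
    (B.bk j - B.bk i) % (2 * B.n) := by
  rw [B.bk_emod, B.bk_emod, show B.bk j - j / I.L * (2 * B.n) - (B.bk i - i / I.L * (2 * B.n)) =
    B.bk j - B.bk i + (2 * B.n) * (i / I.L - j / I.L) by ring, Int.add_mul_emod_self_left]

open Classical in
/-- The pairs of vertices modulo translation at which two lines start to run along each other in
the same direction, and at which they belong to different blocks. -/
noncomputable def offPairs : Finset (ℤ × ℤ) :=
  I.box.filter fun q => I.Parallel q.1 q.2 ∧ B.bk q.1 ≠ B.bk q.2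

lemma mem_offPairs {i j d : ℤ} (h : I.Parallel i j) (hbk : B.bk j = B.bk i + d) (hd : 0 < d)
    (hd' : d < 2 * B.n) : (i % I.L, j % I.L) ∈ B.offPairs ∧
      (B.bk (j % I.L) - B.bk (i % I.L)) % (2 * B.n) = d := by
  have e : (B.bk (j % I.L) - B.bk (i % I.L)) % (2 * B.n) = d := by
    rw [B.bk_emod_sub, hbk, add_sub_cancel_left, Int.emod_eq_of_lt hd.le hd']
  classical
  refine ⟨Finset.mem_filter.2 ⟨I.emod_mem_box i j, h.emod, fun heq => ?_⟩, e⟩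
  simp only at heq
  rw [heq, sub_self, Int.zero_emod] at e
  omega

/-- The type of the turn changes between a generator and an inverse at the start of block `k`. -/
def SignChange (k : ℤ) : Prop := (B.lt (k - 1)).val % 2 ≠ (B.lt k).val % 2

lemma parity_eq {k k' : ℤ} (h : k ≤ k') (hr : ∀ r, k < r → r ≤ k' → ¬ B.SignChange r) :
    (B.lt k').val % 2 = (B.lt k).val % 2 := by
  obtain ⟨m, rfl⟩ := Int.le.dest h
  induction m with
  | zero => simp
  | succ m ih =>
    rw [← ih (by omega) fun r h1 h2 => hr r h1 (by push_cast; omega)]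
    have := hr (k + (m + 1 : ℕ)) (by push_cast; omega) le_rfl
    unfold SignChange at this
    rw [not_not] at this
    rw [← this]
    congr 3; push_cast; ring

lemma lt_eq_of_parity {k k' : ℤ} (he : Even (k' - k))
    (hp : (B.lt k).val % 2 = (B.lt k').val % 2) : B.lt k = B.lt k' := by
  have h1 := B.typ k
  have h2 := B.typ k'
  have h3 : Even k ↔ Even k' := by
    rw [Int.even_sub] at he; exact he.symm
  rw [← h3, ← h1] at h2
  have : ∀ y z : Fin 4, (z = 0 ∨ z = 3 ↔ y = 0 ∨ y = 3) → y.val % 2 = z.val % 2 → y = z := by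
    decide
  exact this _ _ h2 hp

lemma turn_of_parity {k : ℤ} (h : ¬ B.SignChange (k + 1)) :
    turn (B.lt k) (B.lt (k + 1)) = 2 := by
  unfold SignChange at h
  rw [not_not, add_sub_cancel_right] at h
  unfold turn
  rw [if_neg (B.lt_ne_succ k), if_pos h]

lemma turn_of_signChange {k : ℤ} (h : B.SignChange (k + 1)) :
    turn (B.lt k) (B.lt (k + 1)) = 1 := by
  unfold SignChange at h
  rw [add_sub_cancel_right] at h
  unfold turn
  rw [if_neg (B.lt_ne_succ k), if_neg h]

lemma turn_E' (k : ℤ) : turn (I.x (B.E k - 1)) (I.x (B.E k)) =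
    turn (B.lt (k - 1)) (B.lt (k - 1 + 1)) := by
  have := B.turn_E (k - 1)
  rw [sub_add_cancel] at this ⊢
  exact this

/-- Words without sign changes: each shift by `2 s` blocks gives a crossing. -/
lemma exists_parallel_of_no_signChange (hno : ∀ k, ¬ B.SignChange k) (hL : I.L ≠ 2 * B.n) (s : ℤ) :
    ∃ i j, I.Parallel i j ∧ B.bk j = B.bk i + 2 * s := by
  have hpar : ∀ k k', (B.lt k').val % 2 = (B.lt k).val % 2 := by
    intro k k'
    rcases le_total k k' with h | h
    · exact B.parity_eq h fun r _ _ => hno r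
    · exact (B.parity_eq h fun r _ _ => hno r).symm
  have hlt : ∀ k, B.lt k = B.lt (k + 2 * s) := fun k =>
    B.lt_eq_of_parity (by rw [add_sub_cancel_left]; exact even_two_mul s) (hpar _ _)
  set D : ℤ → ℤ := fun k => B.E (k + 2 * s) - B.E k with hD
  have hDs : ∀ k, D (k + 1) = D k + (B.e (k + 2 * s) - B.e k) := by
    intro k
    simp only [hD]
    rw [add_right_comm, B.E_succ, B.E_succ]; ring
  have hDp : ∀ k, D (k + 2 * B.n) = D k := by
    intro k
    simp only [hD]
    rw [add_right_comm, B.E_per, B.E_per]; ring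
  by_cases hper : ∀ k, B.e k = B.e (k + 2 * s)
  -- If the lengths are invariant under the shift, a block of at least two letters crosses its shift
  -- with a displacement of one letter. Such a block exists because `L ≠ 2n`.
  · have hk : ∃ k, 2 ≤ B.e k := by
      by_contra! hall
      have h1 : ∀ m : ℕ, B.E m = m := by
        intro m
        induction m with
        | zero => exact_mod_cast B.E_zero
        | succ m ih =>
          have h1 := hall m
          have h2 := B.e_pos m
          push_cast
          rw [B.E_succ, ih]; omega
      apply hL
      rw [B.L_eq]
      exact_mod_cast h1 (2 * B.n)
    obtain ⟨k, hk⟩ := hk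
    have hs := B.E_succ k
    have hs' := B.E_succ (k + 2 * s)
    have he := hper k
    refine ⟨B.E k + 1, B.E (k + 2 * s), I.parallel_of_chain (m := B.e k - 1) (by omega) ?_ ?_ ?_ ?_,
      ?_⟩
    · intro t h1 h2
      rw [B.x_of_mem (k := k) (by omega) (by omega),
        B.x_of_mem (i := B.E (k + 2 * s) + t) (k := k + 2 * s) (by omega) (by omega), hlt]
    · rw [B.x_of_mem (k := k) (by omega) (by omega),
        B.x_of_mem (i := B.E k + 1 + _ - 1) (k := k) (by omega) (by omega)]
    · rw [B.turn_of_mem (k := k) (by omega) (by omega)]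
      exact B.turn_E_pos _
    · rw [B.turn_of_mem (k := k + 2 * s) (by omega) (by omega),
        show B.E k + 1 + ((B.e k : ℤ) - 1) = B.E (k + 1) by omega]
      exact B.turn_E_pos _
    · rw [B.bk_E, B.bk_eq (k := k) (by omega) (by omega)]
  -- A monotone periodic sequence is constant. Applied to `D` and `-D`, this yields both a block
  -- longer than its shift and a block shorter than its shift.
  · have hiter : ∀ (f : ℤ → ℤ), (∀ k, f k ≤ f (k + 1)) → (∀ k, f (k + 2 * B.n) = f k) →
        ∀ k, f k = f (k + 1) := by
      intro f h1 h2 k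
      have hm : Monotone f := monotone_int_of_le_succ h1
      have := hm (show k + 1 ≤ k + 2 * B.n by have := B.n_pos; omega)
      rw [h2] at this
      exact le_antisymm (h1 k) this
    have hgt : ∃ k, B.e (k + 2 * s) < B.e k := by
      by_contra! hall
      refine hper fun k => ?_
      have := hiter D (fun k => by rw [hDs]; have := hall k; omega) hDp k
      rw [hDs] at this; omega
    have hle : ∃ k, B.e k < B.e (k + 2 * s) := by
      by_contra! hall
      refine hper fun k => ?_
      have := hiter (fun k => -D k) (fun k => by rw [hDs]; have := hall k; omega)
        (fun k => by rw [hDp]) k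
      rw [hDs] at this; omega
    obtain ⟨k₁, hk₁⟩ := hgt
    -- Adding periods puts the shorter block after the longer one: the segment starts in `k₁` or
    -- later, and parts by `k₂` at the latest.
    obtain ⟨k₂, hk₂, hk₁₂⟩ : ∃ k, B.e k < B.e (k + 2 * s) ∧ k₁ < k := by
      obtain ⟨k, hk⟩ := hle
      refine ⟨k + (|k₁ - k| + 1) * (2 * B.n), ?_, ?_⟩
      · rw [add_right_comm, B.e_per_int, B.e_per_int]; exact hk
      · have h1 := le_abs_self (k₁ - k)
        have h2 : |k₁ - k| + 1 ≤ (|k₁ - k| + 1) * (2 * B.n) :=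
          le_mul_of_one_le_right (by positivity) (by have := B.n_pos; omega)
        omega
    have hs := B.E_succ k₁
    have hs' := B.E_succ (k₁ + 2 * s)
    have hp := B.e_pos (k₁ + 2 * s)
    have hi : B.E k₁ < B.E (k₁ + 1) - B.e (k₁ + 2 * s) := by omega
    have hi' : B.E (k₁ + 1) - B.e (k₁ + 2 * s) < B.E (k₁ + 1) := by omega
    have hE : B.E (k₁ + 1 + 2 * s) = B.E (k₁ + 2 * s + 1) := by rw [add_right_comm]
    have hal : B.Aligned k₁ (2 * s) (B.E (k₁ + 1) - B.e (k₁ + 2 * s)) (B.E (k₁ + 2 * s))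
        (k₁ + 1) := by
      refine ⟨by omega, by omega, ?_, ?_, ?_, ?_, ?_, by rw [B.x_of_mem hi.le hi']⟩
      · intro t h1 h2
        rw [B.x_of_mem (k := k₁) (by omega) h2, B.x_of_mem (i := t + _) (k := k₁ + 2 * s), hlt]
        · omega
        · omega
      · rw [B.turn_of_mem hi hi']; exact B.turn_E_pos _
      · rw [B.bk_eq hi.le hi']
      · rw [B.bk_eq hi.le hi']; omega
      · rw [B.bk_eq hi.le hi', B.bk_E]
    obtain ⟨i, j, h1, h2, -⟩ := hal.exists_parallel (k₂ - k₁ - 1).toNat (by omega)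
      (fun r _ _ => ⟨hlt r, hpar _ _⟩) (Or.inl (by
        rw [Int.toNat_of_nonneg (by omega), show k₁ + 1 + (k₂ - k₁ - 1) = k₂ by ring]
        exact hk₂))
    exact ⟨i, j, h1, h2⟩

/-- The shifts `s = 1, …, n - 1` are told apart by the difference of the blocks modulo `2n`. -/
lemma card_offPairs_of_no_signChange (hno : ∀ k, ¬ B.SignChange k) (hL : I.L ≠ 2 * B.n) :
    (B.n : ℤ) - 1 ≤ B.offPairs.card := by
  choose f g hP hbk using B.exists_parallel_of_no_signChange hno hL
  have hmem : ∀ s ∈ Finset.Ico (1 : ℤ) B.n, (f s % I.L, g s % I.L) ∈ B.offPairs ∧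
      (B.bk (g s % I.L) - B.bk (f s % I.L)) % (2 * B.n) = 2 * s := by
    intro s hs
    rw [Finset.mem_Ico] at hs
    exact B.mem_offPairs (hP s) (hbk s) (by omega) (by omega)
  have := Finset.card_le_card_of_injOn (fun s => (f s % I.L, g s % I.L)) (fun s hs => (hmem s hs).1)
    (by
      intro s hs s' hs' he
      have h1 := (hmem s hs).2
      have h2 := (hmem s' hs').2
      simp only [Prod.mk.injEq] at he
      rw [he.1, he.2] at h1
      omega)
  simp only [Int.card_Ico] at this
  omega

end Blocks

/-! ### Words with sign changes -/

namespace Blocks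
variable {S : PingPong} {I : Itinerary S} (B : Blocks I)

lemma signChange_per (k m : ℤ) : B.SignChange (k + m * (2 * B.n)) ↔ B.SignChange k := by
  unfold SignChange
  rw [show k + m * (2 * B.n) - 1 = k - 1 + m * (2 * B.n) by ring, B.lt_per_int, B.lt_per_int]

/-- The number of blocks back to the last change of sign. -/
def RunDist (k : ℤ) (t : ℕ) : Prop := B.SignChange (k - t) ∧ ∀ r : ℕ, r < t → ¬ B.SignChange (k - r)

variable {B}

lemma RunDist.unique {k : ℤ} {t t' : ℕ} (h : B.RunDist k t) (h' : B.RunDist k t') : t = t' := by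
  rcases lt_trichotomy t t' with hlt | hlt | hlt
  · exact absurd h.1 (h'.2 t hlt)
  · exact hlt
  · exact absurd h'.1 (h.2 t' hlt)

lemma exists_back_signChange (hex : ∃ k, B.SignChange k) (k : ℤ) :
    ∃ t : ℕ, (t : ℤ) < 2 * B.n ∧ B.SignChange (k - t) := by
  obtain ⟨k', hk'⟩ := hex
  have hn := B.two_n_pos
  refine ⟨((k - k') % (2 * B.n)).toNat, ?_, ?_⟩
  · rw [Int.toNat_of_nonneg (Int.emod_nonneg _ hn.ne')]
    exact Int.emod_lt_of_pos _ hn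
  · rw [Int.toNat_of_nonneg (Int.emod_nonneg _ hn.ne')]
    have := Int.emod_add_mul_ediv (k - k') (2 * B.n)
    rw [show k - (k - k') % (2 * B.n) = k' + (k - k') / (2 * B.n) * (2 * B.n) by linarith,
      B.signChange_per]
    exact hk'

lemma exists_runDist (hex : ∃ k, B.SignChange k) (k : ℤ) :
    ∃ t : ℕ, (t : ℤ) < 2 * B.n ∧ B.RunDist k t := by
  classical
  obtain ⟨t, ht, hs⟩ := exists_back_signChange hex k
  have hex' : ∃ t : ℕ, B.SignChange (k - t) := ⟨t, hs⟩
  refine ⟨Nat.find hex', ?_, Nat.find_spec hex', fun r hr => Nat.find_min hex' hr⟩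
  have := Nat.find_min' hex' hs
  omega

lemma exists_next_signChange (hex : ∃ k, B.SignChange k) (k : ℤ) :
    ∃ N : ℕ, B.SignChange (k + N + 1) ∧ ∀ r, k < r → r ≤ k + N → ¬ B.SignChange r := by
  classical
  have hex' : ∃ N : ℕ, B.SignChange (k + N + 1) := by
    obtain ⟨t, ht, hs⟩ := exists_back_signChange hex (k + 2 * B.n)
    refine ⟨(2 * B.n - t - 1 : ℤ).toNat, ?_⟩
    rw [Int.toNat_of_nonneg (by omega)]
    convert hs using 1; ring
  refine ⟨Nat.find hex', Nat.find_spec hex', fun r h1 h2 => ?_⟩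
  have := Nat.find_min hex' (m := (r - k - 1).toNat) (by omega)
  rw [Int.toNat_of_nonneg (by omega)] at this
  rwa [show k + (r - k - 1) + 1 = r by ring] at this

lemma RunDist.per {k : ℤ} {t : ℕ} (h : B.RunDist k t) (m : ℤ) :
    B.RunDist (k + m * (2 * B.n)) t := by
  have e : ∀ r : ℕ, B.SignChange (k + m * (2 * B.n) - r) ↔ B.SignChange (k - r) := by
    intro r
    rw [show k + m * (2 * B.n) - r = k - r + m * (2 * B.n) by ring, B.signChange_per]
  exact ⟨(e t).2 h.1, fun r hr => (e r).not.2 (h.2 r hr)⟩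

/-- A maximal run without inner sign changes is compared with its shift by `t` blocks. At the start
of the run the first line makes a turn `1`, with sign change, and the second a turn `2`. -/
lemma RunDist.exists_parallel (hex : ∃ k, B.SignChange k) {k : ℤ} {t : ℕ} (h : B.RunDist k t)
    (he : Even t) (ht : 0 < t) :
    ∃ i j, I.Parallel i j ∧ B.bk j = B.bk i + t ∧ ∃ t' : ℕ, B.RunDist (B.bk i) t' ∧
      B.bk i - t' = k - t := by
  obtain ⟨N, hN, hrun⟩ := exists_next_signChange hex k
  have hno : ∀ r, k - t < r → r ≤ k + N → ¬ B.SignChange r := by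
    intro r h1 h2
    rcases le_or_gt r k with h3 | h3
    · have := h.2 (k - r).toNat (by omega)
      rwa [Int.toNat_of_nonneg (by omega), sub_sub_cancel] at this
    · exact hrun r h3 h2
  have hal : B.Aligned (k - t) t (B.E (k - t)) (B.E k) (k - t) := by
    refine ⟨by rw [sub_add_cancel], le_rfl, fun t h1 h2 => absurd h1 (not_le.2 h2), ?_,
      by rw [B.bk_E], by rw [B.bk_E], by rw [B.bk_E, B.bk_E, sub_add_cancel], by rw [B.x_E]⟩
    have h1 := h.1
    have h2 := hno k (by omega) (by omega)
    rw [B.turn_E', B.turn_E', B.turn_of_signChange (by rwa [sub_add_cancel]),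
      B.turn_of_parity (by rwa [sub_add_cancel])]
    norm_num
  obtain ⟨i, j, h1, h2, h3, h4⟩ := hal.exists_parallel N le_rfl (by
    intro r hr1 hr2
    have p1 := B.parity_eq (k := k - t) (k' := r) hr1 fun s hs1 hs2 => hno s hs1 (by omega)
    have p2 := B.parity_eq (k := k - t) (k' := r + t) (by omega)
      fun s hs1 hs2 => hno s hs1 (by omega)
    exact ⟨B.lt_eq_of_parity (by rw [add_sub_cancel_left]; exact_mod_cast he) (by rw [p1, p2]), p1⟩)
    -- The second line reaches the end of the run first, so there the turns `1` and `2` are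
    -- exchanged.
    (Or.inr (by
      rw [show k - t + N + t = k + N by ring, B.turn_of_signChange hN,
        B.turn_of_parity (hno _ (by omega) (by omega))]
      norm_num))
  refine ⟨i, j, h1, h2, (B.bk i - (k - t)).toNat, ⟨?_, fun r hr => ?_⟩, ?_⟩
  · rw [Int.toNat_of_nonneg (by omega), sub_sub_cancel]; exact h.1
  · exact hno _ (by omega) (by omega)
  · rw [Int.toNat_of_nonneg (by omega), sub_sub_cancel]

variable (B)

open Classical in
/-- The blocks at a positive even distance from the last change of sign. -/
noncomputable def evenBlocks : Finset ℤ := {k ∈ Finset.Ico (0 : ℤ) (2 * B.n) |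
  ∃ t : ℕ, B.RunDist k t ∧ Even t ∧ 0 < t}

open Classical in
noncomputable def signChanges : Finset ℤ := {k ∈ Finset.Ico (0 : ℤ) (2 * B.n) | B.SignChange k}

/-- The block is recovered from the pair: the run starts at `bk q.1 - t'`, and the distance `t` is
the difference of the two blocks modulo `2n`. -/
lemma card_evenBlocks_le (hex : ∃ k, B.SignChange k) : B.evenBlocks.card ≤ B.offPairs.card := by
  classical
  have key : ∀ k ∈ B.evenBlocks, ∃ q ∈ B.offPairs, ∃ t t' : ℕ,
      (B.bk q.2 - B.bk q.1) % (2 * B.n) = t ∧ B.RunDist (B.bk q.1) t' ∧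
      (B.bk q.1 - t' + t) % (2 * B.n) = k := by
    intro k hk
    obtain ⟨hk, t, ht, he, hpos⟩ := Finset.mem_filter.1 hk
    rw [Finset.mem_Ico] at hk
    obtain ⟨i, j, hP, hbk, t', ht', hkt⟩ := ht.exists_parallel hex he hpos
    have hlt : (t : ℤ) < 2 * B.n := by
      obtain ⟨t₁, h1, h2⟩ := exists_runDist hex k
      rwa [ht.unique h2]
    obtain ⟨h1, h2⟩ := B.mem_offPairs hP hbk (by omega) hlt
    refine ⟨_, h1, t, t', h2, ?_, ?_⟩
    · have := ht'.per (-(i / I.L))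
      rw [B.bk_emod]
      convert this using 1; ring
    · simp only
      rw [B.bk_emod, show B.bk i - i / I.L * (2 * B.n) - t' + t =
        k + (2 * B.n) * (-(i / I.L)) by linarith, Int.add_mul_emod_self_left,
        Int.emod_eq_of_lt hk.1 hk.2]
  choose! f hf using key
  refine Finset.card_le_card_of_injOn f (fun k hk => (hf k hk).1) ?_
  intro k hk k' hk' heq
  obtain ⟨-, t, t', h1, h2, h3⟩ := hf k hk
  obtain ⟨-, t₁, t₁', h1', h2', h3'⟩ := hf k' hk'
  rw [← heq] at h1' h2' h3'
  have ht : (t : ℤ) = t₁ := by rw [← h1, h1']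
  rw [h2.unique h2', ht] at h3
  rw [← h3, h3']

/-- A block at odd distance from the last sign change is preceded by one at even distance. So at
least half of the `2n` blocks are at even distance, and those at distance `0` are the sign changes.
-/
lemma le_card_evenBlocks (hex : ∃ k, B.SignChange k) :
    B.n ≤ B.evenBlocks.card + B.signChanges.card := by
  classical
  have hn := B.two_n_pos
  set ev : Finset ℤ := {k ∈ Finset.Ico (0 : ℤ) (2 * B.n) | ∃ t : ℕ, B.RunDist k t ∧ Even t}
    with hev
  set od : Finset ℤ := {k ∈ Finset.Ico (0 : ℤ) (2 * B.n) | ¬ ∃ t : ℕ, B.RunDist k t ∧ Even t}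
    with hod
  have h1 : ev.card + od.card = 2 * B.n := by
    rw [hev, hod, Finset.card_filter_add_card_filter_not]
    simp only [Int.card_Ico, sub_zero]; omega
  have h2 : ev.card ≤ B.evenBlocks.card + B.signChanges.card := by
    refine (Finset.card_le_card ?_).trans (Finset.card_union_le _ _)
    intro k hk
    obtain ⟨hk, t, ht, he⟩ := Finset.mem_filter.1 hk
    rcases Nat.eq_zero_or_pos t with rfl | hpos
    · exact Finset.mem_union_right _ (Finset.mem_filter.2 ⟨hk, by simpa using ht.1⟩)
    · exact Finset.mem_union_left _ (Finset.mem_filter.2 ⟨hk, t, ht, he, hpos⟩)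
  have h3 : od.card ≤ ev.card := by
    refine Finset.card_le_card_of_injOn (fun k => (k - 1) % (2 * B.n)) ?_ ?_
    · intro k hk
      obtain ⟨hk, hne⟩ := Finset.mem_filter.1 hk
      obtain ⟨t, -, ht⟩ := exists_runDist hex k
      have hodd : ¬ Even t := fun he => hne ⟨t, ht, he⟩
      have hpos : 0 < t := by
        rcases Nat.eq_zero_or_pos t with rfl | h
        · exact absurd (by decide) hodd
        · exact h
      refine Finset.mem_coe.2 (Finset.mem_filter.2 ⟨Finset.mem_Ico.2
        ⟨Int.emod_nonneg _ hn.ne', Int.emod_lt_of_pos _ hn⟩, t - 1, ?_, ?_⟩)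
      · have hr : B.RunDist (k - 1) (t - 1) := by
          refine ⟨?_, fun r hr => ?_⟩
          · have := ht.1
            convert this using 1; omega
          · have := ht.2 (r + 1) (by omega)
            convert this using 2; push_cast; ring
        have := hr.per (-((k - 1) / (2 * B.n)))
        have e := Int.emod_add_mul_ediv (k - 1) (2 * B.n)
        convert this using 1; linarith
      · rw [Nat.even_sub (by omega)]; simp [hodd]
    · intro k hk k' hk' he
      have hk := Finset.mem_Ico.1 (Finset.mem_filter.1 hk).1
      have hk' := Finset.mem_Ico.1 (Finset.mem_filter.1 hk').1
      have := congrArg (fun r => (r + 1) % (2 * (B.n : ℤ))) he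
      simpa [Int.emod_add_emod, Int.emod_eq_of_lt hk.1 hk.2, Int.emod_eq_of_lt hk'.1 hk'.2]
        using this
  omega

lemma pairCode_signChange : ∀ y z : Fin 4, z ≠ y.rev →
    (y.val % 2 ≠ z.val % 2 ↔ pairCode y.rev z = 2 ∨ pairCode y.rev z = 3) := by decide

lemma card_signChanges : B.signChanges.card = I.codeCount 2 + I.codeCount 3 := by
  classical
  have hu : I.codeCount 2 + I.codeCount 3 =
      {i ∈ Finset.Ico 0 I.L | I.code i = 2 ∨ I.code i = 3}.card := by
    rw [Finset.filter_or, Finset.card_union_of_disjoint]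
    · rfl
    · rw [Finset.disjoint_filter]
      intro i _ h1 h2
      rw [h1] at h2
      exact absurd h2 (by decide)
  rw [hu, ← Finset.card_image_of_injective _ B.E_strictMono.injective]
  congr 1
  ext i
  rw [Finset.mem_image, Finset.mem_filter]
  have hE : ∀ k, (I.x (B.E k - 1)).val % 2 ≠ (I.x (B.E k)).val % 2 ↔ B.SignChange k := by
    intro k
    have := B.x_E_sub_one (k - 1)
    rw [sub_add_cancel] at this
    rw [this, B.x_E]; rfl
  unfold Itinerary.code
  rw [← pairCode_signChange _ _ (I.red' i)]
  constructor
  · rintro ⟨k, hk, rfl⟩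
    obtain ⟨h1, h2⟩ := Finset.mem_filter.1 hk
    exact ⟨(B.E_mem_iff k).2 h1, (hE k).2 h2⟩
  · rintro ⟨h1, h2⟩
    obtain ⟨k, rfl⟩ := (B.x_pred_ne_iff i).1 (fun h => h2 (by rw [h]))
    exact ⟨k, Finset.mem_filter.2 ⟨(B.E_mem_iff k).1 h1, (hE k).1 h2⟩, rfl⟩

/-! ### The lower bound -/

lemma le_card_offPairs (hL : I.L ≠ 2 * B.n ∨ I.codeCount 2 ≠ 0) :
    (B.n : ℤ) - 1 ≤ B.offPairs.card + I.codeCount 2 ^ 2 := by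
  classical
  obtain ⟨h23, -⟩ := I.codeCount_eq
  have hs := B.card_signChanges
  by_cases hex : ∃ k, B.SignChange k
  · have h1 := B.card_evenBlocks_le hex
    have h2 := B.le_card_evenBlocks hex
    rw [hs, ← h23] at h2
    -- For `m = codeCount 2` this is `n - 2m + m² = n - 1 + (m - 1)²`.
    nlinarith [sq_nonneg ((I.codeCount 2 : ℤ) - 1)]
  · have h0 : I.codeCount 2 = 0 := by
      have : B.signChanges.card = 0 := Finset.card_eq_zero.2
        (Finset.eq_empty_of_forall_notMem fun k hk => hex ⟨k, (Finset.mem_filter.1 hk).2⟩)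
      omega
    have := B.card_offPairs_of_no_signChange (fun k hk => hex ⟨k, hk⟩)
      (hL.resolve_right fun h => h h0)
    rw [h0]; simpa using this

/-- The lower bound for the number of self-intersections. -/
lemma le_ncard (hL : I.L ≠ 2 * B.n ∨ I.codeCount 2 ≠ 0) :
    I.L - B.n - 1 ≤ {p ∈ I.orderedCrossings | p.1 < p.2}.ncard := by
  classical
  set Z : Finset (ℤ × ℤ) := {i ∈ Finset.Ico 0 I.L | I.code i = 2} ×ˢ
    {i ∈ Finset.Ico 0 I.L | I.code i = 3} with hZ
  set P : Finset (ℤ × ℤ) := I.box.filter fun q => I.Parallel q.1 q.2 with hP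
  have hZcard : Z.card = I.codeCount 2 ^ 2 := by
    rw [hZ, Finset.card_product, sq]
    nth_rewrite 2 [I.codeCount_eq.1]
    rfl
  -- These are the `L - 2n` crossings of blocks with themselves, one for each straight vertex.
  have hself : {i ∈ Finset.Ico 0 I.L | I.x (i - 1) = I.x i}.card ≤
      (P.filter fun q => ¬ B.bk q.1 ≠ B.bk q.2).card := by
    refine Finset.card_le_card_of_injOn (fun i => (i, B.E (B.bk i))) ?_ ?_
    · intro i hi
      obtain ⟨h1, h2⟩ := Finset.mem_filter.1 hi
      refine Finset.mem_coe.2 (Finset.mem_filter.2 ⟨Finset.mem_filter.2 ⟨?_, B.parallel_self h2⟩, ?_⟩)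
      · refine Finset.mem_product.2 ⟨h1, ?_⟩
        rw [B.E_mem_iff, Finset.mem_Ico]
        rw [Finset.mem_Ico] at h1
        have h3 := B.lt_E_bk i
        have h4 := B.E_bk_le i
        have h5 : B.E 0 < B.E (B.bk i + 1) := by rw [B.E_zero]; omega
        have h6 : B.E (B.bk i) < B.E (2 * B.n) := by rw [← B.L_eq]; omega
        rw [B.E_strictMono.lt_iff_lt] at h5 h6
        omega
      · simp only [not_not]; rw [B.bk_E]
    · intro i _ i' _ h
      exact (Prod.mk.inj h).1
  have hPcard : (P.filter fun q => ¬ B.bk q.1 ≠ B.bk q.2).card + B.offPairs.card = P.card := by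
    have : B.offPairs = P.filter fun q => B.bk q.1 ≠ B.bk q.2 := by
      rw [hP, Finset.filter_filter]; rfl
    rw [this, add_comm, Finset.card_filter_add_card_filter_not]
  have hZprop : ∀ q ∈ Z, q ∈ I.box ∧ I.Lk q.1 q.2 ∧ I.BackEnd q.1 q.2 ∧ I.x q.1 ≠ I.x q.2 := by
    intro q hq
    obtain ⟨h1, h2⟩ := Finset.mem_product.1 hq
    obtain ⟨h1, h1'⟩ := Finset.mem_filter.1 h1
    obtain ⟨h2, h2'⟩ := Finset.mem_filter.1 h2
    obtain ⟨a, b, c, d, e⟩ := sgn_of_pairCode _ _ _ _ h1' h2' (I.red' _) (I.red' _)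
    have d' : I.x (q.1 - 1) ≠ I.x (q.2 - 1) := fun h => d (by rw [h])
    exact ⟨Finset.mem_product.2 ⟨h1, h2⟩, (I.Lk_iff_of_distinct b c d' e).2 a, ⟨d', c, e⟩, b⟩
  have hPprop : ∀ q ∈ P, q ∈ I.box ∧ I.Parallel q.1 q.2 := fun q hq => Finset.mem_filter.1 hq
  have hLk : ∀ i j, I.Lk i j → I.Lk j i := by
    intro i j h
    unfold Itinerary.Lk at *
    rw [← entryProd_inv]
    convert h using 2
    unfold Itinerary.δ; group
  have hbox : ∀ q ∈ I.box, q.swap ∈ I.box := by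
    intro q hq
    obtain ⟨h1, h2⟩ := Finset.mem_product.1 hq
    exact Finset.mem_product.2 ⟨h2, h1⟩
  have hcode : ∀ q ∈ Z, I.code q.1 = 2 := fun q hq =>
    (Finset.mem_filter.1 (Finset.mem_product.1 hq).1).2
  have hcode' : ∀ q ∈ Z, I.code q.2 = 3 := fun q hq =>
    (Finset.mem_filter.1 (Finset.mem_product.1 hq).2).2
  have hdZ : Disjoint Z (Z.image Prod.swap) := by
    rw [Finset.disjoint_left]
    intro q hq hq'
    obtain ⟨q', hq'', rfl⟩ := Finset.mem_image.1 hq'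
    have h1 := hcode _ hq
    have h2 := hcode' _ hq''
    simp only [Prod.fst_swap] at h1
    rw [h1] at h2
    exact absurd h2 (by decide)
  have hdP : Disjoint P (P.image Prod.swap) := by
    rw [Finset.disjoint_left]
    intro q hq hq'
    obtain ⟨q', hq'', rfl⟩ := Finset.mem_image.1 hq'
    exact lt_asymm (hPprop _ hq).2.2.2.2 (hPprop _ hq'').2.2.2.2
  -- The pairs in `P` share their forward direction, those in `Z` do not.
  have hd : Disjoint (Z ∪ Z.image Prod.swap) (P ∪ P.image Prod.swap) := by
    have h1 : ∀ q ∈ Z ∪ Z.image Prod.swap, I.x q.1 ≠ I.x q.2 := by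
      intro q hq
      rcases Finset.mem_union.1 hq with hq | hq
      · exact (hZprop q hq).2.2.2
      · obtain ⟨q', hq', rfl⟩ := Finset.mem_image.1 hq
        exact (hZprop q' hq').2.2.2.symm
    have h2 : ∀ q ∈ P ∪ P.image Prod.swap, I.x q.1 = I.x q.2 := by
      intro q hq
      rcases Finset.mem_union.1 hq with hq | hq
      · exact (hPprop q hq).2.2.2.1
      · obtain ⟨q', hq', rfl⟩ := Finset.mem_image.1 hq
        exact (hPprop q' hq').2.2.2.1.symm
    rw [Finset.disjoint_left]
    exact fun q hq hq' => h1 q hq (h2 q hq')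
  -- Both orders of each pair are included, since `orderedCrossings` counts every self-intersection
  -- twice.
  have hle := I.card_backEnd_le ((Z ∪ Z.image Prod.swap) ∪ (P ∪ P.image Prod.swap)) (by
    intro q hq
    rcases Finset.mem_union.1 hq with hq | hq <;> rcases Finset.mem_union.1 hq with hq | hq
    · obtain ⟨a, b, c, -⟩ := hZprop q hq
      exact ⟨a, b, c⟩
    · obtain ⟨q', hq', rfl⟩ := Finset.mem_image.1 hq
      obtain ⟨a, b, c, -⟩ := hZprop q' hq'
      exact ⟨hbox _ a, hLk _ _ b, c.symm⟩
    · obtain ⟨a, b, c, -⟩ := hPprop q hq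
      exact ⟨a, b, c⟩
    · obtain ⟨q', hq', rfl⟩ := Finset.mem_image.1 hq
      obtain ⟨a, b, c, -⟩ := hPprop q' hq'
      exact ⟨hbox _ a, hLk _ _ b, c.symm⟩)
  rw [Finset.card_union_of_disjoint hd, Finset.card_union_of_disjoint hdZ,
    Finset.card_union_of_disjoint hdP, Finset.card_image_of_injective _ Prod.swap_injective,
    Finset.card_image_of_injective _ Prod.swap_injective, I.ncard_orderedCrossings] at hle
  have h1 := B.le_card_offPairs hL
  have h2 := B.card_straight
  generalize {p ∈ I.orderedCrossings | p.1 < p.2}.ncard = X at *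
  have h4 : (Z.card : ℤ) = I.codeCount 2 ^ 2 := by exact_mod_cast hZcard
  omega

end Blocks

/-! ### Construction of the ping-pong data and of the itinerary -/

lemma exists_partial_products {H : Type*} [Group H] (f : ℤ → H) :
    ∃ g : ℤ → H, g 0 = 1 ∧ ∀ i, g (i + 1) = g i * f i := by
  let P : ℕ → H := fun n => Nat.rec 1 (fun k p => p * f k) n
  let Q : ℕ → H := fun n => Nat.rec 1 (fun k p => p * (f (-(k + 1 : ℤ)))⁻¹) n
  refine ⟨fun i => match i with
    | Int.ofNat n => P n
    | Int.negSucc n => Q (n + 1), rfl, fun i => ?_⟩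
  match i with
  | Int.ofNat n => rfl
  | Int.negSucc 0 =>
    change P 0 = Q 1 * f (Int.negSucc 0)
    simp [P, Q, Int.negSucc_eq]
  | Int.negSucc (n + 1) =>
    have : Int.negSucc (n + 1) + 1 = Int.negSucc n := by omega
    rw [this]
    change Q (n + 1) = Q (n + 1) * (f (-((n + 1 : ℕ) + 1 : ℤ)))⁻¹ * f (Int.negSucc (n + 1))
    simp [Int.negSucc_eq]

lemma exists_partial_sums (f : ℤ → ℤ) : ∃ E : ℤ → ℤ, E 0 = 0 ∧ ∀ i, E (i + 1) = E i + f i := by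
  obtain ⟨g, h0, h1⟩ := exists_partial_products (fun i => Multiplicative.ofAdd (f i))
  refine ⟨fun i => (g i).toAdd, by simp [h0], fun i => by simp [h1]⟩

lemma pingPong_of_smul_eq {A h : SL(2, ℝ)} {c r c' r' : ℝ}
    (hA : A • (h • halfDisk c' r') = (h • openHalfDisk c r)ᶜ) :
    (∀ z : ℍ, z ∉ halfDisk c' r' → (h⁻¹ * A * h) • z ∈ halfDisk c r) ∧
    (∀ z : ℍ, z ∉ halfDisk c r → (h⁻¹ * A⁻¹ * h) • z ∈ halfDisk c' r') := by
  have hsub : openHalfDisk c r ⊆ halfDisk c r := fun z (hz : dist _ _ < r) =>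
    (show dist _ _ ≤ r from hz.le)
  constructor
  · intro z hz
    by_contra hc
    have h1 : h • ((h⁻¹ * A * h) • z) ∈ (h • openHalfDisk c r)ᶜ := by
      rw [Set.mem_compl_iff, Set.smul_mem_smul_set_iff]
      exact fun h => hc (hsub h)
    have e : h • ((h⁻¹ * A * h) • z) = A • h • z := by
      rw [← mul_smul, ← mul_smul]
      congr 1
      group
    rw [← hA, e, Set.smul_mem_smul_set_iff, Set.smul_mem_smul_set_iff] at h1
    exact hz h1
  · intro z hz
    have h1 : h • z ∈ (h • openHalfDisk c r)ᶜ := by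
      rw [Set.mem_compl_iff, Set.smul_mem_smul_set_iff]
      exact fun h => hz (hsub h)
    rw [← hA, Set.mem_smul_set_iff_inv_smul_mem, Set.mem_smul_set_iff_inv_smul_mem] at h1
    rwa [mul_smul, mul_smul]

/-- Listed in the order of their intervals, the letters are `a, b⁻¹, b, a⁻¹`, so that `Fin.rev` is
the inversion. -/
lemma exists_pingPong {a b : SL(2, ℝ)} (hab : IsPantsPair a b) :
    ∃ (h : SL(2, ℝ)) (S : PingPong), S.G 0 = h⁻¹ * a * h ∧ S.G 1 = h⁻¹ * b⁻¹ * h ∧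
      S.G 2 = h⁻¹ * b * h ∧ S.G 3 = h⁻¹ * a⁻¹ * h := by
  obtain ⟨h, xa, ra, xb', rb', xb, rb, xa', ra', h1, h2, h3, h4, s1, s2, s3, ha, hb⟩ := hab
  obtain ⟨pa, pa'⟩ := pingPong_of_smul_eq ha
  obtain ⟨pb, pb'⟩ := pingPong_of_smul_eq hb
  refine ⟨h, ⟨![h⁻¹ * a * h, h⁻¹ * b⁻¹ * h, h⁻¹ * b * h, h⁻¹ * a⁻¹ * h], ![xa, xb', xb, xa'],
    ![ra, rb', rb, ra'], ?_, ?_, ?_, ?_⟩, rfl, rfl, rfl, rfl⟩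
  · intro y
    fin_cases y
    · change h⁻¹ * a⁻¹ * h = (h⁻¹ * a * h)⁻¹; group
    · change h⁻¹ * b * h = (h⁻¹ * b⁻¹ * h)⁻¹; group
    · change h⁻¹ * b⁻¹ * h = (h⁻¹ * b * h)⁻¹; group
    · change h⁻¹ * a * h = (h⁻¹ * a⁻¹ * h)⁻¹; group
  · intro y
    fin_cases y <;> assumption
  · intro y y' hy
    fin_cases y <;> fin_cases y' <;> simp at hy ⊢ <;> linarith
  · intro y
    fin_cases y
    · exact fun p q hpq => cone_of_pingPong h1 h4 pa hpq
    · exact fun p q hpq => cone_of_pingPong h2 h3 pb' hpq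
    · exact fun p q hpq => cone_of_pingPong h3 h2 pb hpq
    · exact fun p q hpq => cone_of_pingPong h4 h1 pa' hpq

namespace BlockPattern
variable (B : BlockPattern)

/-- The word composed of the blocks. -/
noncomputable def letter (i : ℤ) : Fin 4 := B.lt (B.bk i)

lemma letter_of_mem {i k : ℤ} (h1 : B.E k ≤ i) (h2 : i < B.E (k + 1)) : B.letter i = B.lt k := by
  rw [letter, B.bk_eq h1 h2]

lemma letter_succ_ne (i : ℤ) : B.letter (i + 1) ≠ (B.letter i).rev := by
  have h1 := B.E_bk_le i
  have h2 := B.lt_E_bk i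
  rw [B.letter_of_mem h1 h2]
  by_cases h3 : i + 1 < B.E (B.bk i + 1)
  · rw [B.letter_of_mem (k := B.bk i) (by omega) h3]
    exact (by decide : ∀ y : Fin 4, y ≠ y.rev) _
  · rw [B.letter_of_mem (k := B.bk i + 1) (by omega)
      (by have := B.E_lt_succ (B.bk i + 1); omega)]
    have t1 := B.typ (B.bk i)
    have t2 := B.typ (B.bk i + 1)
    rw [Int.even_add_one, ← t1] at t2
    exact (by decide : ∀ y z : Fin 4, ((z = 0 ∨ z = 3) ↔ ¬ (y = 0 ∨ y = 3)) → z ≠ y.rev) _ _ t2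

lemma letter_per (i : ℤ) : B.letter (i + B.E (2 * B.n)) = B.letter i := by
  have h1 := B.E_bk_le i
  have h2 := B.lt_E_bk i
  rw [B.letter_of_mem h1 h2, B.letter_of_mem (k := B.bk i + 2 * B.n), B.lt_per]
  · rw [B.E_add_period]; omega
  · rw [add_right_comm, B.E_add_period]; omega

lemma period_pos : 0 < B.E (2 * B.n) := by
  have := B.E_strictMono (show (0 : ℤ) < 2 * B.n by have := B.n_pos; omega)
  rwa [B.E_zero] at this

/-- The partial products of the word. -/
lemma exists_prefixes (S : PingPong) : ∃ g : ℤ → SL(2, ℝ), g 0 = 1 ∧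
    (∀ i, g (i + 1) = g i * S.G (B.letter i)) ∧
    (∀ i, g (i + B.E (2 * B.n)) = g (B.E (2 * B.n)) * g i) ∧
    ∀ k, g (B.E (k + 1)) = g (B.E k) * S.G (B.lt k) ^ B.e k := by
  obtain ⟨g, h0, h1⟩ := exists_partial_products fun i => S.G (B.letter i)
  refine ⟨g, h0, h1, fun i => ?_, fun k => ?_⟩
  · induction i using Int.induction_on with
    | zero => rw [zero_add, h0, mul_one]
    | succ i ih => rw [add_right_comm, h1, h1, ih, B.letter_per, mul_assoc]
    | pred i ih =>
      have e1 := h1 (-(i : ℤ) - 1)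
      have e2 := h1 (-(i : ℤ) - 1 + B.E (2 * B.n))
      rw [sub_add_cancel] at e1
      rw [B.letter_per, show -(i : ℤ) - 1 + B.E (2 * B.n) + 1 = -i + B.E (2 * B.n) by ring, ih, e1,
        ← mul_assoc, mul_left_inj] at e2
      exact e2.symm
  · have : ∀ o : ℕ, o ≤ B.e k → g (B.E k + o) = g (B.E k) * S.G (B.lt k) ^ o := by
      intro o
      induction o with
      | zero => simp
      | succ o ih =>
        intro ho
        push_cast
        rw [← add_assoc, h1, ih (by omega), B.letter_of_mem (k := k) (by omega)
          (by rw [B.E_succ]; omega), pow_succ, mul_assoc]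
    rw [B.E_succ, this _ le_rfl]

end BlockPattern

section Word
variable {n : ℕ} (σ τ : Fin n → ℤˣ) (i j : Fin n → ℕ)

/-- The pattern of the word `s₁^{i₁} r₁^{j₁} ⋯ sₙ^{iₙ} rₙ^{jₙ}`. -/
lemma exists_blockPattern (hn : 0 < n) (hi : ∀ k, 0 < i k) (hj : ∀ k, 0 < j k) :
    ∃ B : BlockPattern, B.n = n ∧ ∀ k : Fin n, B.e (2 * (k : ℕ)) = i k ∧
      B.e (2 * (k : ℕ) + 1) = j k ∧ B.lt (2 * (k : ℕ)) = (if σ k = 1 then 0 else 3) ∧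
      B.lt (2 * (k : ℕ) + 1) = if τ k = 1 then 2 else 1 := by
  have hn' : (0 : ℤ) < n := by exact_mod_cast hn
  let idx : ℤ → Fin n := fun k => ⟨((k / 2) % n).toNat, by
    have h1 := Int.emod_nonneg (k / 2) hn'.ne'
    have h2 := Int.emod_lt_of_pos (k / 2) hn'
    omega⟩
  have hidx : ∀ k, idx (k + 2 * n) = idx k := by
    intro k
    have : (k + 2 * n) / 2 = k / 2 + n := by omega
    simp only [idx, this, Int.add_emod_right]
  have hidx0 : ∀ k : Fin n, idx (2 * (k : ℕ)) = k ∧ idx (2 * (k : ℕ) + 1) = k := by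
    intro k
    have hk := k.isLt
    have e1 : (2 * ((k : ℕ) : ℤ)) / 2 = (k : ℕ) := by omega
    have e2 : (2 * ((k : ℕ) : ℤ) + 1) / 2 = (k : ℕ) := by omega
    have e3 : (((k : ℕ) : ℤ) % n) = (k : ℕ) := Int.emod_eq_of_lt (by omega) (by omega)
    simp [idx, e1, e2, e3]
  have hev : ∀ k : ℤ, Even (k + 2 * n) ↔ Even k := by
    intro k; simp [Int.even_add]
  let e : ℤ → ℕ := fun k => if Even k then i (idx k) else j (idx k)
  let lt : ℤ → Fin 4 := fun k => if Even k then (if σ (idx k) = 1 then 0 else 3)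
    else (if τ (idx k) = 1 then 2 else 1)
  obtain ⟨E, hE0, hE1⟩ := exists_partial_sums fun k => (e k : ℤ)
  refine ⟨⟨n, e, E, lt, hn, ?_, hE0, hE1, ?_, ?_, ?_⟩, rfl, ?_⟩
  · intro k; simp only [e]; split_ifs
    · exact hi _
    · exact hj _
  · intro k; simp only [lt]; split_ifs with h1 h2 h2 <;> simp [h1]
  · intro k; simp only [e, hidx, hev]
  · intro k; simp only [lt, hidx, hev]
  · intro k
    obtain ⟨e1, e2⟩ := hidx0 k
    have h1 : Even (2 * ((k : ℕ) : ℤ)) := even_two_mul _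
    have h2 : ¬ Even (2 * ((k : ℕ) : ℤ) + 1) := by rw [Int.even_add_one, not_not]; exact h1
    simp only [e, lt, e1, e2, h1, h2, if_true, if_false, and_self]

lemma conj_word (a b h : SL(2, ℝ)) : h⁻¹ * word a b σ τ i j * h =
    (List.ofFn fun k => (h⁻¹ * a ^ (σ k : ℤ) * h) ^ i k *
      (h⁻¹ * b ^ (τ k : ℤ) * h) ^ j k).prod := by
  have : h⁻¹ * word a b σ τ i j * h = MulAut.conj h⁻¹ (word a b σ τ i j) := by simp
  rw [this, word, map_list_prod, List.map_ofFn]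
  congr 2
  funext k
  simp only [Function.comp, map_mul, map_pow, MulAut.conj_apply, inv_inv]

end Word

/-- The itinerary of the word, seen from a coordinate `h` of the hyperbolic plane. -/
lemma exists_itinerary {a b : SL(2, ℝ)} {n : ℕ} (hn : 0 < n) {σ τ : Fin n → ℤˣ}
    {i j : Fin n → ℕ} (hi : ∀ k, 0 < i k) (hj : ∀ k, 0 < j k) {ℓ : ℝ} {h M : SL(2, ℝ)}
    {S : PingPong} (h0 : S.G 0 = h⁻¹ * a * h) (h1 : S.G 1 = h⁻¹ * b⁻¹ * h)
    (h2 : S.G 2 = h⁻¹ * b * h) (h3 : S.G 3 = h⁻¹ * a⁻¹ * h) (hℓ : 0 < ℓ)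
    (hM : ∀ t, (M⁻¹ * word a b σ τ i j * M) • axisPoint t = axisPoint (t + ℓ)) :
    ∃ (I : Itinerary S) (B : Blocks I), I.M = h⁻¹ * M ∧ I.ℓ = ℓ ∧ B.n = n ∧
      I.L = combLength i j := by
  obtain ⟨B, hBn, hB⟩ := exists_blockPattern σ τ i j hn hi hj
  obtain ⟨g, g0, g1, g2, g3⟩ := B.exists_prefixes S
  have hG : ∀ k : Fin n, S.G (B.lt (2 * (k : ℕ))) = h⁻¹ * a ^ (σ k : ℤ) * h ∧
      S.G (B.lt (2 * (k : ℕ) + 1)) = h⁻¹ * b ^ (τ k : ℤ) * h := by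
    intro k
    obtain ⟨-, -, e1, e2⟩ := hB k
    constructor
    · rcases Int.units_eq_one_or (σ k) with hs | hs
      · rw [e1, hs, if_pos rfl, h0]; simp
      · rw [e1, hs, if_neg (by decide), h3]; simp
    · rcases Int.units_eq_one_or (τ k) with hs | hs
      · rw [e2, hs, if_pos rfl, h2]; simp
      · rw [e2, hs, if_neg (by decide), h1]; simp
  have hw : g (B.E (2 * B.n)) = h⁻¹ * word a b σ τ i j * h := by
    rw [conj_word, hBn]
    set F : Fin n → SL(2, ℝ) := fun k => (h⁻¹ * a ^ (σ k : ℤ) * h) ^ i k *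
      (h⁻¹ * b ^ (τ k : ℤ) * h) ^ j k with hF
    have key : ∀ q : Fin (n + 1), g (B.E (2 * (q : ℕ))) = Fin.partialProd F q := by
      intro q
      induction q using Fin.induction with
      | zero => simp [B.E_zero, g0]
      | succ q ih =>
        rw [Fin.partialProd_succ, ← ih, Fin.val_succ, Fin.val_castSucc]
        push_cast
        rw [show 2 * (((q : ℕ) : ℤ) + 1) = 2 * (q : ℕ) + 1 + 1 by ring, g3, g3, (hG q).1, (hG q).2,
          (hB q).1, (hB q).2.1, hF, mul_assoc]
    have := key (Fin.last n)
    rw [Fin.val_last] at this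
    rw [this, Fin.partialProd, Fin.val_last, List.take_of_length_le (by simp)]
  have hL : B.E (2 * B.n) = combLength i j := by
    have key : ∀ q : ℕ, B.E (2 * q) = ∑ m ∈ Finset.range q,
        ((B.e (2 * m) : ℤ) + B.e (2 * m + 1)) := by
      intro q
      induction q with
      | zero => simp [B.E_zero]
      | succ q ih =>
        push_cast
        rw [Finset.sum_range_succ, ← ih, show 2 * ((q : ℤ) + 1) = 2 * q + 1 + 1 by ring, B.E_succ,
          B.E_succ, add_assoc]
    rw [hBn, key, Finset.sum_range, combLength]
    push_cast
    exact Finset.sum_congr rfl fun k _ => by rw [(hB k).1, (hB k).2.1]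
  let I : Itinerary S :=
    { x := B.letter, g := g, L := B.E (2 * B.n), w := g (B.E (2 * B.n)), M := h⁻¹ * M, ℓ := ℓ
      red := B.letter_succ_ne, g_zero := g0, g_succ := g1, L_pos := B.period_pos
      x_per := B.letter_per, g_per := g2, ℓ_pos := hℓ
      axis := by
        intro t
        rw [← hM t, hw]
        congr 1; group }
  refine ⟨I, { B with x_eq := ?_, L_eq := rfl }, rfl, rfl, hBn, hL⟩
  intro k o ho ho'
  exact B.letter_of_mem (by omega) (by rw [B.E_succ]; omega)

lemma conj_mem_Gam_iff {a b h : SL(2, ℝ)} {S : PingPong} (h0 : S.G 0 = h⁻¹ * a * h)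
    (h1 : S.G 1 = h⁻¹ * b⁻¹ * h) (h2 : S.G 2 = h⁻¹ * b * h) (h3 : S.G 3 = h⁻¹ * a⁻¹ * h)
    (g : SL(2, ℝ)) : h⁻¹ * g * h ∈ S.Gam ↔ g ∈ group a b := by
  have hle : group a b ≤ S.Gam.comap (MulAut.conj h⁻¹).toMonoidHom := by
    rw [group, Subgroup.closure_le]
    rintro g (rfl | rfl)
    · have := S.G_mem 0
      rw [h0] at this
      simpa [Subgroup.mem_comap] using this
    · have := S.G_mem 2
      rw [h2] at this
      simpa [Subgroup.mem_comap] using this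
  have ha : a ∈ group a b := Subgroup.subset_closure (by simp)
  have hb : b ∈ group a b := Subgroup.subset_closure (by simp)
  have hge : S.Gam ≤ (group a b).comap (MulAut.conj h).toMonoidHom := by
    rw [PingPong.Gam, Subgroup.closure_le]
    rintro _ ⟨y, rfl⟩
    have : h * S.G y * h⁻¹ ∈ group a b := by
      fin_cases y
      · change h * S.G 0 * h⁻¹ ∈ _
        rw [h0]; simpa [mul_assoc] using ha
      · change h * S.G 1 * h⁻¹ ∈ _
        rw [h1]; simpa [mul_assoc] using hb
      · change h * S.G 2 * h⁻¹ ∈ _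
        rw [h2]; simpa [mul_assoc] using hb
      · change h * S.G 3 * h⁻¹ ∈ _
        rw [h3]; simpa [mul_assoc] using ha
    simpa [Subgroup.mem_comap] using this
  constructor
  · intro hg
    have := hge hg
    simpa [Subgroup.mem_comap, mul_assoc] using this
  · intro hg
    have := hle hg
    simpa [Subgroup.mem_comap] using this

/-! ### Conclusion -/

/-- Finiteness and the bounds for the number of self-intersections. -/
theorem ncard_selfIntersections_bounds (a b : SL(2, ℝ)) (hab : IsPantsPair a b)
    (n : ℕ) (hn : 0 < n) (σ τ : Fin n → ℤˣ) (i j : Fin n → ℕ)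
    (hi : ∀ k, 0 < i k) (hj : ∀ k, 0 < j k)
    (c : ℝ → ℍ) (ℓ : ℝ)
    (hc : IsClosedGeodesicLift (word a b σ τ i j) c ℓ)
    (hns : NonSimple (group a b) c) :
    (selfIntersections (group a b) c ℓ).Finite ∧
    (combLength i j : ℤ) - n - 1
      ≤ ((selfIntersections (group a b) c ℓ).ncard : ℤ) ∧
    ((selfIntersections (group a b) c ℓ).ncard : ℤ)
      ≤ n * (combLength i j : ℤ) - (n : ℤ) ^ 2 := by
  obtain ⟨⟨M, hM⟩, hℓ, hw⟩ := hc
  obtain ⟨h, S, h0, h1, h2, h3⟩ := exists_pingPong hab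
  obtain ⟨I, B, hIM, hIℓ, hBn, hL⟩ := exists_itinerary (σ := σ) (τ := τ) (i := i) (j := j)
    (M := M) hn hi hj h0 h1 h2 h3 hℓ (by
      intro t
      have := hw t
      rw [hM, hM] at this
      rw [mul_smul, mul_smul, this, inv_smul_smul])
  have hrange : Set.range c = M • Set.range axisPoint := by
    ext z
    constructor
    · rintro ⟨t, rfl⟩
      rw [hM]; exact ⟨_, ⟨t, rfl⟩, rfl⟩
    · rintro ⟨_, ⟨t, rfl⟩, rfl⟩
      exact ⟨t, hM t⟩
  have hK : ∀ g, I.M⁻¹ * (h⁻¹ * g * h) * I.M = M⁻¹ * g * M := by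
    intro g; rw [hIM]; group
  have hcross : ∀ g s t, (g • c s = c t ∧ g • Set.range c ≠ Set.range c) ↔
      ((I.M⁻¹ * (h⁻¹ * g * h) * I.M) • axisPoint s = axisPoint t ∧
        entryProd (I.M⁻¹ * (h⁻¹ * g * h) * I.M) < 0) := by
    intro g s t
    have e1 : g • c s = c t ↔ (M⁻¹ * g * M) • axisPoint s = axisPoint t := by
      rw [hM, hM, mul_smul, mul_smul, inv_smul_eq_iff]
    have e2 : g • Set.range c ≠ Set.range c ↔
        (M⁻¹ * g * M) • Set.range axisPoint ≠ Set.range axisPoint := by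
      rw [hrange, mul_smul, mul_smul, ne_eq, ne_eq, inv_smul_eq_iff]
    rw [hK, e1, e2]
    exact and_congr_right fun h => smul_range_axis_ne_iff h
  have hset : selfIntersections (group a b) c ℓ = {p ∈ I.orderedCrossings | p.1 < p.2} := by
    ext p
    constructor
    · rintro ⟨p1, p2, p3, g, hg, hgc⟩
      refine ⟨⟨p1, ?_, ?_, ?_, h⁻¹ * g * h, (conj_mem_Gam_iff h0 h1 h2 h3 g).2 hg,
        (hcross g _ _).1 hgc⟩, p2⟩
      · rw [hIℓ]; linarith
      · linarith
      · rw [hIℓ]; exact p3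
    · rintro ⟨⟨p1, -, -, p4, g, hg, hgc⟩, p2⟩
      rw [hIℓ] at p4
      refine ⟨p1, p2, p4, h * g * h⁻¹, ?_⟩
      have e : h⁻¹ * (h * g * h⁻¹) * h = g := by group
      rw [hcross, ← conj_mem_Gam_iff h0 h1 h2 h3, e]
      exact ⟨hg, hgc⟩
  have hne : I.orderedCrossings.Nonempty := by
    obtain ⟨g, hg, hne, z, ⟨_, ⟨s, rfl⟩, hs⟩, t, ht⟩ := hns
    have := (hcross g s t).1 ⟨hs.trans ht.symm, hne⟩
    obtain ⟨k, l, hδ⟩ := I.exists_δ ((conj_mem_Gam_iff h0 h1 h2 h3 g).2 hg) this.2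
    have hLk : I.Lk k l := by unfold Itinerary.Lk; rw [← hδ]; exact this.2
    obtain ⟨p, hp, -⟩ := I.exists_crossing_seenFrom (q := (k, l)) hLk
    exact ⟨p, hp⟩
  have hfin := I.finite_and_card_le_front.1
  obtain ⟨hm, hup⟩ := I.ncard_le_of_turns B.codeCount_turns
  have hpos : 0 < {p ∈ I.orderedCrossings | p.1 < p.2}.ncard := by
    have h4 := (Set.ncard_pos hfin).2 hne
    rw [I.ncard_orderedCrossings] at h4
    omega
  -- In the case excluded from `le_ncard`, where `L = 2n` and there is no sign change, the upper
  -- bound is `0`, although there is a crossing.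
  have hlow := B.le_ncard (by
    by_contra! hcon
    rw [hcon.1, hcon.2] at hup
    simp at hup
    omega)
  rw [hset, ← hL, ← hBn]
  refine ⟨hfin.subset fun p hp => hp.1, hlow, hup.trans ?_⟩
  -- The two upper bounds differ by `(n - m)²` with `m = codeCount 2`.
  nlinarith [sq_nonneg ((B.n : ℤ) - I.codeCount 2)]

end Pants

theorem theorem1 (a b : SL(2, ℝ)) (hab : Pants.IsPantsPair a b)
    (n : ℕ) (hn : 0 < n) (σ τ : Fin n → ℤˣ) (i j : Fin n → ℕ)
    (hi : ∀ k, 0 < i k) (hj : ∀ k, 0 < j k)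
    (c : ℝ → ℍ) (ℓ : ℝ)
    (hc : Pants.IsClosedGeodesicLift (Pants.word a b σ τ i j) c ℓ)
    (hns : Pants.NonSimple (Pants.group a b) c) :
    (Pants.selfIntersections (Pants.group a b) c ℓ).Finite ∧
    (Pants.combLength i j : ℤ) - n - 1
      ≤ ((Pants.selfIntersections (Pants.group a b) c ℓ).ncard : ℤ) ∧
    ((Pants.selfIntersections (Pants.group a b) c ℓ).ncard : ℤ)
      ≤ n * (Pants.combLength i j : ℤ) - (n : ℤ) ^ 2 :=
  Pants.ncard_selfIntersections_bounds a b hab n hn σ τ i j hi hj c ℓ hc hns
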